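/- Let $p,q:\mathbb{R}^n\to[1,\infty]$ be measurable, let $p_-,q_-$ and $p_+,q_+$ denote their essential infima and suprema, and assume $$1<p_-\le p_+<\infty,\qquad 1<q_-\le q_+<\infty .$$ For measurable $f$ put $$\varrho_{p(\cdot)}(f)=\int_{\{p<\infty\}}|f(x)|^{p(x)}\,dx+\|f\|_{L^\infty(\{p=\infty\})},$$ and for a sequence $f=(f_\nu)_{\nu}$ of (real or complex) measurable functions, identified when equal almost everywhere, put $$\varrho(f)=\sum_{\nu}\inf\Big\{\lambda>0:\ \varrho_{p(\cdot)}\big(f_\nu/\lambda^{1/q(\cdot)}\big)\le 1\Big\}\in[0,\infty]\qquad(\lambda^{1/\infty}:=1).$$ Let $$\ell^{q(\cdot)}(L^{p(\cdot)})=\{f:\ \varrho(f/\lambda)<\infty\text{ for some }\lambda>0\},\qquad \|f\|=\inf\{\mu>0:\ \varrho(f/\mu)\le 1\}.$$ In general $\|\cdot\|$ is a quasi-norm; assume that it satisfies the triangle inequality, so that $\ell^{q(\cdot)}(L^{p(\cdot)})$ is a normed space. Then its dual space $X^*=(\ell^{q(\cdot)}(L^{p(\cdot)}))^*$, with the dual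 norm, is Gateaux smooth: for every $x\in X^*$ with $\|x\|=1$ and every $y\in X^*$, the limit $$\lim_{t\to0,\ t\in\mathbb{R}}\frac{\|x+ty\|-\|x\|}{t}$$ exists. -/

import Mathlib

open scoped ENNReal Topology
open MeasureTheory Filter

/-- A variable exponent `p : ℝⁿ → [1, ∞]`: a measurable function (the class `𝒫`). -/
structure VarExponent (n : ℕ) where
  toFun : EuclideanSpace ℝ (Fin n) → ℝ≥0∞
  measurable_toFun : Measurable toFun
  one_le : ∀ x, 1 ≤ toFun x

namespace VarExponent

instance {n : ℕ} : CoeFun (VarExponent n) (fun _ => EuclideanSpace ℝ (Fin n) → ℝ≥0∞) := ⟨toFun⟩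

/-- The essential infimum `p₋`. -/
noncomputable def minus {n : ℕ} (p : VarExponent n) : ℝ≥0∞ := essInf p.toFun volume

/-- The essential supremum `p₊`. -/
noncomputable def plus {n : ℕ} (p : VarExponent n) : ℝ≥0∞ := essSup p.toFun volume

end VarExponent

namespace VarMixed

variable {n : ℕ} {𝕜 : Type*} [RCLike 𝕜]

/-- The modular of `L^{p(·)}(ℝⁿ)`:
`∫_{p < ∞} |f(x)|^{p(x)} dx + ‖f‖_{L^∞({p = ∞})}`. -/
noncomputable def lebModular (p : VarExponent n) (f : EuclideanSpace ℝ (Fin n) → 𝕜) : ℝ≥0∞ :=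
  (∫⁻ x in {x | p x ≠ ∞}, ‖f x‖ₑ ^ (p x).toReal) +
    eLpNormEssSup f (volume.restrict {x | p x = ∞})

/-- One summand of the modular of the mixed space:
`inf {l > 0 : ϱ_{p(·)}(f / l^{1/q(·)}) ≤ 1}` in `[0, ∞]`; here `l^{1/∞} = 1`. -/
noncomputable def mixedTerm (p q : VarExponent n) (f : EuclideanSpace ℝ (Fin n) → 𝕜) : ℝ≥0∞ :=
  ⨅ (l : ℝ) (_ : 0 < l)
    (_ : lebModular p (fun x => (l ^ ((q x)⁻¹).toReal)⁻¹ • f x) ≤ 1), ENNReal.ofReal l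

/-- The modular of `ℓ^{q(·)}(L^{p(·)})`, on sequences of functions. -/
noncomputable def mixedModular (p q : VarExponent n)
    (f : ℕ → EuclideanSpace ℝ (Fin n) → 𝕜) : ℝ≥0∞ :=
  ∑' ν, mixedTerm p q (f ν)

lemma lebModular_mono (p : VarExponent n) {f g : EuclideanSpace ℝ (Fin n) → 𝕜}
    (h : ∀ᵐ x, ‖f x‖ ≤ ‖g x‖) : lebModular p f ≤ lebModular p g := by
  unfold lebModular
  refine add_le_add (lintegral_mono_ae ?_) (eLpNormEssSup_mono_enorm_ae ?_)
  · filter_upwards [ae_restrict_of_ae h] with x hx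
    exact ENNReal.rpow_le_rpow (enorm_le_iff_norm_le.2 hx) ENNReal.toReal_nonneg
  · filter_upwards [ae_restrict_of_ae h] with x hx
    exact enorm_le_iff_norm_le.2 hx

lemma mixedTerm_mono (p q : VarExponent n) {f g : EuclideanSpace ℝ (Fin n) → 𝕜}
    (h : ∀ᵐ x, ‖f x‖ ≤ ‖g x‖) : mixedTerm p q f ≤ mixedTerm p q g := by
  unfold mixedTerm
  refine iInf_mono fun l => iInf_mono fun hl => le_iInf fun hg => ?_
  refine iInf_le_of_le (le_trans (lebModular_mono p ?_) hg) le_rfl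
  filter_upwards [h] with x hx
  rw [norm_smul, norm_smul]
  gcongr

lemma mixedModular_mono (p q : VarExponent n) {f g : ℕ → EuclideanSpace ℝ (Fin n) → 𝕜}
    (h : ∀ ν, ∀ᵐ x, ‖f ν x‖ ≤ ‖g ν x‖) : mixedModular p q f ≤ mixedModular p q g :=
  ENNReal.tsum_le_tsum fun ν => mixedTerm_mono p q (h ν)

lemma inv_toReal_mem (q : VarExponent n) (x : EuclideanSpace ℝ (Fin n)) :
    0 ≤ ((q x)⁻¹).toReal ∧ ((q x)⁻¹).toReal ≤ 1 := by
  refine ⟨ENNReal.toReal_nonneg, ?_⟩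
  have h : (q x)⁻¹ ≤ 1 := ENNReal.inv_le_one.2 (q.one_le x)
  simpa using ENNReal.toReal_mono ENNReal.one_ne_top h

lemma mixedTerm_scale (p q : VarExponent n) (f : EuclideanSpace ℝ (Fin n) → 𝕜) {K : ℝ}
    (hK : 1 ≤ K) :
    ENNReal.ofReal K * mixedTerm p q (fun x => K⁻¹ • f x) ≤ mixedTerm p q f := by
  have hK0 : 0 < K := by linarith
  conv_rhs => unfold mixedTerm
  refine le_iInf fun l => le_iInf fun hl => le_iInf fun h => ?_
  have h1 : mixedTerm p q (fun x => K⁻¹ • f x) ≤ ENNReal.ofReal (l / K) := by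
    unfold mixedTerm
    refine iInf_le_of_le (l / K) (iInf_le_of_le (by positivity) (iInf_le_of_le ?_ le_rfl))
    refine le_trans (lebModular_mono p (Eventually.of_forall fun x => ?_)) h
    obtain ⟨h0, h1⟩ := inv_toReal_mem q x
    rw [smul_smul, norm_smul, norm_smul, Real.div_rpow hl.le hK0.le]
    have hKe : K ^ ((q x)⁻¹).toReal ≤ K := by
      simpa using Real.rpow_le_rpow_of_exponent_le hK h1
    have hlp : 0 < l ^ ((q x)⁻¹).toReal := by positivity
    have hkp : 0 < K ^ ((q x)⁻¹).toReal := by positivity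
    refine mul_le_mul_of_nonneg_right ?_ (norm_nonneg _)
    rw [Real.norm_of_nonneg (by positivity), Real.norm_of_nonneg (by positivity), inv_div,
      div_mul_eq_mul_div, inv_eq_one_div (l ^ _)]
    refine div_le_div_of_nonneg_right ?_ hlp.le
    rw [← div_eq_mul_inv]
    exact (div_le_one hK0).2 hKe
  calc ENNReal.ofReal K * mixedTerm p q (fun x => K⁻¹ • f x)
      ≤ ENNReal.ofReal K * ENNReal.ofReal (l / K) := by gcongr
    _ = ENNReal.ofReal l := by
      rw [← ENNReal.ofReal_mul hK0.le]
      congr 1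
      field_simp

lemma mixedModular_scale (p q : VarExponent n) (f : ℕ → EuclideanSpace ℝ (Fin n) → 𝕜) {K : ℝ}
    (hK : 1 ≤ K) :
    ENNReal.ofReal K * mixedModular p q (fun ν x => K⁻¹ • f ν x) ≤ mixedModular p q f := by
  unfold mixedModular
  rw [← ENNReal.tsum_mul_left]
  exact ENNReal.tsum_le_tsum fun ν => mixedTerm_scale p q (f ν) hK

lemma one_le_toReal (p : VarExponent n) {x : EuclideanSpace ℝ (Fin n)} (h : p x ≠ ∞) :
    1 ≤ (p x).toReal := by
  simpa using ENNReal.toReal_mono h (p.one_le x)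

lemma lebModular_add (p : VarExponent n) {u v : EuclideanSpace ℝ (Fin n) → 𝕜}
    (hu : AEStronglyMeasurable u)
    (hu1 : lebModular p u ≤ 1) (hv1 : lebModular p v ≤ 1) :
    lebModular p (fun x => (4 : ℝ)⁻¹ • (u x + v x)) ≤ 1 := by
  have hmeas : MeasurableSet {x | p x ≠ ∞} :=
    (p.measurable_toFun (measurableSet_singleton (∞ : ℝ≥0∞))).compl
  have h4 : ‖(4 : ℝ)⁻¹‖ₑ ≤ (2 : ℝ≥0∞)⁻¹ := by
    rw [← ofReal_norm, Real.norm_of_nonneg (by norm_num), ENNReal.ofReal_inv_of_pos (by norm_num)]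
    gcongr
    rw [show (2 : ℝ≥0∞) = ENNReal.ofReal 2 by simp]
    exact ENNReal.ofReal_le_ofReal (by norm_num)
  have hpt : ∀ x, p x ≠ ∞ → ‖(4 : ℝ)⁻¹ • (u x + v x)‖ₑ ^ (p x).toReal ≤
      (2 : ℝ≥0∞)⁻¹ * (‖u x‖ₑ ^ (p x).toReal + ‖v x‖ₑ ^ (p x).toReal) := by
    intro x hx
    have hp1 := one_le_toReal p hx
    have hp0 : 0 ≤ (p x).toReal := by linarith
    have hm : ‖(4 : ℝ)⁻¹ • (u x + v x)‖ₑ ≤ (2 : ℝ≥0∞)⁻¹ * max ‖u x‖ₑ ‖v x‖ₑ := by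
      have h4' : ‖(4 : ℝ)⁻¹‖ₑ = (2 : ℝ≥0∞)⁻¹ * 2⁻¹ := by
        rw [← ofReal_norm, Real.norm_of_nonneg (by norm_num),
          show (4 : ℝ)⁻¹ = 2⁻¹ * 2⁻¹ by norm_num, ENNReal.ofReal_mul (by norm_num),
          ENNReal.ofReal_inv_of_pos (by norm_num)]
        simp
      rw [enorm_smul, h4', mul_assoc]
      gcongr
      calc (2 : ℝ≥0∞)⁻¹ * ‖u x + v x‖ₑ
          ≤ 2⁻¹ * (max ‖u x‖ₑ ‖v x‖ₑ + max ‖u x‖ₑ ‖v x‖ₑ) := by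
            gcongr
            exact (enorm_add_le _ _).trans (add_le_add (le_max_left _ _) (le_max_right _ _))
        _ = max ‖u x‖ₑ ‖v x‖ₑ := by
            rw [← two_mul, ← mul_assoc, ENNReal.inv_mul_cancel (by norm_num) (by norm_num),
              one_mul]
    calc ‖(4 : ℝ)⁻¹ • (u x + v x)‖ₑ ^ (p x).toReal
        ≤ ((2 : ℝ≥0∞)⁻¹ * max ‖u x‖ₑ ‖v x‖ₑ) ^ (p x).toReal := ENNReal.rpow_le_rpow hm hp0
      _ = (2 : ℝ≥0∞)⁻¹ ^ (p x).toReal * max ‖u x‖ₑ ‖v x‖ₑ ^ (p x).toReal :=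
          ENNReal.mul_rpow_of_nonneg _ _ hp0
      _ ≤ (2 : ℝ≥0∞)⁻¹ * (‖u x‖ₑ ^ (p x).toReal + ‖v x‖ₑ ^ (p x).toReal) := by
          gcongr
          · simpa using ENNReal.rpow_le_rpow_of_exponent_ge
              (ENNReal.inv_le_one.2 (by norm_num : (1 : ℝ≥0∞) ≤ 2)) hp1
          · rcases le_total ‖u x‖ₑ ‖v x‖ₑ with h | h
            · rw [max_eq_right h]; exact le_add_self
            · rw [max_eq_left h]; exact le_self_add
  have hA : (∫⁻ x in {x | p x ≠ ∞}, ‖(4 : ℝ)⁻¹ • (u x + v x)‖ₑ ^ (p x).toReal) ≤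
      (2 : ℝ≥0∞)⁻¹ * ((∫⁻ x in {x | p x ≠ ∞}, ‖u x‖ₑ ^ (p x).toReal) +
        ∫⁻ x in {x | p x ≠ ∞}, ‖v x‖ₑ ^ (p x).toReal) := by
    have hum : AEMeasurable (fun x => ‖u x‖ₑ ^ (p x).toReal)
        (volume.restrict {x | p x ≠ ∞}) :=
      (hu.enorm.pow p.measurable_toFun.ennreal_toReal.aemeasurable).restrict
    rw [← lintegral_add_left' hum, ← lintegral_const_mul' _ _ (by simp)]
    refine lintegral_mono_ae ?_
    filter_upwards [ae_restrict_mem hmeas] with x hx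
    exact hpt x hx
  have hB : eLpNormEssSup (fun x => (4 : ℝ)⁻¹ • (u x + v x)) (volume.restrict {x | p x = ∞}) ≤
      (2 : ℝ≥0∞)⁻¹ * (eLpNormEssSup u (volume.restrict {x | p x = ∞}) +
        eLpNormEssSup v (volume.restrict {x | p x = ∞})) := by
    have := eLpNormEssSup_const_smul_le (c := (4 : ℝ)⁻¹) (f := u + v)
      (μ := volume.restrict {x | p x = ∞})
    refine le_trans this ?_
    exact mul_le_mul' h4 eLpNormEssSup_add_le
  unfold lebModular at hu1 hv1 ⊢
  refine (add_le_add hA hB).trans ?_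
  rw [← mul_add, add_add_add_comm]
  calc _ ≤ (2 : ℝ≥0∞)⁻¹ * (1 + 1) := by gcongr
    _ = 1 := by
      rw [one_add_one_eq_two]
      exact ENNReal.inv_mul_cancel (by norm_num) (by norm_num)

lemma aesm_scale (q : VarExponent n) {f : EuclideanSpace ℝ (Fin n) → 𝕜}
    (hf : AEStronglyMeasurable f) (l : ℝ) :
    AEStronglyMeasurable (fun x => (l ^ ((q x)⁻¹).toReal)⁻¹ • f x) := by
  have hm : Measurable fun x => (l ^ ((q x)⁻¹).toReal)⁻¹ :=
    (measurable_const.pow q.measurable_toFun.inv.ennreal_toReal).inv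
  exact hm.aestronglyMeasurable.smul hf

lemma mixedTerm_add (p q : VarExponent n) {f g : EuclideanSpace ℝ (Fin n) → 𝕜}
    (hf : AEStronglyMeasurable f) :
    mixedTerm p q (fun x => (4 : ℝ)⁻¹ • (f x + g x)) ≤ mixedTerm p q f + mixedTerm p q g := by
  conv_rhs => unfold mixedTerm
  simp only [ENNReal.iInf_add, ENNReal.add_iInf]
  refine le_iInf fun a => le_iInf fun ha => le_iInf fun hfa => ?_
  refine le_iInf fun b => le_iInf fun hb => le_iInf fun hgb => ?_
  rw [← ENNReal.ofReal_add hb.le ha.le]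
  unfold mixedTerm
  refine iInf_le_of_le (b + a) (iInf_le_of_le (by positivity) (iInf_le_of_le ?_ le_rfl))
  have hmono : ∀ (c d : ℝ) (h : EuclideanSpace ℝ (Fin n) → 𝕜), 0 < c → c ≤ d →
      lebModular p (fun x => (c ^ ((q x)⁻¹).toReal)⁻¹ • h x) ≤ 1 →
      lebModular p (fun x => (d ^ ((q x)⁻¹).toReal)⁻¹ • h x) ≤ 1 := by
    intro c d h hc hcd hle
    refine le_trans (lebModular_mono p (Eventually.of_forall fun x => ?_)) hle
    obtain ⟨h0, h1⟩ := inv_toReal_mem q x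
    have hd : 0 < d := by linarith
    rw [norm_smul, norm_smul]
    gcongr
    rw [Real.norm_of_nonneg (by positivity), Real.norm_of_nonneg (by positivity)]
    gcongr
  have key := lebModular_add p (v := fun x => ((b + a) ^ ((q x)⁻¹).toReal)⁻¹ • g x)
    (aesm_scale q hf (b + a))
    (hmono b _ f hb (by linarith) hgb) (hmono a _ g ha (by linarith) hfa)
  refine le_trans (lebModular_mono p (Eventually.of_forall fun x => le_of_eq ?_)) key
  congr 1
  rw [← smul_add, smul_comm]

/-- Membership in `ℓ^{q(·)}(L^{p(·)})` for a sequence of measurable functions, taken up to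
equality almost everywhere: `ϱ(f / l) < ∞` for some `l > 0`. -/
def MemMixed (p q : VarExponent n) (f : ℕ → (EuclideanSpace ℝ (Fin n) →ₘ[volume] 𝕜)) : Prop :=
  ∃ l : ℝ, 0 < l ∧ mixedModular p q (fun ν x => l⁻¹ • f ν x) < ∞

lemma MemMixed.add {p q : VarExponent n} {f g : ℕ → (EuclideanSpace ℝ (Fin n) →ₘ[volume] 𝕜)}
    (hf : MemMixed p q f) (hg : MemMixed p q g) : MemMixed p q (f + g) := by
  obtain ⟨a, ha, hfa⟩ := hf
  obtain ⟨b, hb, hgb⟩ := hg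
  have hmono : ∀ (c d : ℝ) (h : ℕ → (EuclideanSpace ℝ (Fin n) →ₘ[volume] 𝕜)), 0 < c → c ≤ d →
      mixedModular p q (fun ν x => c⁻¹ • h ν x) < ∞ →
      mixedModular p q (fun ν x => d⁻¹ • h ν x) < ∞ := by
    intro c d h hc hcd hlt
    refine lt_of_le_of_lt (mixedModular_mono p q fun ν => Eventually.of_forall fun x => ?_) hlt
    have hd : 0 < d := by linarith
    rw [norm_smul, norm_smul, Real.norm_of_nonneg (by positivity),
      Real.norm_of_nonneg (by positivity)]
    gcongr
  have h1 := hmono a (a + b) f ha (by linarith) hfa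
  have h2 := hmono b (a + b) g hb (by linarith) hgb
  refine ⟨4 * (a + b), by positivity, ?_⟩
  refine lt_of_le_of_lt ?_ (ENNReal.add_lt_top.2 ⟨h1, h2⟩)
  unfold mixedModular
  rw [← ENNReal.tsum_add]
  refine ENNReal.tsum_le_tsum fun ν => ?_
  refine le_trans (mixedTerm_mono p q ?_) (mixedTerm_add p q
    (g := fun x => (a + b)⁻¹ • g ν x)
    ((f ν).aestronglyMeasurable.const_smul (a + b)⁻¹))
  filter_upwards [AEEqFun.coeFn_add (f ν) (g ν)] with x hx
  simp only [Pi.add_apply] at hx ⊢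
  rw [hx, ← smul_add, smul_smul, ← mul_inv]

lemma MemMixed.smul {p q : VarExponent n} {f : ℕ → (EuclideanSpace ℝ (Fin n) →ₘ[volume] 𝕜)}
    (c : 𝕜) (hf : MemMixed p q f) : MemMixed p q (c • f) := by
  obtain ⟨a, ha, hfa⟩ := hf
  have hc : 0 < ‖c‖ + 1 := by positivity
  refine ⟨(‖c‖ + 1) * a, by positivity, lt_of_le_of_lt (mixedModular_mono p q fun ν => ?_) hfa⟩
  filter_upwards [AEEqFun.coeFn_smul c (f ν)] with x hx
  simp only [Pi.smul_apply] at hx ⊢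
  rw [hx, norm_smul, norm_smul, norm_smul, Real.norm_of_nonneg (by positivity),
    Real.norm_of_nonneg (by positivity), mul_inv]
  have : (‖c‖ + 1)⁻¹ * ‖c‖ ≤ 1 := by
    rw [inv_mul_le_iff₀ hc]; linarith
  calc (‖c‖ + 1)⁻¹ * a⁻¹ * (‖c‖ * ‖f ν x‖) = ((‖c‖ + 1)⁻¹ * ‖c‖) * (a⁻¹ * ‖f ν x‖) := by ring
    _ ≤ 1 * (a⁻¹ * ‖f ν x‖) := by gcongr
    _ = _ := one_mul _

lemma lebModular_zero (p : VarExponent n) {f : EuclideanSpace ℝ (Fin n) → 𝕜}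
    (h : ∀ᵐ x, f x = 0) : lebModular p f = 0 := by
  have hmeas : MeasurableSet {x | p x ≠ ∞} :=
    (p.measurable_toFun (measurableSet_singleton (∞ : ℝ≥0∞))).compl
  unfold lebModular
  rw [add_eq_zero]
  constructor
  · rw [← lintegral_zero (μ := volume.restrict {x | p x ≠ ∞})]
    refine lintegral_congr_ae ?_
    filter_upwards [ae_restrict_of_ae h, ae_restrict_mem hmeas] with x hx hp
    have := one_le_toReal p hp
    rw [hx, enorm_zero, ENNReal.zero_rpow_of_pos (by linarith)]
  · exact eLpNormEssSup_eq_zero_iff.2 (ae_restrict_of_ae h)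

lemma mixedTerm_zero (p q : VarExponent n) {f : EuclideanSpace ℝ (Fin n) → 𝕜}
    (h : ∀ᵐ x, f x = 0) : mixedTerm p q f = 0 := by
  refine le_antisymm (le_of_forall_pos_le_add fun ε hε => ?_) bot_le
  rw [zero_add]
  rcases eq_or_ne ε ∞ with rfl | hne
  · exact le_top
  have h0 : 0 < ε.toReal := ENNReal.toReal_pos hε.ne' hne
  unfold mixedTerm
  refine iInf_le_of_le ε.toReal (iInf_le_of_le h0 (iInf_le_of_le ?_ ?_))
  · rw [lebModular_zero]
    · exact zero_le_one
    · filter_upwards [h] with x hx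
      rw [hx, smul_zero]
  · rw [ENNReal.ofReal_toReal hne]

lemma memMixed_zero (p q : VarExponent n) :
    MemMixed p q (0 : ℕ → (EuclideanSpace ℝ (Fin n) →ₘ[volume] 𝕜)) := by
  refine ⟨1, one_pos, ?_⟩
  have : mixedModular p q (fun (ν : ℕ) x => (1 : ℝ)⁻¹ •
      (0 : ℕ → (EuclideanSpace ℝ (Fin n) →ₘ[volume] 𝕜)) ν x) = 0 := by
    unfold mixedModular
    refine ENNReal.tsum_eq_zero.2 fun ν => mixedTerm_zero p q ?_
    filter_upwards [AEEqFun.coeFn_zero (α := EuclideanSpace ℝ (Fin n)) (β := 𝕜)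
      (μ := volume)] with x hx
    simp only [Pi.zero_apply] at hx ⊢
    rw [hx, smul_zero]
  rw [this]
  exact ENNReal.zero_lt_top

variable (𝕜) in
/-- `ℓ^{q(·)}(L^{p(·)}(ℝⁿ))` as a linear subspace of all sequences of (classes of) measurable
functions. -/
noncomputable def mixedSubmodule (p q : VarExponent n) :
    Submodule 𝕜 (ℕ → (EuclideanSpace ℝ (Fin n) →ₘ[volume] 𝕜)) where
  carrier := {f | MemMixed p q f}
  zero_mem' := memMixed_zero p q
  add_mem' := MemMixed.add
  smul_mem' c _ hf := MemMixed.smul c hf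

variable (𝕜) in
/-- The space `ℓ^{q(·)}(L^{p(·)}(ℝⁿ))`. It is a type of its own so that its only topology is the
one of its norm. -/
def MixedSpace (p q : VarExponent n) : Type _ := mixedSubmodule 𝕜 p q

noncomputable instance (p q : VarExponent n) : AddCommGroup (MixedSpace 𝕜 p q) :=
  inferInstanceAs (AddCommGroup (mixedSubmodule 𝕜 p q))

noncomputable instance (p q : VarExponent n) : Module 𝕜 (MixedSpace 𝕜 p q) :=
  inferInstanceAs (Module 𝕜 (mixedSubmodule 𝕜 p q))

/-- The sequence of (classes of) functions underlying an element of the space. -/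
def MixedSpace.seq {p q : VarExponent n} (f : MixedSpace 𝕜 p q) :
    ℕ → (EuclideanSpace ℝ (Fin n) →ₘ[volume] 𝕜) := f.1

/-- The Luxemburg functional `inf {μ > 0 : ϱ(f / μ) ≤ 1}`. -/
noncomputable def luxNorm {p q : VarExponent n} (f : MixedSpace 𝕜 p q) : ℝ :=
  sInf {μ : ℝ | 0 < μ ∧ mixedModular p q (fun ν x => μ⁻¹ • f.seq ν x) ≤ 1}

variable (𝕜) in
/-- The Luxemburg functional of `ℓ^{q(·)}(L^{p(·)})` satisfies the triangle inequality, so that it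
is a norm (in general it is only a quasi-norm). -/
def LuxTriangle (p q : VarExponent n) : Prop :=
  ∀ f g : MixedSpace 𝕜 p q, luxNorm (f + g) ≤ luxNorm f + luxNorm g

lemma luxSet_nonempty {p q : VarExponent n} (f : MixedSpace 𝕜 p q) :
    {μ : ℝ | 0 < μ ∧ mixedModular p q (fun ν x => μ⁻¹ • f.seq ν x) ≤ 1}.Nonempty := by
  obtain ⟨l, hl, hfin⟩ : MemMixed p q f.seq := f.2
  set ρ := mixedModular p q (fun ν x => l⁻¹ • f.seq ν x) with hρ
  set K : ℝ := max 1 ρ.toReal with hKdef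
  have hK : 1 ≤ K := le_max_left _ _
  have hK0 : 0 < K := by linarith
  refine ⟨K * l, by positivity, ?_⟩
  have h := mixedModular_scale p q (fun ν x => l⁻¹ • f.seq ν x) hK
  simp only [smul_smul, ← mul_inv] at h
  have hle : mixedModular p q (fun ν x => l⁻¹ • f.seq ν x) ≤ ENNReal.ofReal K := by
    rw [← hρ, ← ENNReal.ofReal_toReal hfin.ne]
    exact ENNReal.ofReal_le_ofReal (le_max_right _ _)
  have h2 : ENNReal.ofReal K * mixedModular p q (fun ν x => (K * l)⁻¹ • f.seq ν x) ≤
      ENNReal.ofReal K * 1 := by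
    rw [mul_one]; exact h.trans hle
  exact (ENNReal.mul_le_mul_iff_right (ENNReal.ofReal_pos.2 hK0).ne' ENNReal.ofReal_ne_top).1 h2

lemma luxSet_bddBelow {p q : VarExponent n} (f : MixedSpace 𝕜 p q) :
    BddBelow {μ : ℝ | 0 < μ ∧ mixedModular p q (fun ν x => μ⁻¹ • f.seq ν x) ≤ 1} :=
  ⟨0, fun _ h => h.1.le⟩

lemma luxNorm_nonneg {p q : VarExponent n} (f : MixedSpace 𝕜 p q) : 0 ≤ luxNorm f :=
  Real.sInf_nonneg fun _ h => h.1.le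

lemma luxNorm_zero {p q : VarExponent n} : luxNorm (0 : MixedSpace 𝕜 p q) = 0 := by
  refine le_antisymm (le_of_forall_pos_le_add fun ε hε => ?_) (luxNorm_nonneg _)
  rw [zero_add]
  refine csInf_le (luxSet_bddBelow _) ⟨hε, ?_⟩
  have : mixedModular p q (fun ν x => ε⁻¹ • (0 : MixedSpace 𝕜 p q).seq ν x) = 0 := by
    unfold mixedModular
    refine ENNReal.tsum_eq_zero.2 fun ν => mixedTerm_zero p q ?_
    filter_upwards [AEEqFun.coeFn_zero (α := EuclideanSpace ℝ (Fin n)) (β := 𝕜)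
      (μ := volume)] with x hx
    have hx' : (0 : MixedSpace 𝕜 p q).seq ν x = 0 := hx
    rw [hx', smul_zero]
  rw [this]
  exact zero_le_one

lemma luxNorm_smul_le {p q : VarExponent n} {c : 𝕜} (hc : c ≠ 0) (f : MixedSpace 𝕜 p q) :
    luxNorm (c • f) ≤ ‖c‖ * luxNorm f := by
  have hc0 : 0 < ‖c‖ := norm_pos_iff.2 hc
  rw [← div_le_iff₀' hc0]
  refine le_csInf (luxSet_nonempty f) fun μ hμ => ?_
  rw [div_le_iff₀' hc0]
  have hμ0 : 0 < μ := hμ.1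
  refine csInf_le (luxSet_bddBelow _) ⟨by positivity, le_trans ?_ hμ.2⟩
  refine mixedModular_mono p q fun ν => ?_
  filter_upwards [AEEqFun.coeFn_smul c (f.seq ν)] with x hx
  have hx' : (c • f).seq ν x = c • f.seq ν x := hx
  rw [hx', norm_smul, norm_smul, norm_smul, Real.norm_of_nonneg (by positivity),
    Real.norm_of_nonneg (by positivity)]
  apply le_of_eq
  field_simp

lemma luxNorm_smul {p q : VarExponent n} (c : 𝕜) (f : MixedSpace 𝕜 p q) :
    luxNorm (c • f) = ‖c‖ * luxNorm f := by
  rcases eq_or_ne c 0 with rfl | hc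
  · rw [zero_smul, luxNorm_zero, norm_zero, zero_mul]
  refine le_antisymm (luxNorm_smul_le hc f) ?_
  have h := luxNorm_smul_le (inv_ne_zero hc) (c • f)
  rw [smul_smul, inv_mul_cancel₀ hc, one_smul, norm_inv] at h
  rwa [le_inv_mul_iff₀ (norm_pos_iff.2 hc)] at h

lemma lebModular_scale (p : VarExponent n) (f : EuclideanSpace ℝ (Fin n) → 𝕜) {k : ℝ}
    (hk : 1 ≤ k) : ENNReal.ofReal k * lebModular p f ≤ lebModular p (fun x => k • f x) := by
  have hk0 : 0 ≤ k := by linarith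
  have hke : ‖k‖ₑ = ENNReal.ofReal k := by
    rw [← ofReal_norm, Real.norm_of_nonneg hk0]
  have hmeas : MeasurableSet {x | p x ≠ ∞} :=
    (p.measurable_toFun (measurableSet_singleton (∞ : ℝ≥0∞))).compl
  unfold lebModular
  rw [mul_add]
  refine add_le_add ?_ ?_
  · rw [← lintegral_const_mul' _ _ ENNReal.ofReal_ne_top]
    refine lintegral_mono_ae ?_
    filter_upwards [ae_restrict_mem hmeas] with x hx
    have hp1 := one_le_toReal p hx
    rw [enorm_smul, ENNReal.mul_rpow_of_nonneg _ _ (by linarith), hke]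
    gcongr
    have h1 : (1 : ℝ≥0∞) ≤ ENNReal.ofReal k := by simpa using ENNReal.ofReal_le_ofReal hk
    simpa using ENNReal.rpow_le_rpow_of_exponent_le h1 hp1
  · have := eLpNormEssSup_const_smul (c := k) (f := f)
      (μ := volume.restrict {x | p x = ∞})
    rw [← hke]
    exact this.ge

lemma ae_zero_of_lebModular (p : VarExponent n) {f : EuclideanSpace ℝ (Fin n) → 𝕜}
    (hf : AEStronglyMeasurable f) (h : lebModular p f = 0) : ∀ᵐ x, f x = 0 := by
  have hmeas : MeasurableSet {x | p x ≠ ∞} :=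
    (p.measurable_toFun (measurableSet_singleton (∞ : ℝ≥0∞))).compl
  have hmeas' : MeasurableSet {x | p x = ∞} :=
    p.measurable_toFun (measurableSet_singleton (∞ : ℝ≥0∞))
  unfold lebModular at h
  obtain ⟨h1, h2⟩ := add_eq_zero.1 h
  have hum : AEMeasurable (fun x => ‖f x‖ₑ ^ (p x).toReal) (volume.restrict {x | p x ≠ ∞}) :=
    (hf.enorm.pow p.measurable_toFun.ennreal_toReal.aemeasurable).restrict
  have h1' := (ae_restrict_iff' hmeas).1 ((lintegral_eq_zero_iff' hum).1 h1)
  have h2' := (ae_restrict_iff' hmeas').1 (eLpNormEssSup_eq_zero_iff.1 h2)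
  filter_upwards [h1', h2'] with x hx1 hx2
  by_cases hp : p x = ∞
  · exact hx2 hp
  · have := one_le_toReal p hp
    have hz : ‖f x‖ₑ ^ (p x).toReal = 0 := hx1 hp
    rw [ENNReal.rpow_eq_zero_iff_of_pos (by linarith)] at hz
    exact enorm_eq_zero.1 hz

lemma eq_zero_of_luxNorm {p q : VarExponent n} (f : MixedSpace 𝕜 p q) (h : luxNorm f = 0) :
    f = 0 := by
  have hbound : ∀ (ν : ℕ) (k : ℝ), 1 ≤ k → lebModular p (fun x => k • f.seq ν x) ≤ 1 := by
    intro ν k hk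
    have hk0 : 0 < k := by linarith
    obtain ⟨μ, ⟨hμ0, hμ⟩, hμk⟩ := exists_lt_of_csInf_lt (luxSet_nonempty f)
      (show luxNorm f < (2 * k)⁻¹ by rw [h]; positivity)
    have hterm : mixedTerm p q (fun x => μ⁻¹ • f.seq ν x) < ENNReal.ofReal 2 :=
      lt_of_le_of_lt ((ENNReal.le_tsum ν).trans hμ) (by simp)
    unfold mixedTerm at hterm
    simp only [iInf_lt_iff] at hterm
    obtain ⟨l, hl, hle, hl2⟩ := hterm
    have hl2' : l < 2 := (ENNReal.ofReal_lt_ofReal_iff (by norm_num)).1 hl2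
    refine le_trans (lebModular_mono p (Eventually.of_forall fun x => ?_)) hle
    obtain ⟨h0, h1⟩ := inv_toReal_mem q x
    have hlq : l ^ ((q x)⁻¹).toReal ≤ 2 :=
      calc l ^ ((q x)⁻¹).toReal ≤ 2 ^ ((q x)⁻¹).toReal := Real.rpow_le_rpow hl.le hl2'.le h0
        _ ≤ 2 := by
          simpa using Real.rpow_le_rpow_of_exponent_le (by norm_num : (1 : ℝ) ≤ 2) h1
    have hlp : 0 < l ^ ((q x)⁻¹).toReal := by positivity
    rw [smul_smul, norm_smul, norm_smul]
    refine mul_le_mul_of_nonneg_right ?_ (norm_nonneg _)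
    rw [Real.norm_of_nonneg hk0.le, Real.norm_of_nonneg (by positivity), ← mul_inv,
      le_inv_comm₀ hk0 (by positivity)]
    calc l ^ ((q x)⁻¹).toReal * μ ≤ 2 * (2 * k)⁻¹ := by gcongr
      _ = k⁻¹ := by field_simp
  have hzero : ∀ ν, lebModular p (fun x => f.seq ν x) = 0 := by
    intro ν
    by_contra hne
    have h1 : lebModular p (fun x => f.seq ν x) ≤ 1 := by simpa using hbound ν 1 le_rfl
    have hfin : lebModular p (fun x => f.seq ν x) ≠ ∞ := ne_top_of_le_ne_top (by simp) h1
    set a := (lebModular p (fun x => f.seq ν x)).toReal with ha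
    have ha0 : 0 < a := ENNReal.toReal_pos hne hfin
    have ha1 : a ≤ 1 := by simpa using ENNReal.toReal_mono ENNReal.one_ne_top h1
    have hk : 1 ≤ 2 / a := by rw [le_div_iff₀ ha0]; linarith
    have hs := (lebModular_scale p (fun x => f.seq ν x) hk).trans (hbound ν _ hk)
    rw [← ENNReal.ofReal_toReal hfin, ← ha, ← ENNReal.ofReal_mul (by positivity),
      div_mul_cancel₀ _ ha0.ne', ENNReal.ofReal_le_one] at hs
    norm_num at hs
  refine Subtype.ext (funext fun ν => ?_)
  refine AEEqFun.ext ?_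
  filter_upwards [ae_zero_of_lebModular p (f.seq ν).aestronglyMeasurable (hzero ν),
    AEEqFun.coeFn_zero (α := EuclideanSpace ℝ (Fin n)) (β := 𝕜) (μ := volume)] with x hx hx0
  exact hx.trans hx0.symm

noncomputable instance {p q : VarExponent n} : Norm (MixedSpace 𝕜 p q) := ⟨luxNorm⟩

lemma mixedSpace_core {p q : VarExponent n} (h : LuxTriangle 𝕜 p q) :
    NormedSpace.Core 𝕜 (MixedSpace 𝕜 p q) where
  norm_nonneg := luxNorm_nonneg
  norm_smul := luxNorm_smul
  norm_triangle := h
  norm_eq_zero_iff f := ⟨eq_zero_of_luxNorm f, fun hf => hf ▸ luxNorm_zero⟩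

/-- If the Luxemburg functional satisfies the triangle inequality, it makes
`ℓ^{q(·)}(L^{p(·)})` a normed space. -/
noncomputable instance {p q : VarExponent n} [h : Fact (LuxTriangle 𝕜 p q)] :
    NormedAddCommGroup (MixedSpace 𝕜 p q) :=
  NormedAddCommGroup.ofCore (mixedSpace_core h.out)

noncomputable instance {p q : VarExponent n} [h : Fact (LuxTriangle 𝕜 p q)] :
    NormedSpace 𝕜 (MixedSpace 𝕜 p q) :=
  NormedSpace.ofCore (mixedSpace_core h.out)

end VarMixed

/-- A normed space is Gateaux smooth if `lim_{t → 0} (‖x + t y‖ - ‖x‖) / t` (real `t`) exists for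
all `x` in the unit sphere and all `y`. -/
def IsGateauxSmooth (𝕜 X : Type*) [RCLike 𝕜] [NormedAddCommGroup X] [NormedSpace 𝕜 X] : Prop :=
  ∀ x : X, ‖x‖ = 1 → ∀ y : X, ∃ l : ℝ,
    Tendsto (fun t : ℝ => (‖x + (t : 𝕜) • y‖ - ‖x‖) / t) (𝓝[≠] 0) (𝓝 l)

/-! Off a null set the exponents are finite and bounded, and a summand of the modular is the level
of |f|: the infimum of the l > 0 with ∫ |f|^P l^(-S) ≤ 1, where S = P/Q. Two properties of the mixed
space X are proved and joined in `isGateauxSmooth_dual`: X is strictly convex, and if two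
functionals satisfy joint lower bounds approximately on the unit ball, they satisfy them exactly at
some point of it. The second property replaces weak compactness. A norm-one x then attains its norm
at exactly one u0, and its derivative in direction y is Re y(u0). Evaluation at u0 gives the lower
bound. If the upper bound failed as t → 0+, almost maximizers of x + ty would almost maximize x
while Re y exceeds Re y(u0) by a fixed amount on them, and attainment would give a second maximizer
of x.

Strict convexity (`eq_of_norm_add_eq_two`): the triangle inequality makes the level midpoint convex
(`midpointConvex_of_luxTriangle`). If equality holds at the midpoint of F, G ≥ 0 with positive
levels, the level is affine at the five quarter points of the segment, and convexity makes its
derivative the same at all five. Up to the factor P, this derivative has density ω = U^(P-1) l^(-S)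
/ Z. Since ∫ ωU = 1/Z, the number 1/Z is affine along the segment too, and the constancy of log ω at
a point x relates the logarithms of three affine functions of the parameter. By `affine_rigidity`,
either F = G, or F and G are in the ratio of their levels, and then integration against ω gives
ratio 1. Strict monotonicity of the level and the parallelogram law for scalars do the rest.

Attainment (`exists_attains`): let C_k be the part of the ball where the bounds hold up to 1/(k+1).
Almost minimizers over C_k of an integral of sqrt(1+|u|²) converge almost everywhere along a
subsequence (`exists_seq_tendsto_ae`), and by Fatou the limit v lies in the ball. The functionals
pass to the limit because bounded sequences tending to 0 almost everywhere have arbitrarily small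
averages (`exists_average_small`): sums over sparse finite sets of indices are nearly pointwise
maxima, and a maximum of M elements of the ball has norm at most 2 M^(1/r) with r = min(p0, q0) > 1.
-/

/-! ### Levels of functions -/

/-- A pair of measurable exponents bounded away from `1` and from `∞`. -/
structure ExponentPair (α : Type*) [MeasurableSpace α] where
  P : α → ℝ
  Q : α → ℝ
  p0 : ℝ
  p1 : ℝ
  q0 : ℝ
  q1 : ℝ
  measurable_P : Measurable P
  measurable_Q : Measurable Q
  one_lt_p0 : 1 < p0
  one_lt_q0 : 1 < q0
  p0_le : ∀ x, p0 ≤ P x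
  le_p1 : ∀ x, P x ≤ p1
  q0_le : ∀ x, q0 ≤ Q x
  le_q1 : ∀ x, Q x ≤ q1

namespace ExponentPair

variable {α : Type*} [MeasurableSpace α] {μ : Measure α} (e : ExponentPair α)

/-- The ratio of the two exponents. -/
noncomputable def S (x : α) : ℝ := e.P x / e.Q x

lemma one_lt_P (x : α) : 1 < e.P x := e.one_lt_p0.trans_le (e.p0_le x)
lemma one_lt_Q (x : α) : 1 < e.Q x := e.one_lt_q0.trans_le (e.q0_le x)
lemma P_pos (x : α) : 0 < e.P x := one_pos.trans (e.one_lt_P x)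
lemma Q_pos (x : α) : 0 < e.Q x := one_pos.trans (e.one_lt_Q x)
lemma S_pos (x : α) : 0 < e.S x := div_pos (e.P_pos x) (e.Q_pos x)
lemma measurable_S : Measurable e.S := e.measurable_P.div e.measurable_Q

/-- A lower bound of the ratio of the exponents. -/
noncomputable def s0 : ℝ := 1 / max e.q1 1
/-- An upper bound of the ratio of the exponents. -/
noncomputable def s1 : ℝ := max e.p1 1

lemma s0_pos : 0 < e.s0 := div_pos one_pos (lt_max_of_lt_right one_pos)
lemma s1_pos : 0 < e.s1 := lt_max_of_lt_right one_pos

lemma s0_le (x : α) : e.s0 ≤ e.S x :=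
  div_le_div₀ (e.P_pos x).le (e.one_lt_P x).le (e.Q_pos x) ((e.le_q1 x).trans (le_max_left _ _))

lemma le_s1 (x : α) : e.S x ≤ e.s1 :=
  (div_le_self (e.P_pos x).le (e.one_lt_Q x).le).trans ((e.le_p1 x).trans (le_max_left _ _))

/-- The integral `∫ |f|^P l^{-P/Q}`. -/
noncomputable def levelIntegral (μ : Measure α) (l : ℝ) (f : α → ℝ) : ℝ≥0∞ :=
  ∫⁻ x, ENNReal.ofReal (|f x| ^ e.P x * l ^ (-e.S x)) ∂μ

/-- The infimum of all `l > 0` for which the level integral is at most `1`. -/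
noncomputable def level (μ : Measure α) (f : α → ℝ) : ℝ≥0∞ :=
  ⨅ (l : ℝ) (_ : 0 < l) (_ : e.levelIntegral μ l f ≤ 1), ENNReal.ofReal l

variable {e}

lemma aemeasurable_integrand {f : α → ℝ} (hf : AEMeasurable f μ) (l : ℝ) :
    AEMeasurable (fun x => |f x| ^ e.P x * l ^ (-e.S x)) μ := by
  have h1 : AEMeasurable (fun x => |f x|) μ := hf.norm
  exact (h1.pow e.measurable_P.aemeasurable).mul
    ((measurable_const.pow e.measurable_S.neg).aemeasurable)

lemma levelIntegral_mono {l : ℝ} (hl : 0 < l) {f g : α → ℝ} (h : ∀ᵐ x ∂μ, |f x| ≤ |g x|) :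
    e.levelIntegral μ l f ≤ e.levelIntegral μ l g := by
  refine lintegral_mono_ae ?_
  filter_upwards [h] with x hx
  have := e.P_pos x
  gcongr

/-- Since l/m ≤ 1 and S ≥ `s0`, the pointwise factor (l/m)^S is at most (l/m)^`s0`. This is the
decay rate of the integral in the level; `levelIntegral_le_of_ge` bounds its growth in the other
direction. -/
lemma levelIntegral_le_of_le {l m : ℝ} (hl : 0 < l) (hlm : l ≤ m) (f : α → ℝ) :
    e.levelIntegral μ m f ≤ ENNReal.ofReal ((l / m) ^ e.s0) * e.levelIntegral μ l f := by
  have hm : 0 < m := hl.trans_le hlm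
  unfold levelIntegral
  rw [← lintegral_const_mul' _ _ ENNReal.ofReal_ne_top]
  refine lintegral_mono fun x => ?_
  rw [← ENNReal.ofReal_mul (by positivity)]
  refine ENNReal.ofReal_le_ofReal ?_
  have h1 : m ^ (-e.S x) = (l / m) ^ e.S x * l ^ (-e.S x) := by
    rw [Real.div_rpow hl.le hm.le, Real.rpow_neg hm.le, Real.rpow_neg hl.le]
    have := Real.rpow_pos_of_pos hl (e.S x)
    field_simp
  have h2 : (l / m) ^ e.S x ≤ (l / m) ^ e.s0 :=
    Real.rpow_le_rpow_of_exponent_ge (by positivity) ((div_le_one hm).2 hlm) (e.s0_le x)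
  rw [h1]
  calc |f x| ^ e.P x * ((l / m) ^ e.S x * l ^ (-e.S x))
      = (l / m) ^ e.S x * (|f x| ^ e.P x * l ^ (-e.S x)) := by ring
    _ ≤ _ := by gcongr

lemma levelIntegral_le_of_ge {l m : ℝ} (hl : 0 < l) (hlm : l ≤ m) (f : α → ℝ) :
    e.levelIntegral μ l f ≤ ENNReal.ofReal ((m / l) ^ e.s1) * e.levelIntegral μ m f := by
  have hm : 0 < m := hl.trans_le hlm
  unfold levelIntegral
  rw [← lintegral_const_mul' _ _ ENNReal.ofReal_ne_top]
  refine lintegral_mono fun x => ?_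
  rw [← ENNReal.ofReal_mul (by positivity)]
  refine ENNReal.ofReal_le_ofReal ?_
  have h1 : l ^ (-e.S x) = (m / l) ^ e.S x * m ^ (-e.S x) := by
    rw [Real.div_rpow hm.le hl.le, Real.rpow_neg hm.le, Real.rpow_neg hl.le]
    have := Real.rpow_pos_of_pos hm (e.S x)
    field_simp
  have h2 : (m / l) ^ e.S x ≤ (m / l) ^ e.s1 :=
    Real.rpow_le_rpow_of_exponent_le ((one_le_div hl).2 hlm) (e.le_s1 x)
  rw [h1]
  calc |f x| ^ e.P x * ((m / l) ^ e.S x * m ^ (-e.S x))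
      = (m / l) ^ e.S x * (|f x| ^ e.P x * m ^ (-e.S x)) := by ring
    _ ≤ _ := by gcongr

lemma levelIntegral_antitone {l m : ℝ} (hl : 0 < l) (hlm : l ≤ m) (f : α → ℝ) :
    e.levelIntegral μ m f ≤ e.levelIntegral μ l f := by
  refine (levelIntegral_le_of_le hl hlm f).trans ?_
  refine mul_le_of_le_one_left zero_le ?_
  rw [ENNReal.ofReal_le_one]
  have hm : 0 < m := hl.trans_le hlm
  exact Real.rpow_le_one (by positivity) ((div_le_one hm).2 hlm) e.s0_pos.le

/-- The integral at l is at most (m/l)^`s1` times an integral bounded by 1 for every m > l, and m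
tends to l. So a positive finite infimum is attained, and comparisons of levels become comparisons
of integrals at one fixed l. -/
lemma level_le_ofReal_iff {l : ℝ} (hl : 0 < l) {f : α → ℝ} :
    e.level μ f ≤ ENNReal.ofReal l ↔ e.levelIntegral μ l f ≤ 1 := by
  constructor
  · intro h
    have key : ∀ m, l < m → e.levelIntegral μ l f ≤ ENNReal.ofReal ((m / l) ^ e.s1) := by
      intro m hm
      have h1 : e.level μ f < ENNReal.ofReal m :=
        h.trans_lt ((ENNReal.ofReal_lt_ofReal_iff (hl.trans hm)).2 hm)
      unfold level at h1
      simp only [iInf_lt_iff] at h1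
      obtain ⟨k, hk, hk1, hkm⟩ := h1
      have hkm' : k < m := (ENNReal.ofReal_lt_ofReal_iff (hl.trans hm)).1 hkm
      calc e.levelIntegral μ l f ≤ ENNReal.ofReal ((m / l) ^ e.s1) * e.levelIntegral μ m f :=
            levelIntegral_le_of_ge hl hm.le f
        _ ≤ ENNReal.ofReal ((m / l) ^ e.s1) * 1 := by
            gcongr
            exact (levelIntegral_antitone hk hkm'.le f).trans hk1
        _ = _ := mul_one _
    have ht : Tendsto (fun m : ℝ => ENNReal.ofReal ((m / l) ^ e.s1)) (𝓝[>] l) (𝓝 1) := by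
      have h0 : ContinuousAt (fun m : ℝ => ENNReal.ofReal ((m / l) ^ e.s1)) l := by
        refine ENNReal.continuous_ofReal.continuousAt.comp ?_
        exact (continuousAt_id.div_const l).rpow_const (Or.inr e.s1_pos.le)
      have h1 := h0.tendsto
      simp only [div_self hl.ne', Real.one_rpow, ENNReal.ofReal_one] at h1
      exact h1.mono_left nhdsWithin_le_nhds
    exact ge_of_tendsto ht (eventually_mem_nhdsWithin.mono key)
  · intro h
    exact iInf_le_of_le l (iInf_le_of_le hl (iInf_le_of_le h le_rfl))

lemma le_level {f : α → ℝ} {c : ℝ≥0∞}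
    (h : ∀ l : ℝ, 0 < l → e.level μ f ≤ ENNReal.ofReal l → c ≤ ENNReal.ofReal l) :
    c ≤ e.level μ f :=
  le_iInf fun l => le_iInf fun hl => le_iInf fun hle => h l hl ((level_le_ofReal_iff hl).2 hle)

lemma level_mono {f g : α → ℝ} (h : ∀ᵐ x ∂μ, |f x| ≤ |g x|) : e.level μ f ≤ e.level μ g :=
  le_level fun _ hl hg => (level_le_ofReal_iff hl).2
    ((levelIntegral_mono hl h).trans ((level_le_ofReal_iff hl).1 hg))

lemma level_congr {f g : α → ℝ} (h : ∀ᵐ x ∂μ, |f x| = |g x|) : e.level μ f = e.level μ g :=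
  le_antisymm (level_mono (h.mono fun _ hx => hx.le)) (level_mono (h.mono fun _ hx => hx.ge))

lemma level_lt_top_iff {f : α → ℝ} : e.level μ f < ∞ ↔ e.levelIntegral μ 1 f < ∞ := by
  constructor
  · intro h
    set m : ℝ := max 1 (e.level μ f).toReal with hm
    have hm1 : 1 ≤ m := le_max_left _ _
    have hle : e.level μ f ≤ ENNReal.ofReal m := by
      rw [← ENNReal.ofReal_toReal h.ne]
      exact ENNReal.ofReal_le_ofReal (le_max_right _ _)
    have h1 := (level_le_ofReal_iff (one_pos.trans_le hm1)).1 hle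
    refine (levelIntegral_le_of_ge one_pos hm1 f).trans_lt ?_
    exact ENNReal.mul_lt_top ENNReal.ofReal_lt_top (h1.trans_lt ENNReal.one_lt_top)
  · intro h
    have ht : Tendsto (fun m : ℝ => ENNReal.ofReal ((1 / m) ^ e.s0) * e.levelIntegral μ 1 f) atTop
        (𝓝 (0 * e.levelIntegral μ 1 f)) := by
      refine ENNReal.Tendsto.mul_const ?_ (Or.inr h.ne)
      rw [← ENNReal.ofReal_zero]
      refine (ENNReal.continuous_ofReal.tendsto 0).comp ?_
      have h1 : Tendsto (fun m : ℝ => 1 / m) atTop (𝓝 0) := by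
        simpa using tendsto_inv_atTop_zero (𝕜 := ℝ)
      have h2 := h1.rpow_const (p := e.s0) (Or.inr e.s0_pos.le)
      rwa [Real.zero_rpow e.s0_pos.ne'] at h2
    rw [zero_mul] at ht
    obtain ⟨m, hm1, hm⟩ := ((eventually_ge_atTop (1 : ℝ)).and
      (ht.eventually_le_const (zero_lt_one))).exists
    refine lt_of_le_of_lt ((level_le_ofReal_iff (one_pos.trans_le hm1)).2 ?_)
      ENNReal.ofReal_lt_top
    exact (levelIntegral_le_of_le one_pos hm1 f).trans hm

lemma levelIntegral_lt_top {f : α → ℝ} (h : e.level μ f < ∞) {l : ℝ} (hl : 0 < l) :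
    e.levelIntegral μ l f < ∞ := by
  have h1 := level_lt_top_iff.1 h
  rcases le_total l 1 with h2 | h2
  · exact (levelIntegral_le_of_ge hl h2 f).trans_lt (ENNReal.mul_lt_top ENNReal.ofReal_lt_top h1)
  · exact (levelIntegral_antitone one_pos h2 f).trans_lt h1

/-- For m < l the integral at m exceeds 1, yet it is at most (l/m)^`s1` times the integral at l; let
m tend to l. This normalization allows the level to be differentiated implicitly. -/
lemma levelIntegral_eq_one {f : α → ℝ} {l : ℝ} (hl : 0 < l)
    (h : e.level μ f = ENNReal.ofReal l) : e.levelIntegral μ l f = 1 := by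
  refine le_antisymm ((level_le_ofReal_iff hl).1 h.le) ?_
  have key : ∀ m, 0 < m → m < l → 1 ≤ ENNReal.ofReal ((l / m) ^ e.s1) * e.levelIntegral μ l f := by
    intro m hm hml
    refine le_trans ?_ (levelIntegral_le_of_ge hm hml.le f)
    by_contra hlt
    have := (level_le_ofReal_iff hm).2 (not_le.1 hlt).le
    rw [h, ENNReal.ofReal_le_ofReal_iff hm.le] at this
    linarith
  have ht : Tendsto (fun m : ℝ => ENNReal.ofReal ((l / m) ^ e.s1) * e.levelIntegral μ l f)
      (𝓝[<] l) (𝓝 (1 * e.levelIntegral μ l f)) := by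
    refine ENNReal.Tendsto.mul_const ?_ (Or.inl one_ne_zero)
    have h0 : ContinuousAt (fun m : ℝ => ENNReal.ofReal ((l / m) ^ e.s1)) l := by
      refine ENNReal.continuous_ofReal.continuousAt.comp ?_
      exact (continuousAt_const.div continuousAt_id hl.ne').rpow_const (Or.inr e.s1_pos.le)
    have h1 := h0.tendsto
    simp only [div_self hl.ne', Real.one_rpow, ENNReal.ofReal_one] at h1
    exact h1.mono_left nhdsWithin_le_nhds
  rw [one_mul] at ht
  refine ge_of_tendsto ht ?_
  filter_upwards [eventually_mem_nhdsWithin,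
    nhdsWithin_le_nhds (lt_mem_nhds hl)] with m h1 h2 using key m h2 h1

lemma ae_eq_zero_of_level {f : α → ℝ} (hf : AEMeasurable f μ) (h : e.level μ f = 0) :
    ∀ᵐ x ∂μ, f x = 0 := by
  have h1 : e.levelIntegral μ 1 f = 0 := by
    refine le_antisymm ?_ zero_le
    have key : ∀ l : ℝ, 0 < l → l < 1 → e.levelIntegral μ 1 f ≤ ENNReal.ofReal (l ^ e.s0) := by
      intro l hl hl1
      have h1 := (level_le_ofReal_iff (e := e) (μ := μ) (f := f) hl).1 (by rw [h]; exact zero_le)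
      calc _ ≤ _ := levelIntegral_le_of_le hl hl1.le f
        _ ≤ ENNReal.ofReal ((l / 1) ^ e.s0) * 1 := by gcongr
        _ = _ := by rw [mul_one, div_one]
    have ht : Tendsto (fun l : ℝ => ENNReal.ofReal (l ^ e.s0)) (𝓝[>] 0) (𝓝 0) := by
      have h0 : ContinuousAt (fun l : ℝ => ENNReal.ofReal (l ^ e.s0)) 0 :=
        ENNReal.continuous_ofReal.continuousAt.comp
          (continuousAt_id.rpow_const (Or.inr e.s0_pos.le))
      have h1 := h0.tendsto
      simp only [Real.zero_rpow e.s0_pos.ne', ENNReal.ofReal_zero] at h1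
      exact h1.mono_left nhdsWithin_le_nhds
    refine ge_of_tendsto ht ?_
    filter_upwards [eventually_mem_nhdsWithin,
      nhdsWithin_le_nhds (gt_mem_nhds one_pos)] with m h1 h2 using key m h1 h2
  unfold levelIntegral at h1
  rw [lintegral_eq_zero_iff' (aemeasurable_integrand hf 1).ennreal_ofReal] at h1
  filter_upwards [h1] with x hx
  simp only [Real.one_rpow, mul_one, Pi.zero_apply, ENNReal.ofReal_eq_zero] at hx
  by_contra hne
  have : 0 < |f x| ^ e.P x := Real.rpow_pos_of_pos (abs_pos.2 hne) _
  linarith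

lemma level_zero {f : α → ℝ} (h : ∀ᵐ x ∂μ, f x = 0) : e.level μ f = 0 := by
  refine le_antisymm (ENNReal.le_of_forall_pos_le_add fun ε hε _ => ?_) zero_le
  rw [zero_add, ← ENNReal.ofReal_coe_nnreal, level_le_ofReal_iff (by exact_mod_cast hε)]
  unfold levelIntegral
  rw [lintegral_congr_ae (g := fun _ => 0), lintegral_zero]
  · exact zero_le_one
  · filter_upwards [h] with x hx
    simp [hx, Real.zero_rpow (e.P_pos x).ne']

/-- Multiplication by `c^{1/Q}` multiplies the level by `c`. -/
lemma level_rpow_mul_le {c : ℝ} (hc : 0 < c) (f : α → ℝ) :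
    e.level μ (fun x => c ^ (e.Q x)⁻¹ * f x) ≤ ENNReal.ofReal c * e.level μ f := by
  have h : ENNReal.ofReal c⁻¹ * e.level μ (fun x => c ^ (e.Q x)⁻¹ * f x) ≤ e.level μ f := by
    refine le_level fun l hl h => ?_
    have h1 : e.level μ (fun x => c ^ (e.Q x)⁻¹ * f x) ≤ ENNReal.ofReal (c * l) := by
      rw [level_le_ofReal_iff (by positivity)]
      rw [level_le_ofReal_iff hl] at h
      refine le_trans (le_of_eq ?_) h
      unfold levelIntegral
      congr with x
      congr 1
      have hcQ := Real.rpow_pos_of_pos hc (e.Q x)⁻¹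
      rw [abs_mul, abs_of_pos hcQ, Real.mul_rpow hcQ.le (abs_nonneg _), Real.mul_rpow hc.le hl.le,
        ← Real.rpow_mul hc.le, Real.rpow_neg hc.le,
        show (e.Q x)⁻¹ * e.P x = e.S x by unfold S; field_simp]
      have := Real.rpow_pos_of_pos hc (e.S x)
      field_simp
    calc _ ≤ ENNReal.ofReal c⁻¹ * ENNReal.ofReal (c * l) := by gcongr
      _ = ENNReal.ofReal l := by
        rw [← ENNReal.ofReal_mul (by positivity)]
        congr 1
        field_simp
  calc _ = ENNReal.ofReal c * (ENNReal.ofReal c⁻¹ * e.level μ (fun x => c ^ (e.Q x)⁻¹ * f x)) := by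
        rw [← mul_assoc, ← ENNReal.ofReal_mul hc.le, mul_inv_cancel₀ hc.ne', ENNReal.ofReal_one,
          one_mul]
    _ ≤ _ := by gcongr

/-- For c ≥ 1, c ≤ (c^`q1`)^(1/Q) pointwise, which reduces to the scaling in `level_rpow_mul_le`.
The companion for c ≤ 1 uses `q0`, and `q0` > 1 is what makes the level strictly superlinear on
rays. -/
lemma level_const_mul_le_of_one_le {c : ℝ} (hc : 1 ≤ c) (f : α → ℝ) :
    e.level μ (fun x => c * f x) ≤ ENNReal.ofReal (c ^ e.q1) * e.level μ f := by
  have hc0 : 0 < c := by linarith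
  refine le_trans (level_mono (Eventually.of_forall fun x => ?_))
    (level_rpow_mul_le (Real.rpow_pos_of_pos hc0 e.q1) f)
  have hQ := e.Q_pos x
  rw [abs_mul, abs_mul, ← Real.rpow_mul hc0.le, abs_of_pos hc0,
    abs_of_pos (Real.rpow_pos_of_pos hc0 _)]
  gcongr
  nth_rw 1 [← Real.rpow_one c]
  refine Real.rpow_le_rpow_of_exponent_le hc ?_
  rw [← div_eq_mul_inv, one_le_div hQ]
  exact e.le_q1 x

lemma level_const_mul_le_of_le_one {c : ℝ} (hc0 : 0 < c) (hc : c ≤ 1) (f : α → ℝ) :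
    e.level μ (fun x => c * f x) ≤ ENNReal.ofReal (c ^ e.q0) * e.level μ f := by
  refine le_trans (level_mono (Eventually.of_forall fun x => ?_))
    (level_rpow_mul_le (Real.rpow_pos_of_pos hc0 e.q0) f)
  have hQ := e.Q_pos x
  rw [abs_mul, abs_mul, ← Real.rpow_mul hc0.le, abs_of_pos hc0,
    abs_of_pos (Real.rpow_pos_of_pos hc0 _)]
  gcongr
  nth_rw 1 [← Real.rpow_one c]
  refine Real.rpow_le_rpow_of_exponent_ge hc0 hc ?_
  rw [← div_eq_mul_inv, div_le_one hQ]
  exact e.q0_le x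

lemma level_const_mul_lt_top {f : α → ℝ} (h : e.level μ f < ∞) (c : ℝ) :
    e.level μ (fun x => c * f x) < ∞ := by
  have h1 : 1 ≤ max |c| 1 := le_max_right _ _
  refine lt_of_le_of_lt (level_mono (g := fun x => max |c| 1 * f x)
    (Eventually.of_forall fun x => ?_)) ((level_const_mul_le_of_one_le h1 f).trans_lt
      (ENNReal.mul_lt_top ENNReal.ofReal_lt_top h))
  rw [abs_mul, abs_mul, abs_of_pos (one_pos.trans_le h1)]
  gcongr
  exact le_max_left _ _

lemma tendsto_abs_rpow {ι : Type*} {F : Filter ι} {u : ι → ℝ} {v p : ℝ} (hp : 0 < p)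
    (h : Tendsto u F (𝓝 v)) : Tendsto (fun k => |u k| ^ p) F (𝓝 (|v| ^ p)) :=
  h.abs.rpow_const (Or.inr hp.le)

/-- Fatou's lemma for the level integral at one l chosen strictly between the liminf and the level
of the limit. -/
lemma level_le_liminf {f : ℕ → α → ℝ} {g : α → ℝ} (hf : ∀ k, AEMeasurable (f k) μ)
    (h : ∀ᵐ x ∂μ, Tendsto (fun k => f k x) atTop (𝓝 (g x))) :
    e.level μ g ≤ liminf (fun k => e.level μ (f k)) atTop := by
  by_contra hlt
  obtain ⟨l, hl1, hl2⟩ := ENNReal.lt_iff_exists_nnreal_btwn.1 (not_le.1 hlt)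
  have hl0 : (0 : ℝ) < l := by
    have := (zero_le (a := liminf (fun k => e.level μ (f k)) atTop)).trans_lt hl1
    exact_mod_cast this
  rw [← ENNReal.ofReal_coe_nnreal] at hl1 hl2
  have hfr : ∃ᶠ k in atTop, e.levelIntegral μ l (f k) ≤ 1 :=
    (frequently_lt_of_liminf_lt (by isBoundedDefault) hl1).mono fun k hk =>
      (level_le_ofReal_iff hl0).1 hk.le
  refine absurd ((level_le_ofReal_iff hl0).2 ?_) (not_le.2 hl2)
  calc e.levelIntegral μ l g
      ≤ ∫⁻ x, liminf (fun k => ENNReal.ofReal (|f k x| ^ e.P x * (l : ℝ) ^ (-e.S x))) atTop ∂μ := by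
        refine lintegral_mono_ae ?_
        filter_upwards [h] with x hx
        refine le_of_eq (Tendsto.liminf_eq ?_).symm
        exact (ENNReal.continuous_ofReal.tendsto _).comp
          ((tendsto_abs_rpow (e.P_pos x) hx).mul_const _)
    _ ≤ liminf (fun k => e.levelIntegral μ l (f k)) atTop :=
        lintegral_liminf_le' fun k => (aemeasurable_integrand (hf k) _).ennreal_ofReal
    _ ≤ 1 := liminf_le_of_frequently_le' hfr

/-- Dominated convergence for the level integral at the fixed level ε: once that integral is at most
1, the level is at most ε. -/
lemma tendsto_level_zero {f : ℕ → α → ℝ} {g : α → ℝ} (hf : ∀ k, AEMeasurable (f k) μ)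
    (hg : e.level μ g < ∞) (hfg : ∀ k, ∀ᵐ x ∂μ, |f k x| ≤ |g x|)
    (h : ∀ᵐ x ∂μ, Tendsto (fun k => f k x) atTop (𝓝 0)) :
    Tendsto (fun k => e.level μ (f k)) atTop (𝓝 0) := by
  rw [ENNReal.tendsto_nhds_zero]
  intro ε hε
  rcases eq_or_ne ε ∞ with rfl | hne
  · exact Eventually.of_forall fun _ => le_top
  have hl : 0 < ε.toReal := ENNReal.toReal_pos hε.ne' hne
  have ht : Tendsto (fun k => e.levelIntegral μ ε.toReal (f k)) atTop (𝓝 0) := by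
    have := tendsto_lintegral_of_dominated_convergence' (μ := μ)
      (F := fun k x => ENNReal.ofReal (|f k x| ^ e.P x * ε.toReal ^ (-e.S x))) (f := fun _ => 0)
      (fun x => ENNReal.ofReal (|g x| ^ e.P x * ε.toReal ^ (-e.S x)))
      (fun k => (aemeasurable_integrand (hf k) _).ennreal_ofReal)
      (fun k => (hfg k).mono fun x hx => ENNReal.ofReal_le_ofReal (mul_le_mul_of_nonneg_right
        (Real.rpow_le_rpow (abs_nonneg _) hx (e.P_pos x).le) (Real.rpow_nonneg hl.le _)))
      (levelIntegral_lt_top hg hl).ne ?_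
    · simpa [levelIntegral] using this
    · filter_upwards [h] with x hx
      have h1 := (tendsto_abs_rpow (e.P_pos x) hx).mul_const (ε.toReal ^ (-e.S x))
      rw [abs_zero, Real.zero_rpow (e.P_pos x).ne', zero_mul] at h1
      simpa [Function.comp_def] using (ENNReal.continuous_ofReal.tendsto _).comp h1
  filter_upwards [ht.eventually_le_const zero_lt_one] with k hk
  rw [← ENNReal.ofReal_toReal hne, level_le_ofReal_iff hl]
  exact hk

end ExponentPair

/-! ### The upper estimate for pointwise maxima -/

/-- The first factor is at most M^(-P/r)/2. What remains is bounded by 1/M if Mt ≤ 1 (as r ≤ P), and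
by t otherwise: from P/Q ≤ 1 directly, or from P/Q ≥ 1 and r ≤ Q. The right side is shaped so that M
values of t with sum 1 give the total 1. -/
lemma max_estimate_scalar {M t r P Q : ℝ} (hM : 1 ≤ M) (ht0 : 0 < t) (ht1 : t ≤ 1)
    (hr : 1 ≤ r) (hP : r ≤ P) (hQ : r ≤ Q) :
    ((2 * M ^ r⁻¹)⁻¹) ^ P * (M * t) ^ (P / Q) ≤ (t + 1 / M) / 2 := by
  have hM0 : 0 < M := by linarith
  have hr0 : 0 < r := by linarith
  have hP0 : 0 < P := by linarith
  have hQ0 : 0 < Q := by linarith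
  have hMt : 0 < M * t := by positivity
  have h1 : ((2 * M ^ r⁻¹)⁻¹) ^ P ≤ 2⁻¹ * (M ^ (P / r))⁻¹ := by
    rw [mul_inv, Real.mul_rpow (by positivity) (by positivity), Real.inv_rpow (by positivity : (0 : ℝ) ≤ M ^ r⁻¹),
      ← Real.rpow_mul hM0.le, show r⁻¹ * P = P / r by ring]
    gcongr
    calc (2⁻¹ : ℝ) ^ P ≤ 2⁻¹ ^ (1 : ℝ) :=
          Real.rpow_le_rpow_of_exponent_ge (by norm_num) (by norm_num) (by linarith)
      _ = 2⁻¹ := Real.rpow_one _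
  have h2 : (M ^ (P / r))⁻¹ * (M * t) ^ (P / Q) ≤ t + 1 / M := by
    have hMPr : M ≤ M ^ (P / r) := by
      nth_rw 1 [← Real.rpow_one M]
      exact Real.rpow_le_rpow_of_exponent_le hM ((one_le_div hr0).2 hP)
    have hpos : 0 < M ^ (P / r) := by positivity
    have hinv : 0 < 1 / M := by positivity
    rcases le_total (M * t) 1 with h | h
    · have h3 : (M * t) ^ (P / Q) ≤ 1 := Real.rpow_le_one hMt.le h (by positivity)
      calc (M ^ (P / r))⁻¹ * (M * t) ^ (P / Q) ≤ M⁻¹ * 1 := by gcongr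
        _ ≤ t + 1 / M := by rw [mul_one, ← one_div]; linarith
    · rcases le_total (P / Q) 1 with hs | hs
      · have h3 : (M * t) ^ (P / Q) ≤ M * t := by
          nth_rw 2 [← Real.rpow_one (M * t)]
          exact Real.rpow_le_rpow_of_exponent_le h hs
        calc (M ^ (P / r))⁻¹ * (M * t) ^ (P / Q) ≤ M⁻¹ * (M * t) := by gcongr
          _ = t := by field_simp
          _ ≤ _ := by linarith
      · have h3 : t ^ (P / Q) ≤ t := by
          nth_rw 2 [← Real.rpow_one t]
          exact Real.rpow_le_rpow_of_exponent_ge ht0 ht1 hs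
        have h4 : M ^ (P / Q) ≤ M ^ (P / r) :=
          Real.rpow_le_rpow_of_exponent_le hM (by gcongr)
        rw [Real.mul_rpow hM0.le ht0.le]
        calc (M ^ (P / r))⁻¹ * (M ^ (P / Q) * t ^ (P / Q))
            ≤ (M ^ (P / r))⁻¹ * (M ^ (P / r) * t) := by gcongr
          _ = t := by field_simp
          _ ≤ _ := by linarith
  calc _ ≤ 2⁻¹ * (M ^ (P / r))⁻¹ * (M * t) ^ (P / Q) := by gcongr
    _ = 2⁻¹ * ((M ^ (P / r))⁻¹ * (M * t) ^ (P / Q)) := by ring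
    _ ≤ 2⁻¹ * (t + 1 / M) := by gcongr
    _ = _ := by ring

namespace ExponentPair

variable {α : Type*} [MeasurableSpace α] {μ : Measure α} {e : ExponentPair α}

/-- An upper estimate for the level of the pointwise maximum of finitely many functions. -/
lemma level_max_le {ι : Type*} {s : Finset ι} (hs : s.Nonempty) {d : ι → α → ℝ} {a : ι → ℝ}
    {g : α → ℝ} {r : ℝ} (hr : 1 ≤ r) (hrp : r ≤ e.p0) (hrq : r ≤ e.q0)
    (hd : ∀ i, AEMeasurable (d i) μ) (ha : ∀ i, 0 ≤ a i)
    (hle : ∀ i ∈ s, e.level μ (d i) ≤ ENNReal.ofReal (a i))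
    (hg : ∀ᵐ x ∂μ, ∃ i ∈ s, |g x| ≤ |d i x|) :
    e.level μ (fun x => (2 * (s.card : ℝ) ^ r⁻¹)⁻¹ * g x) ≤
      ENNReal.ofReal ((∑ i ∈ s, a i) / s.card) := by
  have hM : (1 : ℝ) ≤ s.card := by exact_mod_cast hs.card_pos
  set M : ℝ := (s.card : ℝ) with hMdef
  have hM0 : 0 < M := by linarith
  set K : ℝ := (2 * M ^ r⁻¹)⁻¹ with hK
  have hK0 : 0 < K := by positivity
  have hz : ∀ i ∈ s, a i = 0 → ∀ᵐ x ∂μ, d i x = 0 := fun i hi h0 =>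
    ae_eq_zero_of_level (hd i) (le_antisymm (by simpa [h0] using hle i hi) zero_le)
  set A : ℝ := ∑ i ∈ s, a i with hA
  have hA0 : 0 ≤ A := Finset.sum_nonneg fun i _ => ha i
  rcases hA0.eq_or_lt with h0 | hApos
  · have h0' : ∀ i ∈ s, a i = 0 := (Finset.sum_eq_zero_iff_of_nonneg fun i _ => ha i).1 h0.symm
    rw [level_zero]
    · exact zero_le
    · have : ∀ᵐ x ∂μ, ∀ i ∈ s, d i x = 0 :=
        (ae_ball_iff s.countable_toSet).2 fun i hi => hz i hi (h0' i hi)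
      filter_upwards [this, hg] with x hx ⟨i, hi, hgi⟩
      rw [hx i hi, abs_zero, abs_nonpos_iff] at hgi
      rw [hgi, mul_zero]
  have hl : 0 < A / M := by positivity
  rw [level_le_ofReal_iff hl]
  -- Here t = a i / A is the share of index i. Passing from the common level A/M to the own level a
  -- i costs the factor (Mt)^S, which K^P compensates.
  have hterm : ∀ i ∈ s, ∫⁻ x, ENNReal.ofReal (|d i x| ^ e.P x * K ^ e.P x * (A / M) ^ (-e.S x)) ∂μ ≤
      ENNReal.ofReal ((a i / A + 1 / M) / 2) := by
    intro i hi
    rcases (ha i).eq_or_lt with h0 | hai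
    · rw [lintegral_congr_ae (g := fun _ => 0), lintegral_zero]
      · exact zero_le
      · filter_upwards [hz i hi h0.symm] with x hx
        simp [hx, Real.zero_rpow (e.P_pos x).ne']
    · have hJ := (level_le_ofReal_iff hai).1 (hle i hi)
      have ht1 : a i / A ≤ 1 :=
        (div_le_one hApos).2 (Finset.single_le_sum (fun i _ => ha i) hi)
      calc _ ≤ ∫⁻ x, ENNReal.ofReal ((a i / A + 1 / M) / 2) *
              ENNReal.ofReal (|d i x| ^ e.P x * (a i) ^ (-e.S x)) ∂μ := by
            refine lintegral_mono fun x => ?_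
            rw [← ENNReal.ofReal_mul (by positivity)]
            refine ENNReal.ofReal_le_ofReal ?_
            have key := max_estimate_scalar (P := e.P x) (Q := e.Q x) hM (div_pos hai hApos) ht1 hr
              (hrp.trans (e.p0_le x)) (hrq.trans (e.q0_le x))
            have h1 : (A / M) ^ (-e.S x) = (M * (a i / A)) ^ (e.P x / e.Q x) * a i ^ (-e.S x) := by
              change _ = (M * (a i / A)) ^ (e.S x) * _
              have : M * (a i / A) = a i / (A / M) := by field_simp
              rw [this, Real.div_rpow hai.le hl.le, Real.rpow_neg hai.le, Real.rpow_neg hl.le]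
              have := Real.rpow_pos_of_pos hai (e.S x)
              field_simp
            rw [h1]
            calc |d i x| ^ e.P x * K ^ e.P x *
                  ((M * (a i / A)) ^ (e.P x / e.Q x) * a i ^ (-e.S x))
                = (K ^ e.P x * (M * (a i / A)) ^ (e.P x / e.Q x)) *
                  (|d i x| ^ e.P x * a i ^ (-e.S x)) := by ring
              _ ≤ _ := by gcongr
        _ = ENNReal.ofReal ((a i / A + 1 / M) / 2) * e.levelIntegral μ (a i) (d i) :=
            lintegral_const_mul' _ _ ENNReal.ofReal_ne_top
        _ ≤ ENNReal.ofReal ((a i / A + 1 / M) / 2) * 1 := by gcongr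
        _ = _ := mul_one _
  calc e.levelIntegral μ (A / M) (fun x => K * g x)
      ≤ ∫⁻ x, ∑ i ∈ s, ENNReal.ofReal (|d i x| ^ e.P x * K ^ e.P x * (A / M) ^ (-e.S x)) ∂μ := by
        refine lintegral_mono_ae ?_
        filter_upwards [hg] with x ⟨i, hi, hgi⟩
        refine le_trans (ENNReal.ofReal_le_ofReal ?_) (Finset.single_le_sum
          (f := fun i => ENNReal.ofReal (|d i x| ^ e.P x * K ^ e.P x * (A / M) ^ (-e.S x)))
          (fun _ _ => zero_le) hi)
        rw [abs_mul, abs_of_pos hK0, Real.mul_rpow hK0.le (abs_nonneg _), mul_comm (K ^ _)]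
        have := e.P_pos x
        gcongr
    _ = ∑ i ∈ s, ∫⁻ x, ENNReal.ofReal (|d i x| ^ e.P x * K ^ e.P x * (A / M) ^ (-e.S x)) ∂μ := by
        refine lintegral_finsetSum' _ fun i _ => ?_
        have h1 : AEMeasurable (fun x => |d i x|) μ := (hd i).norm
        exact (((h1.pow e.measurable_P.aemeasurable).mul
          (measurable_const.pow e.measurable_P).aemeasurable).mul
          ((measurable_const.pow e.measurable_S.neg).aemeasurable)).ennreal_ofReal
    _ ≤ ∑ i ∈ s, ENNReal.ofReal ((a i / A + 1 / M) / 2) := Finset.sum_le_sum hterm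
    _ = ENNReal.ofReal (∑ i ∈ s, (a i / A + 1 / M) / 2) :=
        (ENNReal.ofReal_sum_of_nonneg fun i _ => by have := ha i; positivity).symm
    _ = 1 := by
        rw [← Finset.sum_div, Finset.sum_add_distrib, ← Finset.sum_div, ← hA, div_self hApos.ne',
          Finset.sum_const, nsmul_eq_mul, ← hMdef, mul_one_div, div_self hM0.ne']
        norm_num

end ExponentPair

/-! ### Rigidity of a product of powers of affine functions -/

/-- Along a segment on which three positive affine functions `l`, `n`, `A` make
`l^(P-1) n^(-S) A` constant at five points, `l` is constant or proportional to `n`. -/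
lemma affine_rigidity {P S l0 l1 n0 n1 A0 A1 : ℝ} (hP : 1 < P) (hS : 0 < S) (hSP : S < P)
    (hl0 : 0 < l0) (hl1 : 0 < l1) (hn0 : 0 < n0) (hn1 : 0 < n1) (hA0 : 0 < A0) (hA1 : 0 < A1)
    (h : ∀ r ∈ ({0, 1 / 4, 1 / 2, 3 / 4} : Set ℝ),
      (P - 1) * Real.log ((1 - r) * l0 + r * l1) + Real.log ((1 - r) * A0 + r * A1) -
        S * Real.log ((1 - r) * n0 + r * n1) =
      (P - 1) * Real.log l0 + Real.log A0 - S * Real.log n0) :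
    (A0 ≠ A1 → l0 = l1) ∧ (A0 = A1 → l0 * n1 = l1 * n0) := by
  have haff : ∀ u v : ℝ, 0 < u → 0 < v → ∀ r, 0 ≤ r → r ≤ 1 → 0 < (1 - r) * u + r * v := by
    intro u v hu hv r h0 h1
    rcases h0.eq_or_lt with rfl | h0
    · simpa using hu
    · have := mul_pos h0 hv
      have := mul_nonneg (sub_nonneg.2 h1) hu.le
      linarith
  set g : ℝ → ℝ := fun r => (P - 1) * Real.log ((1 - r) * l0 + r * l1) +
    Real.log ((1 - r) * A0 + r * A1) - S * Real.log ((1 - r) * n0 + r * n1) with hg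
  -- Numerator of the derivative of g: each term is a constant slope times two affine functions, so
  -- it is only quadratic in r.
  set q : ℝ → ℝ := fun r => (P - 1) * (l1 - l0) * ((1 - r) * A0 + r * A1) *
    ((1 - r) * n0 + r * n1) + (A1 - A0) * ((1 - r) * l0 + r * l1) * ((1 - r) * n0 + r * n1) -
    S * (n1 - n0) * ((1 - r) * l0 + r * l1) * ((1 - r) * A0 + r * A1) with hq
  have hder : ∀ r, 0 ≤ r → r ≤ 1 → HasDerivAt g (q r / (((1 - r) * l0 + r * l1) *
      ((1 - r) * A0 + r * A1) * ((1 - r) * n0 + r * n1))) r := by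
    intro r h0 h1
    have hd : ∀ u v : ℝ, HasDerivAt (fun r : ℝ => (1 - r) * u + r * v) (v - u) r := by
      intro u v
      have h1 := (((hasDerivAt_id r).const_sub 1).mul_const u).add ((hasDerivAt_id r).mul_const v)
      refine h1.congr_deriv ?_
      ring
    have pl := haff l0 l1 hl0 hl1 r h0 h1
    have pA := haff A0 A1 hA0 hA1 r h0 h1
    have pn := haff n0 n1 hn0 hn1 r h0 h1
    have := ((((hd l0 l1).log pl.ne').const_mul (P - 1)).add ((hd A0 A1).log pA.ne')).sub
      (((hd n0 n1).log pn.ne').const_mul S)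
    refine this.congr_deriv ?_
    simp only [hq]
    generalize (1 - r) * l0 + r * l1 = u at *
    generalize (1 - r) * A0 + r * A1 = v at *
    generalize (1 - r) * n0 + r * n1 = w at *
    field_simp
  -- Rolle: the four equal values of g yield three distinct zeros of the quadratic q, hence all its
  -- coefficients vanish.
  have hroot : ∀ a b, 0 ≤ a → a < b → b ≤ 1 → g a = g b → ∃ c, a < c ∧ c < b ∧ q c = 0 := by
    intro a b ha hab hb hgab
    obtain ⟨c, hc, hc0⟩ := exists_hasDerivAt_eq_zero hab
      (fun r hr => (hder r (ha.trans hr.1) (hr.2.trans hb)).continuousAt.continuousWithinAt) hgab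
      (fun r hr => hder r (ha.trans hr.1.le) (hr.2.le.trans hb))
    refine ⟨c, hc.1, hc.2, ?_⟩
    have h0 : 0 ≤ c := ha.trans hc.1.le
    have h1 : c ≤ 1 := hc.2.le.trans hb
    rcases div_eq_zero_iff.1 hc0 with h | h
    · exact h
    · have := mul_pos (mul_pos (haff l0 l1 hl0 hl1 c h0 h1) (haff A0 A1 hA0 hA1 c h0 h1))
        (haff n0 n1 hn0 hn1 c h0 h1)
      linarith
  have e0 : g 0 = (P - 1) * Real.log l0 + Real.log A0 - S * Real.log n0 := h 0 (by simp)
  have e1 : g (1 / 4) = (P - 1) * Real.log l0 + Real.log A0 - S * Real.log n0 :=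
    h (1 / 4) (by simp)
  have e2 : g (1 / 2) = (P - 1) * Real.log l0 + Real.log A0 - S * Real.log n0 :=
    h (1 / 2) (by simp)
  have e3 : g (3 / 4) = (P - 1) * Real.log l0 + Real.log A0 - S * Real.log n0 :=
    h (3 / 4) (by simp)
  obtain ⟨c1, h1a, h1b, h1⟩ := hroot 0 (1 / 4) (by norm_num) (by norm_num) (by norm_num)
    (e0.trans e1.symm)
  obtain ⟨c2, h2a, h2b, h2⟩ := hroot (1 / 4) (1 / 2) (by norm_num) (by norm_num) (by norm_num)
    (e1.trans e2.symm)
  obtain ⟨c3, h3a, h3b, h3⟩ := hroot (1 / 2) (3 / 4) (by norm_num) (by norm_num) (by norm_num)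
    (e2.trans e3.symm)
  clear_value g
  set l' := l1 - l0 with hl'
  set n' := n1 - n0 with hn'
  set A' := A1 - A0 with hA'
  set k0 := (P - 1) * l' * A0 * n0 + A' * l0 * n0 - S * n' * l0 * A0 with hk0
  set k1 := (P - 1) * l' * (A0 * n' + A' * n0) + A' * (l0 * n' + l' * n0) -
    S * n' * (l0 * A' + l' * A0) with hk1
  -- The factor (P - 1) + 1 - S is nonzero because S < P, so one of the three slopes must vanish.
  set k2 := (P - S) * (l' * A' * n') with hk2
  have hquad : ∀ r, q r = k0 + k1 * r + k2 * r ^ 2 := by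
    intro r
    simp only [hq, hk0, hk1, hk2, hl', hn', hA']
    ring
  rw [hquad] at h1 h2 h3
  have d12 : k1 + k2 * (c1 + c2) = 0 := by
    have : (c2 - c1) * (k1 + k2 * (c1 + c2)) = 0 := by linear_combination h2 - h1
    exact (mul_eq_zero.1 this).resolve_left (by linarith)
  have d23 : k1 + k2 * (c2 + c3) = 0 := by
    have : (c3 - c2) * (k1 + k2 * (c2 + c3)) = 0 := by linear_combination h3 - h2
    exact (mul_eq_zero.1 this).resolve_left (by linarith)
  have z2 : k2 = 0 := by
    have : (c3 - c1) * k2 = 0 := by linear_combination d23 - d12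
    exact (mul_eq_zero.1 this).resolve_left (by linarith)
  have z1 : k1 = 0 := by rw [z2] at d12; linarith
  have z0 : k0 = 0 := by rw [z2, z1] at h1; linarith
  have z2' : l' * A' * n' = 0 := (mul_eq_zero.1 z2).resolve_left (by linarith)
  have hP1 : P - 1 ≠ 0 := by linarith
  have key : A' = 0 → l0 * n1 = l1 * n0 := by
    intro hA
    rw [hA] at hk1 hk0
    have f0 : (P - 1) * l' * n0 - S * n' * l0 = 0 := by
      have : A0 * ((P - 1) * l' * n0 - S * n' * l0) = 0 := by rw [← z0, hk0]; ring
      exact (mul_eq_zero.1 this).resolve_left hA0.ne'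
    have f1 : (P - 1 - S) * (l' * n') = 0 := by
      have : A0 * ((P - 1 - S) * (l' * n')) = 0 := by rw [← z1, hk1]; ring
      exact (mul_eq_zero.1 this).resolve_left hA0.ne'
    suffices l0 * n' = l' * n0 by
      rw [hl', hn'] at this
      linarith
    rcases mul_eq_zero.1 f1 with hs | hln
    · have hs' : P - 1 = S := by linarith
      rw [hs'] at f0
      have : S * (l' * n0 - l0 * n') = 0 := by linear_combination f0
      have := (mul_eq_zero.1 this).resolve_left hS.ne'
      linarith
    · rcases mul_eq_zero.1 hln with hz | hz
      · rw [hz] at f0 ⊢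
        have : (S * l0) * n' = 0 := by linear_combination -f0
        have := (mul_eq_zero.1 this).resolve_left (by positivity)
        rw [this]; ring
      · rw [hz] at f0 ⊢
        have : ((P - 1) * n0) * l' = 0 := by linear_combination f0
        have := (mul_eq_zero.1 this).resolve_left (mul_ne_zero hP1 hn0.ne')
        rw [this]; ring
  refine ⟨fun hne => ?_, fun heq => key (by rw [hA', heq, sub_self])⟩
  have hA'0 : A' ≠ 0 := sub_ne_zero.2 hne.symm
  suffices l' = 0 by rw [hl'] at this; linarith
  by_contra hl'0
  have hn'0 : n' = 0 := (mul_eq_zero.1 z2').resolve_left (mul_ne_zero hl'0 hA'0)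
  rw [hn'0] at hk1
  -- With n' = 0 the linear coefficient collapses to this product, which contradicts l' ≠ 0 and A' ≠
  -- 0.
  have : (P * n0) * (l' * A') = 0 := by rw [← z1, hk1]; ring
  have := (mul_eq_zero.1 this).resolve_left (by positivity)
  exact mul_ne_zero hl'0 hA'0 this

/-! ### Differentiation of the level integral -/

namespace ExponentPair

variable {α : Type*} [MeasurableSpace α] {μ : Measure α} {e : ExponentPair α}

lemma integrable_integrand {f : α → ℝ} (hf : AEMeasurable f μ) (h : e.level μ f < ∞) {l : ℝ}
    (hl : 0 < l) : Integrable (fun x => |f x| ^ e.P x * l ^ (-e.S x)) μ := by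
  refine ⟨(aemeasurable_integrand hf l).aestronglyMeasurable, ?_⟩
  rw [hasFiniteIntegral_iff_ofReal]
  · exact levelIntegral_lt_top h hl
  · exact Eventually.of_forall fun x => by positivity

lemma levelIntegral_eq_ofReal {f : α → ℝ} (hf : AEMeasurable f μ) (h : e.level μ f < ∞) {l : ℝ}
    (hl : 0 < l) : e.levelIntegral μ l f =
      ENNReal.ofReal (∫ x, |f x| ^ e.P x * l ^ (-e.S x) ∂μ) :=
  (ofReal_integral_eq_lintegral_ofReal (integrable_integrand hf h hl)
    (Eventually.of_forall fun x => by positivity)).symm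

variable (e) in
/-- The directional derivative of the level integral in the function. -/
noncomputable def dirDeriv (μ : Measure α) (l : ℝ) (U K : α → ℝ) : ℝ :=
  ∫ x, e.P x * |U x| ^ (e.P x - 2) * U x * K x * l ^ (-e.S x) ∂μ

variable (e) in
/-- The negative of the derivative of the level integral in the level. -/
noncomputable def levelDeriv (μ : Measure α) (l : ℝ) (U : α → ℝ) : ℝ :=
  ∫ x, e.S x * |U x| ^ e.P x * l ^ (-e.S x - 1) ∂μ

/-- The factor y absorbs the possible singularity of |y|^(p-2), leaving |y|^(p-1) |K|. Thus one
majorant T^p serves the function and its derivative. -/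
lemma abs_deriv_le {y K T p : ℝ} (hp : 1 < p) (hy : |y| ≤ T) (hK : |K| ≤ T) :
    |p * |y| ^ (p - 2) * y * K| ≤ p * T ^ p := by
  have hT : 0 ≤ T := (abs_nonneg y).trans hy
  rcases eq_or_ne y 0 with rfl | hy0
  · simp only [mul_zero, zero_mul, abs_zero]
    have := Real.rpow_nonneg hT p
    nlinarith
  have hypos : 0 < |y| := abs_pos.2 hy0
  have hTpos : 0 < T := hypos.trans_le hy
  rw [abs_mul, abs_mul, abs_mul, abs_of_pos (by linarith : 0 < p),
    abs_of_nonneg (Real.rpow_nonneg hypos.le _)]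
  have h1 : |y| ^ (p - 2) * |y| = |y| ^ (p - 1) := by
    rw [← Real.rpow_add_one hypos.ne']; ring_nf
  have h2 : T ^ (p - 1) * T = T ^ p := by
    rw [← Real.rpow_add_one hTpos.ne']; ring_nf
  rw [mul_assoc p, h1, ← h2, mul_assoc]
  have : |y| ^ (p - 1) ≤ T ^ (p - 1) := Real.rpow_le_rpow hypos.le hy (by linarith)
  gcongr

lemma integrable_dirDeriv {U K T : α → ℝ} (hU : AEMeasurable U μ) (hK : AEMeasurable K μ)
    (hT : AEMeasurable T μ) (hTl : e.level μ T < ∞) (hUT : ∀ x, |U x| ≤ T x)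
    (hKT : ∀ x, |K x| ≤ T x) {l : ℝ} (hl : 0 < l) :
    Integrable (fun x => e.P x * |U x| ^ (e.P x - 2) * U x * K x * l ^ (-e.S x)) μ := by
  refine ((integrable_integrand hT hTl hl).const_mul e.p1).mono' ?_ ?_
  · have h1 : AEMeasurable (fun x => |U x|) μ := hU.norm
    exact (((((e.measurable_P.aemeasurable.mul
      (h1.pow (e.measurable_P.sub_const 2).aemeasurable)).mul hU).mul hK).mul
      (measurable_const.pow e.measurable_S.neg).aemeasurable)).aestronglyMeasurable
  · refine Eventually.of_forall fun x => ?_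
    have hTx : 0 ≤ T x := (abs_nonneg _).trans (hUT x)
    have hlx : 0 < l ^ (-e.S x) := by positivity
    rw [Real.norm_eq_abs, abs_mul, abs_of_pos hlx, abs_of_nonneg hTx, ← mul_assoc]
    refine mul_le_mul_of_nonneg_right ((abs_deriv_le (e.one_lt_P x) (hUT x) (hKT x)).trans ?_)
      hlx.le
    exact mul_le_mul_of_nonneg_right (e.le_p1 x) (Real.rpow_nonneg hTx _)

/-- Function and level move together, with a free slope c for the level. When the integral starts at
1, the sign of this derivative decides whether the level of U + εK grows slower or faster than l +
εc. -/
lemma hasDerivAt_levelIntegral {U K T : α → ℝ} (hU : AEMeasurable U μ) (hK : AEMeasurable K μ)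
    (hT : AEMeasurable T μ) (hTl : e.level μ T < ∞) (hUT : ∀ x, |U x| + |K x| ≤ T x)
    {l : ℝ} (hl : 0 < l) (c : ℝ) :
    HasDerivAt (fun ε : ℝ => ∫ x, |U x + ε * K x| ^ e.P x * (l + ε * c) ^ (-e.S x) ∂μ)
      (e.dirDeriv μ l U K - c * e.levelDeriv μ l U) 0 := by
  have hTn : ∀ x, 0 ≤ T x := fun x => le_trans (by positivity) (hUT x)
  have hU1 : ∀ x, |U x| ≤ T x := fun x => by have := hUT x; have := abs_nonneg (K x); linarith
  have hK1 : ∀ x, |K x| ≤ T x := fun x => by have := hUT x; have := abs_nonneg (U x); linarith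
  -- Keeps l + εc ≥ l/2 and |ε| ≤ 1, so that T dominates U + εK.
  set δ : ℝ := min 1 (l / (2 * (|c| + 1))) with hδ
  have hδ0 : 0 < δ := lt_min one_pos (by positivity)
  have hbase : ∀ ε ∈ Metric.ball (0 : ℝ) δ, l / 2 ≤ l + ε * c ∧ |ε| ≤ 1 := by
    intro ε hε
    rw [mem_ball_zero_iff, Real.norm_eq_abs] at hε
    refine ⟨?_, hε.le.trans (min_le_left _ _)⟩
    have h1 : |ε| ≤ l / (2 * (|c| + 1)) := hε.le.trans (min_le_right _ _)
    rw [le_div_iff₀ (by positivity)] at h1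
    have h2 : |ε * c| ≤ |ε| * (|c| + 1) := by rw [abs_mul]; gcongr; linarith
    have h3 := neg_abs_le (ε * c)
    linarith
  have hpt : ∀ ε ∈ Metric.ball (0 : ℝ) δ, ∀ x, |U x + ε * K x| ≤ T x := by
    intro ε hε x
    refine (abs_add_le _ _).trans (le_trans ?_ (hUT x))
    rw [abs_mul]
    have := mul_le_of_le_one_left (abs_nonneg (K x)) (hbase ε hε).2
    linarith
  have hl2 : 0 < l / 2 := by positivity
  set bound : α → ℝ := fun x => (e.p1 + e.s1 * (2 / l) * |c|) *
    (|T x| ^ e.P x * (l / 2) ^ (-e.S x)) with hbound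
  set F' : ℝ → α → ℝ := fun ε x =>
    (e.P x * |U x + ε * K x| ^ (e.P x - 2) * (U x + ε * K x) * K x) * (l + ε * c) ^ (-e.S x) +
      |U x + ε * K x| ^ e.P x * (c * (-e.S x) * (l + ε * c) ^ (-e.S x - 1)) with hF'
  have hSm := e.measurable_S
  have hPm := e.measurable_P
  have hUε : ∀ ε : ℝ, AEMeasurable (fun x => U x + ε * K x) μ := fun ε =>
    hU.add (hK.const_mul ε)
  have hUεa : ∀ ε : ℝ, AEMeasurable (fun x => |U x + ε * K x|) μ := fun ε => (hUε ε).norm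
  have key := hasDerivAt_integral_of_dominated_loc_of_deriv_le (μ := μ) (x₀ := (0 : ℝ))
    (F := fun ε x => |U x + ε * K x| ^ e.P x * (l + ε * c) ^ (-e.S x)) (F' := F')
    (bound := bound) (Metric.ball_mem_nhds 0 hδ0)
    (Eventually.of_forall fun ε => (aemeasurable_integrand (hUε ε) _).aestronglyMeasurable)
    (by
      have := integrable_integrand (e := e) hU
        ((level_mono (Eventually.of_forall fun x => (hU1 x).trans (le_abs_self _))).trans_lt hTl) hl
      simpa using this)
    (by
      refine AEMeasurable.aestronglyMeasurable ?_
      refine AEMeasurable.add ?_ ?_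
      · exact (((hPm.aemeasurable.mul ((hUεa 0).pow (hPm.sub_const 2).aemeasurable)).mul
          (hUε 0)).mul hK).mul (measurable_const.pow hSm.neg).aemeasurable
      · exact ((hUεa 0).pow hPm.aemeasurable).mul (((measurable_const.mul hSm.neg).mul
          (measurable_const.pow (hSm.neg.sub_const 1))).aemeasurable))
    (by
      refine Eventually.of_forall fun x ε hε => ?_
      obtain ⟨hlb, -⟩ := hbase ε hε
      have hpos : 0 < l + ε * c := hl2.trans_le hlb
      have hS := e.S_pos x
      have hmono : (l + ε * c) ^ (-e.S x) ≤ (l / 2) ^ (-e.S x) :=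
        Real.rpow_le_rpow_of_nonpos hl2 hlb (by linarith)
      have hmono1 : (l + ε * c) ^ (-e.S x - 1) ≤ (l / 2) ^ (-e.S x) * (2 / l) := by
        refine (Real.rpow_le_rpow_of_nonpos hl2 hlb (by linarith)).trans (le_of_eq ?_)
        rw [Real.rpow_sub_one hl2.ne']
        field_simp
      have hpos1 : 0 < (l + ε * c) ^ (-e.S x) := by positivity
      have hpos2 : 0 < (l + ε * c) ^ (-e.S x - 1) := by positivity
      have hTP : 0 ≤ T x ^ e.P x := Real.rpow_nonneg (hTn x) _
      have b1 := abs_deriv_le (e.one_lt_P x) (hpt ε hε x) (hK1 x)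
      have b2 : |U x + ε * K x| ^ e.P x ≤ T x ^ e.P x :=
        Real.rpow_le_rpow (abs_nonneg _) (hpt ε hε x) (e.P_pos x).le
      have hp1 : 0 ≤ e.p1 := (e.P_pos x).le.trans (e.le_p1 x)
      simp only [Real.norm_eq_abs, hF', hbound]
      refine (abs_add_le _ _).trans ?_
      rw [abs_mul, abs_of_pos hpos1, abs_mul _ (c * (-e.S x) * _),
        abs_of_nonneg (Real.rpow_nonneg (abs_nonneg (U x + ε * K x)) (e.P x)), 
        abs_mul (c * (-e.S x)), abs_of_pos hpos2, abs_mul c, abs_neg, abs_of_pos hS, abs_of_nonneg (hTn x)]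
      have t1 : |e.P x * |U x + ε * K x| ^ (e.P x - 2) * (U x + ε * K x) * K x| *
          (l + ε * c) ^ (-e.S x) ≤ (e.p1 * T x ^ e.P x) * (l / 2) ^ (-e.S x) := by
        have := b1.trans (mul_le_mul_of_nonneg_right (e.le_p1 x) hTP)
        gcongr
      have t2 : |U x + ε * K x| ^ e.P x * (|c| * e.S x * (l + ε * c) ^ (-e.S x - 1)) ≤
          T x ^ e.P x * (|c| * e.s1 * ((l / 2) ^ (-e.S x) * (2 / l))) := by
        have := e.le_s1 x
        have := e.s1_pos
        gcongr
      calc _ ≤ _ := add_le_add t1 t2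
        _ = _ := by ring)
    ((integrable_integrand hT hTl hl2).const_mul _)
    (by
      refine Eventually.of_forall fun x ε hε => ?_
      obtain ⟨hlb, -⟩ := hbase ε hε
      have hpos : 0 < l + ε * c := hl2.trans_le hlb
      have d1 : HasDerivAt (fun ε : ℝ => U x + ε * K x) (K x) ε := by
        simpa using ((hasDerivAt_id ε).mul_const (K x)).const_add (U x)
      have d2 : HasDerivAt (fun ε : ℝ => l + ε * c) c ε := by
        simpa using ((hasDerivAt_id ε).mul_const c).const_add l
      have d3 := (hasDerivAt_abs_rpow (U x + ε * K x) (e.one_lt_P x)).comp ε d1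
      have d4 := d2.rpow_const (p := -e.S x) (Or.inl hpos.ne')
      exact d3.mul d4)
  refine key.2.congr_deriv ?_
  have hi := integrable_dirDeriv (e := e) hU hK hT hTl hU1 hK1 hl
  have hi2 : F' 0 = fun x => e.P x * |U x| ^ (e.P x - 2) * U x * K x * l ^ (-e.S x) +
      (-c) * (e.S x * |U x| ^ e.P x * l ^ (-e.S x - 1)) := by
    funext x
    simp only [hF', zero_mul, add_zero]
    ring
  have hi3 : Integrable (fun x => (-c) * (e.S x * |U x| ^ e.P x * l ^ (-e.S x - 1))) μ := by
    refine (key.1.sub hi).congr (Eventually.of_forall fun x => ?_)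
    simp only [hi2, Pi.sub_apply, add_sub_cancel_left]
  rw [hi2, integral_add hi hi3, integral_const_mul]
  simp only [dirDeriv, levelDeriv]
  ring

end ExponentPair

lemma HasDerivAt.eventually_right_lt {f : ℝ → ℝ} {f' c : ℝ} (h : HasDerivAt f f' 0) (hc : f' < 0)
    (h0 : f 0 = c) : ∀ᶠ t in 𝓝[>] (0 : ℝ), f t < c := by
  have h1 := (hasDerivAt_iff_tendsto_slope_zero.1 h).mono_left
    (nhdsWithin_mono 0 (fun t (ht : 0 < t) => ht.ne'))
  filter_upwards [h1.eventually (gt_mem_nhds hc), eventually_mem_nhdsWithin] with t ht ht0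
  have ht0' : 0 < t := ht0
  simp only [zero_add, smul_eq_mul] at ht
  rw [inv_mul_lt_iff₀ ht0'] at ht
  linarith

/-! ### Midpoint convexity and equality of derivatives -/

namespace ExponentPair

variable {α : Type*} [MeasurableSpace α] {μ : Measure α} {e : ExponentPair α}

variable (e μ) in
/-- Midpoint convexity of the level. -/
def MidpointConvex : Prop := ∀ f g : α → ℝ, AEMeasurable f μ → AEMeasurable g μ →
  2 * e.level μ (fun x => (f x + g x) / 2) ≤ e.level μ f + e.level μ g

lemma MidpointConvex.level_add_lt_top (hc : e.MidpointConvex μ) {f g : α → ℝ}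
    (hf : AEMeasurable f μ) (hg : AEMeasurable g μ) (hf' : e.level μ f < ∞)
    (hg' : e.level μ g < ∞) : e.level μ (fun x => f x + g x) < ∞ := by
  have h := hc _ _ (hf.const_mul 2) (hg.const_mul 2)
  have h1 := ENNReal.add_lt_top.2 ⟨level_const_mul_lt_top hf' 2, level_const_mul_lt_top hg' 2⟩
  have h2 := h.trans_lt h1
  refine lt_of_le_of_lt ?_ h2
  have : (fun x => (2 * f x + 2 * g x) / 2) = fun x => f x + g x := by
    funext x; ring
  rw [this]
  exact le_mul_of_one_le_left zero_le (by norm_num)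

lemma integral_eq_one {U : α → ℝ} (hU : AEMeasurable U μ) {l : ℝ} (hl : 0 < l)
    (h : e.level μ U = ENNReal.ofReal l) : ∫ x, |U x| ^ e.P x * l ^ (-e.S x) ∂μ = 1 := by
  have h1 := levelIntegral_eq_one hl h
  rw [levelIntegral_eq_ofReal hU (h ▸ ENNReal.ofReal_lt_top) hl] at h1
  exact ENNReal.ofReal_eq_one.1 h1

/-- By S ≥ `s0` and the normalization of the level integral to 1, the derivative is at least `s0` /
l. -/
lemma levelDeriv_pos {U : α → ℝ} (hU : AEMeasurable U μ) {l : ℝ} (hl : 0 < l)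
    (h : e.level μ U = ENNReal.ofReal l) : 0 < e.levelDeriv μ l U := by
  have hfin : e.level μ U < ∞ := h ▸ ENNReal.ofReal_lt_top
  have hint := integrable_integrand hU hfin hl
  have h1 := integral_eq_one hU hl h
  have hterm : ∀ x, e.S x * |U x| ^ e.P x * l ^ (-e.S x - 1) =
      (e.S x / l) * (|U x| ^ e.P x * l ^ (-e.S x)) := fun x => by
    rw [Real.rpow_sub_one hl.ne']; field_simp
  have hlow : ∫ x, (e.s0 / l) * (|U x| ^ e.P x * l ^ (-e.S x)) ∂μ ≤ e.levelDeriv μ l U := by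
    refine integral_mono_of_nonneg (Eventually.of_forall fun x => ?_) ?_
      (Eventually.of_forall fun x => ?_)
    · have := e.s0_pos
      positivity
    · refine (hint.const_mul (e.s1 / l)).mono' ?_ (Eventually.of_forall fun x => ?_)
      · have h1 : AEMeasurable (fun x => |U x|) μ := hU.norm
        exact ((e.measurable_S.aemeasurable.mul (h1.pow e.measurable_P.aemeasurable)).mul
          (measurable_const.pow (e.measurable_S.neg.sub_const 1)).aemeasurable).aestronglyMeasurable
      · have := e.S_pos x
        have := e.le_s1 x
        rw [hterm, Real.norm_of_nonneg (by positivity)]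
        gcongr
    · have := e.s0_le x
      simp only [hterm]
      gcongr
  rw [integral_const_mul, h1, mul_one] at hlow
  exact (div_pos e.s0_pos hl).trans_le hlow

/-- At a midpoint of equality in the convexity of the level, directional derivatives of the level
are dominated by those at the end points. -/
lemma MidpointConvex.dirDeriv_div_le (hc : e.MidpointConvex μ) {U V W K T : α → ℝ} {a b : ℝ}
    (hU : AEMeasurable U μ) (hV : AEMeasurable V μ) (hW : AEMeasurable W μ)
    (hK : AEMeasurable K μ) (hT : AEMeasurable T μ) (hTl : e.level μ T < ∞)
    (hWeq : ∀ x, W x = (U x + V x) / 2)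
    (hUT : ∀ x, |U x| + |K x| ≤ T x) (hWT : ∀ x, |W x| + |K x| ≤ T x) (ha : 0 < a) (hb : 0 < b)
    (hUa : e.level μ U = ENNReal.ofReal a) (hVb : e.level μ V = ENNReal.ofReal b)
    (hWm : e.level μ W = ENNReal.ofReal ((a + b) / 2)) :
    e.dirDeriv μ ((a + b) / 2) W K / e.levelDeriv μ ((a + b) / 2) W ≤
      e.dirDeriv μ a U K / e.levelDeriv μ a U := by
  by_contra hlt
  -- The quotients are the implicit derivatives of the level. For the trial slope c, the level grows
  -- more slowly than c at U and faster than c at W.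
  obtain ⟨c, hc1, hc2⟩ := exists_between (not_le.1 hlt)
  have hm : 0 < (a + b) / 2 := by positivity
  rw [div_lt_iff₀ (levelDeriv_pos hU ha hUa)] at hc1
  rw [lt_div_iff₀ (levelDeriv_pos hW hm hWm)] at hc2
  have hdU := hasDerivAt_levelIntegral (e := e) hU hK hT hTl hUT ha c
  have hdW := hasDerivAt_levelIntegral (e := e) hW hK hT hTl hWT hm c
  have hfinite : ∀ (f : α → ℝ), (∀ x, |f x| + |K x| ≤ T x) → ∀ ε : ℝ, |ε| ≤ 1 →
      e.level μ (fun x => f x + ε * K x) < ∞ := by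
    intro f hf ε hε
    refine lt_of_le_of_lt (level_mono (Eventually.of_forall fun x => ?_)) hTl
    refine (abs_add_le _ _).trans (le_trans ?_ ((hf x).trans (le_abs_self _)))
    rw [abs_mul]
    have := mul_le_of_le_one_left (abs_nonneg (K x)) hε
    linarith
  have evU := hdU.eventually_right_lt (c := 1) (by linarith)
    (by simpa using integral_eq_one hU ha hUa)
  have evW := hdW.neg.eventually_right_lt (c := -1) (by linarith)
    (by simpa using integral_eq_one hW hm hWm)
  -- A step t at W is matched with a step 2t at U, since W + tK is the midpoint of U + 2tK and V.
  have hdouble : Tendsto (fun t : ℝ => 2 * t) (𝓝[>] 0) (𝓝[>] 0) := by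
    refine tendsto_nhdsWithin_iff.2 ⟨?_, ?_⟩
    · have : Tendsto (fun t : ℝ => 2 * t) (𝓝 0) (𝓝 (2 * 0)) :=
        (continuous_const.mul continuous_id).tendsto 0
      rw [mul_zero] at this
      exact this.mono_left nhdsWithin_le_nhds
    · filter_upwards [eventually_mem_nhdsWithin] with t ht
      have : 0 < t := ht
      simp only [Set.mem_Ioi]
      linarith
  have hsmall : ∀ᶠ t : ℝ in 𝓝[>] 0, t < 1 / 2 :=
    nhdsWithin_le_nhds (gt_mem_nhds (by norm_num))
  have hpos : ∀ u : ℝ, 0 < u → ∀ d : ℝ, ∀ᶠ t : ℝ in 𝓝[>] 0, 0 < u + t * d := by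
    intro u hu d
    have : Tendsto (fun t : ℝ => u + t * d) (𝓝 0) (𝓝 (u + 0 * d)) :=
      (continuous_const.add (continuous_id.mul continuous_const)).tendsto 0
    rw [zero_mul, add_zero] at this
    exact nhdsWithin_le_nhds (this.eventually (lt_mem_nhds hu))
  obtain ⟨t, h1, h2, h3, h4, h5, h6⟩ := ((hdouble.eventually evU).and (evW.and (hsmall.and
    ((hpos a ha (2 * c)).and ((hpos _ hm c).and eventually_mem_nhdsWithin))))).exists
  have ht0 : 0 < t := h6
  have hfU := hfinite U hUT (2 * t) (by rw [abs_of_pos (by positivity)]; linarith)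
  have hfW := hfinite W hWT t (by rw [abs_of_pos ht0]; linarith)
  have hU' : e.level μ (fun x => U x + 2 * t * K x) ≤ ENNReal.ofReal (a + 2 * t * c) := by
    rw [level_le_ofReal_iff (by linarith),
      levelIntegral_eq_ofReal (f := fun x => U x + 2 * t * K x)
        (hU.add (hK.const_mul _)) hfU (by linarith), ENNReal.ofReal_le_one]
    exact h1.le
  have hW' : ENNReal.ofReal ((a + b) / 2 + t * c) < e.level μ (fun x => W x + t * K x) := by
    by_contra hle
    rw [not_lt, level_le_ofReal_iff h5,
      levelIntegral_eq_ofReal (f := fun x => W x + t * K x)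
        (hW.add (hK.const_mul _)) hfW h5, ENNReal.ofReal_le_one] at hle
    simp only [Pi.neg_apply] at h2
    linarith
  have hconv := hc (fun x => U x + 2 * t * K x) V (hU.add (hK.const_mul (2 * t))) hV
  have hmid : (fun x => (U x + 2 * t * K x + V x) / 2) = fun x => W x + t * K x := by
    funext x
    rw [hWeq]
    ring
  rw [hmid, hVb] at hconv
  have h7 : 2 * e.level μ (fun x => W x + t * K x) ≤ ENNReal.ofReal (a + 2 * t * c + b) := by
    rw [ENNReal.ofReal_add (by linarith) hb.le]
    exact hconv.trans (by gcongr)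
  have h8 : ENNReal.ofReal (a + 2 * t * c + b) = 2 * ENNReal.ofReal ((a + b) / 2 + t * c) := by
    rw [← ENNReal.ofReal_ofNat, ← ENNReal.ofReal_mul (by norm_num)]
    congr 1
    ring
  rw [h8] at h7
  exact absurd ((ENNReal.mul_le_mul_iff_right (by norm_num) (by norm_num)).1 h7) (not_le.2 hW')

variable (e) in
/-- The density of the derivative of the level. -/
noncomputable def weight (μ : Measure α) (l : ℝ) (U : α → ℝ) (x : α) : ℝ :=
  U x ^ (e.P x - 1) * l ^ (-e.S x) / e.levelDeriv μ l U

/-- Using K and -K in `dirDeriv_div_le` turns the inequality into an equality. Testing with (U + V)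
restricted to arbitrary measurable sets identifies the densities almost everywhere, and P (U + V)
cancels. -/
lemma MidpointConvex.weight_eq (hc : e.MidpointConvex μ) {U V W : α → ℝ} {a b : ℝ}
    (hU : AEMeasurable U μ) (hV : AEMeasurable V μ) (hW : AEMeasurable W μ)
    (hU0 : ∀ x, 0 ≤ U x) (hV0 : ∀ x, 0 ≤ V x)
    (hWeq : ∀ x, W x = (U x + V x) / 2) (ha : 0 < a) (hb : 0 < b)
    (hUa : e.level μ U = ENNReal.ofReal a) (hVb : e.level μ V = ENNReal.ofReal b)
    (hWm : e.level μ W = ENNReal.ofReal ((a + b) / 2)) :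
    ∀ᵐ x ∂μ, e.weight μ a U x = e.weight μ ((a + b) / 2) W x := by
  have hm : 0 < (a + b) / 2 := by positivity
  set T : α → ℝ := fun x => 2 * (U x + V x) with hTdef
  have hT : AEMeasurable T μ := (hU.add hV).const_mul 2
  have hTl : e.level μ T < ∞ := level_const_mul_lt_top (hc.level_add_lt_top hU hV
    (hUa ▸ ENNReal.ofReal_lt_top) (hVb ▸ ENNReal.ofReal_lt_top)) 2
  have hK0 : AEMeasurable (fun x => U x + V x) μ := hU.add hV
  have hUT : ∀ x, |U x| ≤ U x + V x := fun x => by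
    rw [abs_of_nonneg (hU0 x)]; linarith [hV0 x]
  have hWT : ∀ x, |W x| ≤ U x + V x := fun x => by
    rw [hWeq, abs_of_nonneg (by linarith [hU0 x, hV0 x])]; linarith [hU0 x, hV0 x]
  have hUV : ∀ x, |U x + V x| = U x + V x := fun x => abs_of_nonneg (add_nonneg (hU0 x) (hV0 x))
  have hT1 : ∀ x, U x + V x ≤ T x := fun x => by
    simp only [hTdef]; linarith [hU0 x, hV0 x]
  have hle : ∀ K : α → ℝ, AEMeasurable K μ → (∀ x, |K x| ≤ U x + V x) →
      e.dirDeriv μ ((a + b) / 2) W K / e.levelDeriv μ ((a + b) / 2) W ≤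
        e.dirDeriv μ a U K / e.levelDeriv μ a U := fun K hK hKb =>
    hc.dirDeriv_div_le hU hV hW hK hT hTl hWeq
      (fun x => by simp only [hTdef]; linarith [hUT x, hKb x])
      (fun x => by simp only [hTdef]; linarith [hWT x, hKb x]) ha hb hUa hVb hWm
  have hneg : ∀ (l : ℝ) (f K : α → ℝ),
      e.dirDeriv μ l f (fun x => -K x) = -e.dirDeriv μ l f K := by
    intro l f K
    unfold dirDeriv
    rw [← integral_neg]
    congr with x
    ring
  have heq : ∀ K : α → ℝ, AEMeasurable K μ → (∀ x, |K x| ≤ U x + V x) →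
      e.dirDeriv μ a U K / e.levelDeriv μ a U =
      e.dirDeriv μ ((a + b) / 2) W K / e.levelDeriv μ ((a + b) / 2) W := by
    intro K hK hKb
    refine le_antisymm ?_ (hle K hK hKb)
    have := hle (fun x => -K x) hK.neg (fun x => by rw [abs_neg]; exact hKb x)
    rw [hneg, hneg, neg_div, neg_div] at this
    linarith
  have hind : ∀ (l : ℝ) (f : α → ℝ) (E : Set α), MeasurableSet E →
      e.dirDeriv μ l f (E.indicator fun x => U x + V x) =
        ∫ x in E, e.P x * |f x| ^ (e.P x - 2) * f x * (U x + V x) * l ^ (-e.S x) ∂μ := by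
    intro l f E hE
    rw [← integral_indicator hE]
    unfold dirDeriv
    congr with x
    by_cases hx : x ∈ E <;> simp [hx]
  have hiU := (integrable_dirDeriv (e := e) hU hK0 hT hTl (fun x => (hUT x).trans (hT1 x))
    (fun x => (hUV x).le.trans (hT1 x)) ha).div_const (e.levelDeriv μ a U)
  have hiW := (integrable_dirDeriv (e := e) hW hK0 hT hTl (fun x => (hWT x).trans (hT1 x))
    (fun x => (hUV x).le.trans (hT1 x)) hm).div_const (e.levelDeriv μ ((a + b) / 2) W)
  have hae := Integrable.ae_eq_of_forall_setIntegral_eq _ _ hiU hiW (fun E hE _ => by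
    rw [integral_div, integral_div, ← hind a U E hE, ← hind _ W E hE]
    refine heq _ (hK0.indicator hE) fun x => ?_
    by_cases hx : x ∈ E
    · simp [hx, hUV]
    · simp only [hx, not_false_eq_true, Set.indicator_of_notMem, abs_zero]
      exact add_nonneg (hU0 x) (hV0 x))
  have hpow : ∀ x, ∀ y : ℝ, 0 ≤ y → |y| ^ (e.P x - 2) * y = y ^ (e.P x - 1) := by
    intro x y hy
    rcases hy.eq_or_lt with rfl | hy
    · rw [mul_zero, Real.zero_rpow (by linarith [e.one_lt_P x])]
    · rw [abs_of_pos hy, ← Real.rpow_add_one hy.ne']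
      ring_nf
  filter_upwards [hae] with x hx
  have hW0 : 0 ≤ W x := by rw [hWeq]; linarith [hU0 x, hV0 x]
  have hP := e.P_pos x
  -- Where U + V = 0 nothing can be cancelled, but both weights are 0 because P > 1.
  rcases (add_nonneg (hU0 x) (hV0 x)).eq_or_lt with h0 | hpos
  · have hUz : U x = 0 := by linarith [hU0 x, hV0 x]
    have hWz : W x = 0 := by rw [hWeq]; linarith
    simp only [weight, hUz, hWz]
    rw [Real.zero_rpow (by linarith [e.one_lt_P x])]
    simp
  · simp only [mul_assoc (e.P x), hpow x _ (hU0 x), hpow x _ hW0] at hx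
    simp only [weight]
    have h2 : (e.P x * (U x + V x)) * (U x ^ (e.P x - 1) * a ^ (-e.S x) / e.levelDeriv μ a U) =
        (e.P x * (U x + V x)) * (W x ^ (e.P x - 1) * ((a + b) / 2) ^ (-e.S x) /
          e.levelDeriv μ ((a + b) / 2) W) := by
      calc _ = e.P x * (U x ^ (e.P x - 1) * (U x + V x) * a ^ (-e.S x)) / e.levelDeriv μ a U := by
            ring
        _ = _ := hx
        _ = _ := by ring
    exact mul_left_cancel₀ (by positivity) h2

end ExponentPair

/-! ### Strict convexity and strict monotonicity of the level -/

namespace ExponentPair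

section Seg

variable {α : Type*}

/-- The segment between two functions. -/
def seg (F G : α → ℝ) (r : ℝ) (x : α) : ℝ := (1 - r) * F x + r * G x

lemma seg_midpoint (F G : α → ℝ) (r s : ℝ) (x : α) :
    seg F G ((r + s) / 2) x = (seg F G r x + seg F G s x) / 2 := by
  unfold seg; ring

lemma seg_zero (F G : α → ℝ) : seg F G 0 = F := by funext x; simp [seg]

lemma seg_one (F G : α → ℝ) : seg F G 1 = G := by funext x; simp [seg]

lemma seg_nonneg {F G : α → ℝ} (hF : ∀ x, 0 ≤ F x) (hG : ∀ x, 0 ≤ G x) {r : ℝ} (h0 : 0 ≤ r)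
    (h1 : r ≤ 1) (x : α) : 0 ≤ seg F G r x :=
  add_nonneg (mul_nonneg (sub_nonneg.2 h1) (hF x)) (mul_nonneg h0 (hG x))

end Seg

variable {α : Type*} [MeasurableSpace α] {μ : Measure α} {e : ExponentPair α}

lemma aemeasurable_seg {F G : α → ℝ} (hF : AEMeasurable F μ) (hG : AEMeasurable G μ) (r : ℝ) :
    AEMeasurable (seg F G r) μ := (hF.const_mul (1 - r)).add (hG.const_mul r)

lemma weight_mul_self {U : α → ℝ} (hU0 : ∀ x, 0 ≤ U x) (l : ℝ) (x : α) :
    e.weight μ l U x * U x = |U x| ^ e.P x * l ^ (-e.S x) / e.levelDeriv μ l U := by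
  unfold weight
  have hP := e.one_lt_P x
  have : |U x| ^ e.P x = U x ^ (e.P x - 1) * U x := by
    rcases (hU0 x).eq_or_lt with h | h
    · rw [← h, abs_zero, Real.zero_rpow (by linarith), mul_zero]
    · rw [abs_of_pos h, ← Real.rpow_add_one h.ne']
      ring_nf
  rw [this]
  ring

lemma integrable_weight_mul_self {U : α → ℝ} (hU : AEMeasurable U μ) (hU0 : ∀ x, 0 ≤ U x) {l : ℝ}
    (hl : 0 < l) (h : e.level μ U = ENNReal.ofReal l) :
    Integrable (fun x => e.weight μ l U x * U x) μ := by
  simp only [weight_mul_self hU0]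
  exact (integrable_integrand hU (h ▸ ENNReal.ofReal_lt_top) hl).div_const _

/-- Shows that 1/Z is linear in U as long as the weight stays the same; this supplies the third
affine function in `affine_rigidity`. -/
lemma integral_weight_mul_self {U : α → ℝ} (hU : AEMeasurable U μ) (hU0 : ∀ x, 0 ≤ U x) {l : ℝ}
    (hl : 0 < l) (h : e.level μ U = ENNReal.ofReal l) :
    ∫ x, e.weight μ l U x * U x ∂μ = 1 / e.levelDeriv μ l U := by
  simp only [weight_mul_self hU0]
  rw [integral_div, integral_eq_one hU hl h]

lemma weight_eq_zero_iff {U : α → ℝ} (hU : AEMeasurable U μ) (hU0 : ∀ x, 0 ≤ U x) {l : ℝ}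
    (hl : 0 < l) (h : e.level μ U = ENNReal.ofReal l) (x : α) :
    e.weight μ l U x = 0 ↔ U x = 0 := by
  unfold weight
  have hZ := levelDeriv_pos hU hl h
  have hlS : 0 < l ^ (-e.S x) := by positivity
  have hP := e.one_lt_P x
  rw [div_eq_zero_iff, or_iff_left hZ.ne', mul_eq_zero, or_iff_left hlS.ne',
    Real.rpow_eq_zero (hU0 x) (by linarith)]

lemma log_weight {U : α → ℝ} (hU : AEMeasurable U μ) {l : ℝ}
    (hl : 0 < l) (h : e.level μ U = ENNReal.ofReal l) {x : α} (hx : 0 < U x) :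
    Real.log (e.weight μ l U x) = (e.P x - 1) * Real.log (U x) +
      Real.log (1 / e.levelDeriv μ l U) - e.S x * Real.log l := by
  unfold weight
  have hZ := levelDeriv_pos hU hl h
  have hlS : 0 < l ^ (-e.S x) := by positivity
  have hUP : 0 < U x ^ (e.P x - 1) := by positivity
  rw [Real.log_div (by positivity) hZ.ne', Real.log_mul hUP.ne' hlS.ne', Real.log_rpow hx,
    Real.log_rpow hl, one_div, Real.log_inv]
  ring

/-- `weight_eq` on nested midpoints gives one weight for the five parameters. Its logarithm at a
point is a combination of logarithms of functions affine in the parameter, which `affine_rigidity`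
restricts to two cases. -/
lemma MidpointConvex.eq_of_pos (hc : e.MidpointConvex μ) {F G : α → ℝ} {a b : ℝ}
    (hF : AEMeasurable F μ) (hG : AEMeasurable G μ) (hF0 : ∀ x, 0 ≤ F x) (hG0 : ∀ x, 0 ≤ G x)
    (ha : 0 < a) (hb : 0 < b)
    (h : ∀ r ∈ ({0, 1 / 4, 1 / 2, 3 / 4, 1} : Set ℝ),
      e.level μ (seg F G r) = ENNReal.ofReal ((1 - r) * a + r * b)) :
    ∀ᵐ x ∂μ, F x = G x := by
  set n : ℝ → ℝ := fun r => (1 - r) * a + r * b with hn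
  have hnpos : ∀ r, 0 ≤ r → r ≤ 1 → 0 < n r := by
    intro r h0 h1
    rcases h0.eq_or_lt with rfl | h0
    · simpa [hn] using ha
    · have := mul_pos h0 hb
      have := mul_nonneg (sub_nonneg.2 h1) ha.le
      simp only [hn]
      linarith
  have hm := aemeasurable_seg hF hG
  have l0 : e.level μ (seg F G 0) = ENNReal.ofReal (n 0) := h 0 (by simp)
  have l1 : e.level μ (seg F G (1 / 4)) = ENNReal.ofReal (n (1 / 4)) := h _ (by simp)
  have l2 : e.level μ (seg F G (1 / 2)) = ENNReal.ofReal (n (1 / 2)) := h _ (by simp)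
  have l3 : e.level μ (seg F G (3 / 4)) = ENNReal.ofReal (n (3 / 4)) := h _ (by simp)
  have l4 : e.level μ (seg F G 1) = ENNReal.ofReal (n 1) := h 1 (by simp)
  set ω : ℝ → α → ℝ := fun r => e.weight μ (n r) (seg F G r) with hω
  set Z : ℝ → ℝ := fun r => e.levelDeriv μ (n r) (seg F G r) with hZ
  have hw : ∀ r s t : ℝ, 0 ≤ r → r ≤ 1 → 0 ≤ s → s ≤ 1 → t = (r + s) / 2 →
      e.level μ (seg F G r) = ENNReal.ofReal (n r) → e.level μ (seg F G s) = ENNReal.ofReal (n s) →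
      e.level μ (seg F G t) = ENNReal.ofReal (n t) → ∀ᵐ x ∂μ, ω r x = ω t x := by
    intro r s t hr0 hr1 hs0 hs1 ht hr hs ht'
    have hnt : n t = (n r + n s) / 2 := by simp only [hn, ht]; ring
    have := hc.weight_eq (hm r) (hm s) (hm t) (seg_nonneg hF0 hG0 hr0 hr1)
      (seg_nonneg hF0 hG0 hs0 hs1) (fun x => by rw [ht]; exact seg_midpoint F G r s x)
      (hnpos r hr0 hr1) (hnpos s hs0 hs1) hr hs (by rw [ht', hnt])
    rw [← hnt] at this
    exact this
  have w02 := hw 0 1 (1 / 2) (by norm_num) (by norm_num) (by norm_num) (by norm_num) (by norm_num)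
    l0 l4 l2
  have w42 := hw 1 0 (1 / 2) (by norm_num) (by norm_num) (by norm_num) (by norm_num) (by norm_num)
    l4 l0 l2
  have w01 := hw 0 (1 / 2) (1 / 4) (by norm_num) (by norm_num) (by norm_num) (by norm_num)
    (by norm_num) l0 l2 l1
  have w43 := hw 1 (1 / 2) (3 / 4) (by norm_num) (by norm_num) (by norm_num) (by norm_num)
    (by norm_num) l4 l2 l3
  have w04 : ∀ᵐ x ∂μ, ω 0 x = ω 1 x := by
    filter_upwards [w02, w42] with x h1 h2 using h1.trans h2.symm
  have w03 : ∀ᵐ x ∂μ, ω 0 x = ω (3 / 4) x := by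
    filter_upwards [w04, w43] with x h1 h2 using h1.trans h2
  have hZpos : ∀ r, 0 ≤ r → r ≤ 1 → e.level μ (seg F G r) = ENNReal.ofReal (n r) → 0 < Z r :=
    fun r h0 h1 hr => levelDeriv_pos (hm r) (hnpos r h0 h1) hr
  have hi0 := integrable_weight_mul_self (e := e) (hm 0)
    (seg_nonneg hF0 hG0 le_rfl zero_le_one) (hnpos 0 le_rfl zero_le_one) l0
  have hi1 := integrable_weight_mul_self (e := e) (hm 1)
    (seg_nonneg hF0 hG0 zero_le_one le_rfl) (hnpos 1 zero_le_one le_rfl) l4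
  have hI0 := integral_weight_mul_self (e := e) (hm 0)
    (seg_nonneg hF0 hG0 le_rfl zero_le_one) (hnpos 0 le_rfl zero_le_one) l0
  have hI1 := integral_weight_mul_self (e := e) (hm 1)
    (seg_nonneg hF0 hG0 zero_le_one le_rfl) (hnpos 1 zero_le_one le_rfl) l4
  -- Integrating the common weight against the segment, which is affine in r, shows that 1/Z is
  -- affine.
  have hA : ∀ r, 0 ≤ r → r ≤ 1 → e.level μ (seg F G r) = ENNReal.ofReal (n r) →
      (∀ᵐ x ∂μ, ω 0 x = ω r x) → 1 / Z r = (1 - r) * (1 / Z 0) + r * (1 / Z 1) := by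
    intro r h0 h1 hr hwr
    have hIr := integral_weight_mul_self (e := e) (hm r) (seg_nonneg hF0 hG0 h0 h1)
      (hnpos r h0 h1) hr
    change _ = 1 / Z r at hIr
    change _ = 1 / Z 0 at hI0
    change _ = 1 / Z 1 at hI1
    rw [← hIr, ← hI0, ← hI1, ← integral_const_mul, ← integral_const_mul,
      ← integral_add (hi0.const_mul _) (hi1.const_mul _)]
    refine integral_congr_ae ?_
    filter_upwards [hwr, w04] with x hx hx4
    change ω r x * seg F G r x = (1 - r) * (ω 0 x * seg F G 0 x) + r * (ω 1 x * seg F G 1 x)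
    rw [← hx, ← hx4, seg_zero, seg_one, seg]
    ring
  have A1 := hA _ (by norm_num) (by norm_num) l1 w01
  have A2 := hA _ (by norm_num) (by norm_num) l2 w02
  have A3 := hA _ (by norm_num) (by norm_num) l3 w03
  have hZ0 := hZpos 0 le_rfl zero_le_one l0
  have hZ1 := hZpos 1 zero_le_one le_rfl l4
  have hpt : ∀ᵐ x ∂μ, (1 / Z 0 ≠ 1 / Z 1 → F x = G x) ∧ (1 / Z 0 = 1 / Z 1 → F x * b = G x * a) := by
    filter_upwards [w01, w02, w03, w04] with x h1 h2 h3 h4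
    have z0 := weight_eq_zero_iff (e := e) (hm 0) (seg_nonneg hF0 hG0 le_rfl zero_le_one)
      (hnpos 0 le_rfl zero_le_one) l0 x
    have z1 := weight_eq_zero_iff (e := e) (hm 1) (seg_nonneg hF0 hG0 zero_le_one le_rfl)
      (hnpos 1 zero_le_one le_rfl) l4 x
    change ω 0 x = 0 ↔ _ at z0
    change ω 1 x = 0 ↔ _ at z1
    rw [seg_zero] at z0
    rw [seg_one] at z1
    -- The common weight has the zeros of F and those of G, so logarithms are needed only where both
    -- functions are positive.
    have hFG : F x = 0 ↔ G x = 0 := by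
      rw [← z0, ← z1, h4]
    rcases (hF0 x).eq_or_lt with hz | hFpos
    · rw [hFG.1 hz.symm, ← hz]
      simp
    have hGpos : 0 < G x := (hG0 x).lt_of_ne fun hz => hFpos.ne' (hFG.2 hz.symm)
    have hs : ∀ r, 0 ≤ r → r ≤ 1 → 0 < seg F G r x := by
      intro r h0 h1
      rcases h0.eq_or_lt with rfl | h0
      · simpa [seg_zero] using hFpos
      · exact add_pos_of_nonneg_of_pos (mul_nonneg (sub_nonneg.2 h1) hFpos.le) (mul_pos h0 hGpos)
    have key : ∀ r, 0 ≤ r → r ≤ 1 → e.level μ (seg F G r) = ENNReal.ofReal (n r) →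
        ω 0 x = ω r x → 1 / Z r = (1 - r) * (1 / Z 0) + r * (1 / Z 1) →
        (e.P x - 1) * Real.log ((1 - r) * F x + r * G x) +
          Real.log ((1 - r) * (1 / Z 0) + r * (1 / Z 1)) -
            e.S x * Real.log ((1 - r) * a + r * b) = Real.log (ω 0 x) := by
      intro r h0 h1 hr hwr hAr
      rw [hwr, ← hAr]
      exact (log_weight (hm r) (hnpos r h0 h1) hr (hs r h0 h1)).symm
    have k0 := key 0 le_rfl zero_le_one l0 rfl (by ring)
    have hlast : Real.log (ω 0 x) = (e.P x - 1) * Real.log (F x) + Real.log (1 / Z 0) -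
        e.S x * Real.log a := by
      rw [← k0]; simp
    have hSP : e.S x < e.P x := div_lt_self (e.P_pos x) (e.one_lt_Q x)
    refine affine_rigidity (e.one_lt_P x) (e.S_pos x) hSP hFpos hGpos ha hb
      (one_div_pos.2 hZ0) (one_div_pos.2 hZ1) ?_
    intro r hr
    rw [← hlast]
    rcases hr with rfl | rfl | rfl | rfl
    · exact k0
    · exact key _ (by norm_num) (by norm_num) l1 h1 A1
    · exact key _ (by norm_num) (by norm_num) l2 h2 A2
    · exact key _ (by norm_num) (by norm_num) l3 h3 A3
  -- If they agree, G is b/a times F, and integrating both against the common weight gives 1/Z 1 =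
  -- (b/a)(1/Z 0), hence b = a.
  by_cases hZZ : 1 / Z 0 = 1 / Z 1
  · have hFG : ∀ᵐ x ∂μ, G x = b / a * F x := by
      filter_upwards [hpt] with x hx
      have := hx.2 hZZ
      field_simp
      linarith
    have hint : (1 / Z 1 : ℝ) = b / a * (1 / Z 0) := by
      change _ = 1 / Z 0 at hI0
      change _ = 1 / Z 1 at hI1
      rw [← hI0, ← hI1, ← integral_const_mul]
      refine integral_congr_ae ?_
      filter_upwards [w04, hFG] with x h4 hx
      change ω 1 x * seg F G 1 x = b / a * (ω 0 x * seg F G 0 x)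
      rw [← h4, seg_zero, seg_one, hx]
      ring
    rw [← hZZ] at hint
    have hba : b / a = 1 := by
      have hpos := one_div_pos.2 hZ0
      have : (b / a - 1) * (1 / Z 0) = 0 := by linarith
      have := (mul_eq_zero.1 this).resolve_right hpos.ne'
      linarith
    filter_upwards [hFG] with x hx
    rw [hx, hba, one_mul]
  · filter_upwards [hpt] with x hx using hx.1 hZZ

/-- At level 0 implicit differentiation is not available. Here F = 0, and halving G multiplies its
level by at most 2^(-`q0`) < 1/2, so equality at the midpoint forces G to have level 0. -/
lemma ae_eq_of_level_eq_zero {F G : α → ℝ}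
    (hF : AEMeasurable F μ) (hG : AEMeasurable G μ) (hF' : e.level μ F = 0)
    (hG' : e.level μ G < ∞)
    (h : 2 * e.level μ (fun x => (F x + G x) / 2) = e.level μ F + e.level μ G) :
    ∀ᵐ x ∂μ, F x = G x := by
  have hF0 := ae_eq_zero_of_level hF hF'
  have h1 : e.level μ (fun x => (F x + G x) / 2) = e.level μ (fun x => 2⁻¹ * G x) :=
    level_congr (by filter_upwards [hF0] with x hx; rw [hx]; ring_nf)
  have h2 := level_const_mul_le_of_le_one (e := e) (μ := μ) (c := 2⁻¹) (by norm_num) (by norm_num) G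
  have hlt : (2⁻¹ : ℝ) ^ e.q0 < 2⁻¹ := by
    nth_rw 2 [← Real.rpow_one (2⁻¹ : ℝ)]
    exact Real.rpow_lt_rpow_of_exponent_gt (by norm_num) (by norm_num) e.one_lt_q0
  rw [h1, hF', zero_add] at h
  have hG0 : e.level μ G = 0 := by
    by_contra hne
    have h3 : e.level μ G ≤ ENNReal.ofReal (2 * (2⁻¹ : ℝ) ^ e.q0) * e.level μ G := by
      rw [ENNReal.ofReal_mul (by norm_num), ENNReal.ofReal_ofNat, mul_assoc]
      nth_rw 1 [← h]
      gcongr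
    have h4 : ENNReal.ofReal (2 * (2⁻¹ : ℝ) ^ e.q0) < 1 := by
      rw [ENNReal.ofReal_lt_one]; linarith
    have h5 := ENNReal.mul_lt_mul_left hne hG'.ne h4
    rw [one_mul] at h5
    exact absurd h3 (not_le.2 h5)
  filter_upwards [hF0, ae_eq_zero_of_level hG hG0] with x hx hy
  rw [hx, hy]

/-- Strict convexity of the level on nonnegative functions. -/
lemma MidpointConvex.ae_eq_of_level_eq (hc : e.MidpointConvex μ) {F G : α → ℝ}
    (hF : AEMeasurable F μ) (hG : AEMeasurable G μ) (hF0 : ∀ x, 0 ≤ F x) (hG0 : ∀ x, 0 ≤ G x)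
    (hF' : e.level μ F < ∞) (hG' : e.level μ G < ∞)
    (h : 2 * e.level μ (fun x => (F x + G x) / 2) = e.level μ F + e.level μ G) :
    ∀ᵐ x ∂μ, F x = G x := by
  rcases eq_or_ne (e.level μ F) 0 with hFz | hFz
  · exact ae_eq_of_level_eq_zero hF hG hFz hG' h
  rcases eq_or_ne (e.level μ G) 0 with hGz | hGz
  · have := ae_eq_of_level_eq_zero hG hF hGz hF' (by
      rw [add_comm, ← h]; simp only [add_comm])
    filter_upwards [this] with x hx using hx.symm
  have hfin : ∀ r, e.level μ (seg F G r) < ∞ := fun r =>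
    hc.level_add_lt_top (hF.const_mul (1 - r)) (hG.const_mul r) (level_const_mul_lt_top hF' _)
      (level_const_mul_lt_top hG' _)
  set v : ℝ → ℝ := fun r => (e.level μ (seg F G r)).toReal with hv
  have hvr : ∀ r, e.level μ (seg F G r) = ENNReal.ofReal (v r) := fun r =>
    (ENNReal.ofReal_toReal (hfin r).ne).symm
  have hconv : ∀ r s t, t = (r + s) / 2 → 2 * v t ≤ v r + v s := by
    intro r s t ht
    have := hc _ _ (aemeasurable_seg hF hG r) (aemeasurable_seg hF hG s)
    simp only [← seg_midpoint, ← ht] at this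
    have h2 := ENNReal.toReal_mono (ENNReal.add_lt_top.2 ⟨hfin r, hfin s⟩).ne this
    rw [ENNReal.toReal_add (hfin r).ne (hfin s).ne, ENNReal.toReal_mul] at h2
    simpa using h2
  have hmid : 2 * v (1 / 2) = v 0 + v 1 := by
    have h2 := congrArg ENNReal.toReal h
    rw [ENNReal.toReal_add hF'.ne hG'.ne, ENNReal.toReal_mul] at h2
    have h3 : (fun x => (F x + G x) / 2) = seg F G (1 / 2) := by
      funext x; simp only [seg]; ring
    rw [h3] at h2
    simp only [hv, seg_zero, seg_one]
    simpa using h2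
  -- Equality at 1/2 together with these three convexity inequalities squeezes the values at 1/4 and
  -- 3/4, so v is affine at all five points.
  have c1 := hconv 0 (1 / 2) (1 / 4) (by norm_num)
  have c2 := hconv (1 / 2) 1 (3 / 4) (by norm_num)
  have c3 := hconv (1 / 4) (3 / 4) (1 / 2) (by norm_num)
  have ha : 0 < v 0 := by
    simp only [hv, seg_zero]; exact ENNReal.toReal_pos hFz hF'.ne
  have hb : 0 < v 1 := by
    simp only [hv, seg_one]; exact ENNReal.toReal_pos hGz hG'.ne
  refine hc.eq_of_pos hF hG hF0 hG0 ha hb ?_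
  intro r hr
  rw [hvr]
  congr 1
  rcases hr with rfl | rfl | rfl | rfl | rfl <;> linarith

/-- Strict monotonicity of the level. -/
lemma ae_eq_of_level_eq_of_le {F G : α → ℝ} (hF : AEMeasurable F μ) (hG : AEMeasurable G μ)
    (hF0 : ∀ x, 0 ≤ F x) (hFG : ∀ᵐ x ∂μ, F x ≤ G x) (hG' : e.level μ G < ∞)
    (h : e.level μ F = e.level μ G) : ∀ᵐ x ∂μ, F x = G x := by
  rcases eq_or_ne (e.level μ G) 0 with hz | hz
  · filter_upwards [ae_eq_zero_of_level hF (h.trans hz), ae_eq_zero_of_level hG hz] with x h1 h2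
    rw [h1, h2]
  set l := (e.level μ G).toReal with hl
  have hl0 : 0 < l := ENNReal.toReal_pos hz hG'.ne
  have hGl : e.level μ G = ENNReal.ofReal l := (ENNReal.ofReal_toReal hG'.ne).symm
  have hFl : e.level μ F = ENNReal.ofReal l := h.trans hGl
  have iF := integrable_integrand hF (h.symm ▸ hG') hl0
  have iG := integrable_integrand hG hG' hl0
  have hle : ∀ᵐ x ∂μ, |F x| ^ e.P x * l ^ (-e.S x) ≤ |G x| ^ e.P x * l ^ (-e.S x) := by
    filter_upwards [hFG] with x hx
    have := e.P_pos x
    have : |F x| ≤ |G x| := abs_le_abs_of_nonneg (hF0 x) hx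
    gcongr
  -- Both integrals are 1 at the common level, and the integrands are ordered, so they agree almost
  -- everywhere.
  have hint : ∫ x, |F x| ^ e.P x * l ^ (-e.S x) ∂μ = ∫ x, |G x| ^ e.P x * l ^ (-e.S x) ∂μ :=
    (integral_eq_one hF hl0 hFl).trans (integral_eq_one hG hl0 hGl).symm
  have heq := (integral_eq_iff_of_ae_le iF iG hle).1 hint
  filter_upwards [heq, hFG] with x hx hx2
  have hlS : 0 < l ^ (-e.S x) := by positivity
  have h1 : |F x| ^ e.P x = |G x| ^ e.P x := mul_right_cancel₀ hlS.ne' hx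
  have h2 := (Real.rpow_left_inj (abs_nonneg _) (abs_nonneg _) (e.P_pos x).ne').1 h1
  rwa [abs_of_nonneg (hF0 x), abs_of_nonneg ((hF0 x).trans hx2)] at h2

end ExponentPair

/-! ### The mixed space in terms of levels, and its strict convexity -/

namespace VarMixed

variable {n : ℕ} {𝕜 : Type*} [RCLike 𝕜]

/-- The bounded exponents `e` represent `p` and `q` almost everywhere. -/
def Represents (e : ExponentPair (EuclideanSpace ℝ (Fin n))) (p q : VarExponent n) : Prop :=
  ∀ᵐ x, (p x ≠ ∞ ∧ (p x).toReal = e.P x) ∧ (q x).toReal = e.Q x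

/-- With a constant c strictly between 1 and the essential infimum, clamping to the range from c to
the essential supremum alters the exponent only on a null set and gives bounds valid everywhere. -/
lemma exists_clamp (p : VarExponent n) (hp : 1 < p.minus) (hp' : p.plus < ∞) :
    ∃ (P : EuclideanSpace ℝ (Fin n) → ℝ) (p0 p1 : ℝ), Measurable P ∧ 1 < p0 ∧
      (∀ x, p0 ≤ P x) ∧ (∀ x, P x ≤ p1) ∧ ∀ᵐ x, p x ≠ ∞ ∧ (p x).toReal = P x := by
  obtain ⟨c, hc1, hc2⟩ := exists_between hp
  have hc : c ≠ ∞ := ne_top_of_lt hc2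
  refine ⟨fun x => max c.toReal (min (p x).toReal p.plus.toReal), c.toReal,
    max c.toReal p.plus.toReal, ?_, ?_, fun x => le_max_left _ _, fun x => ?_, ?_⟩
  · exact measurable_const.max (p.measurable_toFun.ennreal_toReal.min measurable_const)
  · simpa using (ENNReal.toReal_lt_toReal ENNReal.one_ne_top hc).2 hc1
  · exact max_le_max le_rfl (min_le_right _ _)
  · filter_upwards [ae_lt_of_lt_essInf hc2, ENNReal.ae_le_essSup (μ := volume) p.toFun]
      with x h1 h2
    have hx : p x ≠ ∞ := (h2.trans_lt hp').ne
    refine ⟨hx, ?_⟩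
    have h3 : (p x).toReal ≤ p.plus.toReal := ENNReal.toReal_mono hp'.ne h2
    have h4 : c.toReal ≤ (p x).toReal := ENNReal.toReal_mono hx h1.le
    rw [min_eq_left h3, max_eq_right h4]

lemma exists_represents (p q : VarExponent n)
    (hp : 1 < p.minus) (hp' : p.plus < ∞) (hq : 1 < q.minus) (hq' : q.plus < ∞) :
    ∃ e : ExponentPair (EuclideanSpace ℝ (Fin n)), Represents e p q := by
  obtain ⟨P, p0, p1, h1, h2, h3, h4, h5⟩ := exists_clamp p hp hp'
  obtain ⟨Q, q0, q1, k1, k2, k3, k4, k5⟩ := exists_clamp q hq hq'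
  refine ⟨⟨P, Q, p0, p1, q0, q1, h1, k1, h2, k2, h3, h4, k3, k4⟩, ?_⟩
  filter_upwards [h5, k5] with x hx hy using ⟨hx, hy.2⟩

variable {p q : VarExponent n} {e : ExponentPair (EuclideanSpace ℝ (Fin n))}

lemma lebModular_scaled (he : Represents e p q) (f : EuclideanSpace ℝ (Fin n) → 𝕜) {l : ℝ}
    (hl : 0 < l) : lebModular p (fun x => (l ^ ((q x)⁻¹).toReal)⁻¹ • f x) =
      e.levelIntegral volume l (fun x => ‖f x‖) := by
  unfold lebModular ExponentPair.levelIntegral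
  have h1 : volume.restrict {x | p x ≠ ∞} = volume :=
    Measure.restrict_eq_self_of_ae_mem (he.mono fun x hx => hx.1.1)
  have h2 : volume.restrict {x | p x = ∞} = 0 := by
    rw [Measure.restrict_eq_zero, ← nonpos_iff_eq_zero]
    have : volume {x | ¬ (p x ≠ ∞)} = 0 := ae_iff.1 (he.mono fun x hx => hx.1.1)
    simpa using this.le
  rw [h1, h2, eLpNormEssSup_measure_zero, add_zero]
  refine lintegral_congr_ae ?_
  filter_upwards [he] with x hx
  have hpos : 0 < (l ^ (e.Q x)⁻¹)⁻¹ := by positivity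
  have hP := e.P_pos x
  have hQ := e.Q_pos x
  rw [ENNReal.toReal_inv, hx.2, hx.1.2, ← ofReal_norm, norm_smul, Real.norm_of_nonneg hpos.le,
    ENNReal.ofReal_rpow_of_nonneg (by positivity) hP.le, Real.mul_rpow hpos.le (norm_nonneg _),
    abs_norm, mul_comm, ← Real.rpow_neg hl.le, ← Real.rpow_mul hl.le]
  congr 3
  unfold ExponentPair.S
  field_simp

lemma mixedTerm_eq_level (he : Represents e p q) (f : EuclideanSpace ℝ (Fin n) → 𝕜) :
    mixedTerm p q f = e.level volume (fun x => ‖f x‖) := by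
  unfold mixedTerm ExponentPair.level
  refine iInf_congr fun l => iInf_congr fun hl => ?_
  rw [lebModular_scaled he f hl]

lemma mixedModular_eq (he : Represents e p q) (f : ℕ → EuclideanSpace ℝ (Fin n) → 𝕜) :
    mixedModular p q f = ∑' ν, e.level volume (fun x => ‖f ν x‖) :=
  tsum_congr fun ν => mixedTerm_eq_level he (f ν)

lemma mixedModular_smul_le (he : Represents e p q) (f : ℕ → EuclideanSpace ℝ (Fin n) → 𝕜) {c : ℝ}
    (hc : 1 ≤ c) : mixedModular p q (fun ν x => c • f ν x) ≤
      ENNReal.ofReal (c ^ e.q1) * mixedModular p q f := by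
  rw [mixedModular_eq he, mixedModular_eq he, ← ENNReal.tsum_mul_left]
  refine ENNReal.tsum_le_tsum fun ν => ?_
  refine le_trans (le_of_eq ?_) (ExponentPair.level_const_mul_le_of_one_le hc _)
  congr with x
  rw [norm_smul, Real.norm_of_nonneg (by linarith)]

lemma mixedModular_lt_top (he : Represents e p q) (f : MixedSpace 𝕜 p q) :
    mixedModular p q (fun ν x => f.seq ν x) < ∞ := by
  obtain ⟨l, hl, hfin⟩ : MemMixed p q f.seq := f.2
  have h1 : 1 ≤ max l 1 := le_max_right _ _
  refine lt_of_le_of_lt (mixedModular_mono p q (g := fun ν x => max l 1 • l⁻¹ • f.seq ν x)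
    fun ν => Eventually.of_forall fun x => ?_) ((mixedModular_smul_le he _ h1).trans_lt
      (ENNReal.mul_lt_top ENNReal.ofReal_lt_top hfin))
  rw [smul_smul, norm_smul, Real.norm_of_nonneg (by positivity)]
  refine le_mul_of_one_le_left (norm_nonneg _) ?_
  rw [← div_eq_mul_inv, one_le_div hl]
  exact le_max_left _ _

lemma luxNorm_le_of_modular {f : MixedSpace 𝕜 p q} {K : ℝ} (hK : 0 < K)
    (h : mixedModular p q (fun ν x => K⁻¹ • f.seq ν x) ≤ 1) : luxNorm f ≤ K :=
  csInf_le (luxSet_bddBelow f) ⟨hK, h⟩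

/-- The modular of f is at most m^`q1` times that of f/m, so the bound for all m > 1 passes to m =
1. The same factor shows in `luxNorm_lt_one` that modular below 1 leaves room for a dilation. -/
lemma luxNorm_le_one_iff (he : Represents e p q) (f : MixedSpace 𝕜 p q) :
    luxNorm f ≤ 1 ↔ mixedModular p q (fun ν x => f.seq ν x) ≤ 1 := by
  constructor
  · intro h
    have key : ∀ m : ℝ, 1 < m →
        mixedModular p q (fun ν x => f.seq ν x) ≤ ENNReal.ofReal (m ^ e.q1) := by
      intro m hm
      obtain ⟨k, ⟨hk0, hk⟩, hkm⟩ := exists_lt_of_csInf_lt (luxSet_nonempty f) (h.trans_lt hm)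
      have hm0 : 0 < m := by linarith
      have h1 : mixedModular p q (fun ν x => m⁻¹ • f.seq ν x) ≤ 1 := by
        refine (mixedModular_mono p q fun ν => Eventually.of_forall fun x => ?_).trans hk
        rw [norm_smul, norm_smul, Real.norm_of_nonneg (by positivity),
          Real.norm_of_nonneg (by positivity)]
        gcongr
      have h2 := mixedModular_smul_le he (fun ν x => m⁻¹ • f.seq ν x) hm.le
      simp only [smul_smul, mul_inv_cancel₀ hm0.ne', one_smul] at h2
      refine h2.trans ?_
      calc _ ≤ ENNReal.ofReal (m ^ e.q1) * 1 := by gcongr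
        _ = _ := mul_one _
    have ht : Tendsto (fun m : ℝ => ENNReal.ofReal (m ^ e.q1)) (𝓝[>] 1) (𝓝 1) := by
      have h0 : ContinuousAt (fun m : ℝ => ENNReal.ofReal (m ^ e.q1)) 1 :=
        ENNReal.continuous_ofReal.continuousAt.comp
          (continuousAt_id.rpow_const (Or.inl one_ne_zero))
      have h1 := h0.tendsto
      simp only [Real.one_rpow, ENNReal.ofReal_one] at h1
      exact h1.mono_left nhdsWithin_le_nhds
    exact ge_of_tendsto ht (eventually_mem_nhdsWithin.mono key)
  · intro h
    exact luxNorm_le_of_modular one_pos (by simpa using h)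

lemma luxNorm_lt_one (he : Represents e p q) (f : MixedSpace 𝕜 p q)
    (h : mixedModular p q (fun ν x => f.seq ν x) < 1) : luxNorm f < 1 := by
  have ht : Tendsto (fun m : ℝ => ENNReal.ofReal (m ^ e.q1) *
      mixedModular p q (fun ν x => f.seq ν x)) (𝓝[>] 1)
      (𝓝 (1 * mixedModular p q (fun ν x => f.seq ν x))) := by
    refine ENNReal.Tendsto.mul_const ?_ (Or.inl one_ne_zero)
    have h0 : ContinuousAt (fun m : ℝ => ENNReal.ofReal (m ^ e.q1)) 1 :=
      ENNReal.continuous_ofReal.continuousAt.comp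
        (continuousAt_id.rpow_const (Or.inl one_ne_zero))
    have h1 := h0.tendsto
    simp only [Real.one_rpow, ENNReal.ofReal_one] at h1
    exact h1.mono_left nhdsWithin_le_nhds
  rw [one_mul] at ht
  obtain ⟨m, hm, hm1⟩ := ((ht.eventually (gt_mem_nhds h)).and eventually_mem_nhdsWithin).exists
  have hm1' : (1 : ℝ) < m := hm1
  have h2 : luxNorm f ≤ m⁻¹ := luxNorm_le_of_modular (by positivity) (by
    rw [inv_inv]
    exact (mixedModular_smul_le he _ hm1'.le).trans hm.le)
  exact h2.trans_lt (inv_lt_one_of_one_lt₀ hm1')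

/-- The element of the mixed space given by a sequence of functions. -/
noncomputable def mkMixed (F : ℕ → EuclideanSpace ℝ (Fin n) → 𝕜)
    (hF : ∀ ν, AEStronglyMeasurable (F ν)) (h : mixedModular p q F < ∞) : MixedSpace 𝕜 p q :=
  ⟨fun ν => AEEqFun.mk (F ν) (hF ν), 1, one_pos, by
    refine lt_of_le_of_lt (mixedModular_mono p q fun ν => ?_) h
    filter_upwards [AEEqFun.coeFn_mk (F ν) (hF ν)] with x hx
    rw [hx, inv_one, one_smul]⟩

lemma mkMixed_seq (F : ℕ → EuclideanSpace ℝ (Fin n) → 𝕜)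
    (hF : ∀ ν, AEStronglyMeasurable (F ν)) (h : mixedModular p q F < ∞) (ν : ℕ) :
    ∀ᵐ x, (mkMixed F hF h).seq ν x = F ν x :=
  AEEqFun.coeFn_mk (F ν) (hF ν)

lemma seq_add (f g : MixedSpace 𝕜 p q) (ν : ℕ) :
    ∀ᵐ x, (f + g).seq ν x = f.seq ν x + g.seq ν x :=
  AEEqFun.coeFn_add (f.seq ν) (g.seq ν)

lemma seq_sub (f g : MixedSpace 𝕜 p q) (ν : ℕ) :
    ∀ᵐ x, (f - g).seq ν x = f.seq ν x - g.seq ν x :=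
  AEEqFun.coeFn_sub (f.seq ν) (g.seq ν)

lemma seq_smul (c : 𝕜) (f : MixedSpace 𝕜 p q) (ν : ℕ) :
    ∀ᵐ x, (c • f).seq ν x = c * f.seq ν x :=
  AEEqFun.coeFn_smul c (f.seq ν)

lemma seq_zero (ν : ℕ) : ∀ᵐ x, (0 : MixedSpace 𝕜 p q).seq ν x = 0 :=
  AEEqFun.coeFn_zero (α := EuclideanSpace ℝ (Fin n)) (β := 𝕜) (μ := volume)

lemma seq_ext {f g : MixedSpace 𝕜 p q} (h : ∀ ν, ∀ᵐ x, f.seq ν x = g.seq ν x) : f = g :=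
  Subtype.ext (funext fun ν => AEEqFun.ext (h ν))

lemma seq_aestronglyMeasurable (f : MixedSpace 𝕜 p q) (ν : ℕ) :
    AEStronglyMeasurable (fun x => f.seq ν x) := (f.seq ν).aestronglyMeasurable

lemma mixedModular_congr {f g : ℕ → EuclideanSpace ℝ (Fin n) → 𝕜}
    (h : ∀ ν, ∀ᵐ x, f ν x = g ν x) : mixedModular p q f = mixedModular p q g :=
  le_antisymm (mixedModular_mono p q fun ν => (h ν).mono fun x hx => by rw [hx])
    (mixedModular_mono p q fun ν => (h ν).mono fun x hx => by rw [hx])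

/-- The triangle inequality of the Luxemburg functional forces the level to be midpoint convex. -/
lemma midpointConvex_of_luxTriangle (he : Represents e p q) (htri : LuxTriangle 𝕜 p q) :
    e.MidpointConvex volume := by
  intro f g hf hg
  by_contra hlt
  obtain ⟨c, hc1, hc2⟩ := ENNReal.lt_iff_exists_nnreal_btwn.1 (not_le.1 hlt)
  have hc0 : (0 : ℝ) < c := by
    have := (zero_le (a := e.level volume f + e.level volume g)).trans_lt hc1
    exact_mod_cast this
  rw [← ENNReal.ofReal_coe_nnreal] at hc1 hc2
  -- Multiplication by c^(-1/Q) divides levels by c. As c lies strictly between the two sides of the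
  -- failing inequality, the levels of T f and T g sum to at most 1.
  set T : (EuclideanSpace ℝ (Fin n) → ℝ) → EuclideanSpace ℝ (Fin n) → 𝕜 :=
    fun h x => (((c : ℝ)⁻¹ ^ (e.Q x)⁻¹ * h x : ℝ) : 𝕜) with hT
  have hTm : ∀ h, AEMeasurable h volume → AEStronglyMeasurable (T h) := by
    intro h hh
    have h1 : AEMeasurable (fun x => (c : ℝ)⁻¹ ^ (e.Q x)⁻¹ * h x) :=
      (measurable_const.pow e.measurable_Q.inv).aemeasurable.mul hh
    exact RCLike.continuous_ofReal.comp_aestronglyMeasurable h1.aestronglyMeasurable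
  have hTl : ∀ h, e.level volume (fun x => ‖T h x‖) ≤
      ENNReal.ofReal (c : ℝ)⁻¹ * e.level volume h := by
    intro h
    refine le_trans (le_of_eq ?_) (ExponentPair.level_rpow_mul_le (inv_pos.2 hc0) h)
    refine ExponentPair.level_congr (Eventually.of_forall fun x => ?_)
    simp only [hT, RCLike.norm_ofReal, abs_abs]
  have hzero : e.level volume (fun _ => ‖(0 : 𝕜)‖) = 0 :=
    ExponentPair.level_zero (Eventually.of_forall fun _ => norm_zero)
  set pair : (EuclideanSpace ℝ (Fin n) → 𝕜) → (EuclideanSpace ℝ (Fin n) → 𝕜) →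
    ℕ → EuclideanSpace ℝ (Fin n) → 𝕜 := fun a b ν =>
      if ν = 0 then a else if ν = 1 then b else fun _ => 0 with hpair
  have hpm : ∀ a b, AEStronglyMeasurable a → AEStronglyMeasurable b →
      ∀ ν, AEStronglyMeasurable (pair a b ν) := by
    intro a b ha hb ν
    simp only [hpair]
    split_ifs
    · exact ha
    · exact hb
    · exact aestronglyMeasurable_const
  have hpmod : ∀ a b, mixedModular p q (pair a b) =
      e.level volume (fun x => ‖a x‖) + e.level volume (fun x => ‖b x‖) := by
    intro a b
    rw [mixedModular_eq he, tsum_eq_sum (s := Finset.range 2)]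
    · simp [Finset.sum_range_succ, hpair]
    · intro ν hν
      have h2 : ¬ ν < 2 := fun h => hν (Finset.mem_range.2 h)
      have h0 : ν ≠ 0 := by omega
      have h1 : ν ≠ 1 := by omega
      simp only [hpair, h0, h1, if_false]
      exact hzero
  have hsum : e.level volume (fun x => ‖T f x‖) + e.level volume (fun x => ‖T g x‖) ≤ 1 := by
    calc _ ≤ _ := add_le_add (hTl f) (hTl g)
      _ = ENNReal.ofReal (c : ℝ)⁻¹ * (e.level volume f + e.level volume g) := by rw [mul_add]
      _ ≤ ENNReal.ofReal (c : ℝ)⁻¹ * ENNReal.ofReal c := by gcongr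
      _ = 1 := by
        rw [← ENNReal.ofReal_mul (by positivity), inv_mul_cancel₀ hc0.ne', ENNReal.ofReal_one]
  have h1 : mixedModular p q (pair (T f) (T g)) ≤ 1 := by rw [hpmod]; exact hsum
  have h2 : mixedModular p q (pair (T g) (T f)) ≤ 1 := by rw [hpmod, add_comm]; exact hsum
  -- The pair and its swap both lie in the unit ball. Their midpoint has two equal entries, so its
  -- modular is exactly twice one level.
  set A : MixedSpace 𝕜 p q := mkMixed _ (hpm _ _ (hTm f hf) (hTm g hg))
    (h1.trans_lt ENNReal.one_lt_top) with hA
  set B : MixedSpace 𝕜 p q := mkMixed _ (hpm _ _ (hTm g hg) (hTm f hf))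
    (h2.trans_lt ENNReal.one_lt_top) with hB
  have hA1 : luxNorm A ≤ 1 := (luxNorm_le_one_iff he A).2
    ((mixedModular_congr (mkMixed_seq _ _ _)).le.trans h1)
  have hB1 : luxNorm B ≤ 1 := (luxNorm_le_one_iff he B).2
    ((mixedModular_congr (mkMixed_seq _ _ _)).le.trans h2)
  have hM : luxNorm ((2⁻¹ : 𝕜) • (A + B)) ≤ 1 := by
    rw [luxNorm_smul, norm_inv, RCLike.norm_ofNat]
    have := htri A B
    linarith
  rw [luxNorm_le_one_iff he] at hM
  have hTadd : ∀ x, (2⁻¹ : 𝕜) * (T f x + T g x) = T (fun x => (f x + g x) / 2) x := by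
    intro x
    simp only [hT]
    push_cast
    ring
  have hMeq : mixedModular p q (fun ν x => ((2⁻¹ : 𝕜) • (A + B)).seq ν x) =
      mixedModular p q (pair (T fun x => (f x + g x) / 2) (T fun x => (f x + g x) / 2)) := by
    refine mixedModular_congr fun ν => ?_
    filter_upwards [seq_smul (2⁻¹ : 𝕜) (A + B) ν, seq_add A B ν,
      mkMixed_seq _ (hpm _ _ (hTm f hf) (hTm g hg)) (h1.trans_lt ENNReal.one_lt_top) ν,
      mkMixed_seq _ (hpm _ _ (hTm g hg) (hTm f hf)) (h2.trans_lt ENNReal.one_lt_top) ν]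
      with x e1 e2 e3 e4
    rw [e1, e2, hA, hB, e3, e4]
    simp only [hpair]
    split_ifs
    · exact hTadd x
    · rw [add_comm]; exact hTadd x
    · simp
  rw [hMeq, hpmod, ← two_mul] at hM
  have hback : e.level volume (fun x => (f x + g x) / 2) ≤ ENNReal.ofReal c *
      e.level volume (fun x => ‖T (fun x => (f x + g x) / 2) x‖) := by
    refine le_trans (le_of_eq ?_) (ExponentPair.level_rpow_mul_le hc0 _)
    refine ExponentPair.level_congr (Eventually.of_forall fun x => ?_)
    have hpos : 0 < (c : ℝ) ^ (e.Q x)⁻¹ := by positivity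
    simp only [hT, RCLike.norm_ofReal]
    rw [Real.inv_rpow hc0.le, abs_mul, abs_abs, abs_mul, abs_inv, abs_of_pos hpos,
      mul_inv_cancel_left₀ hpos.ne']
  refine absurd hc2 (not_lt.2 ?_)
  calc 2 * e.level volume (fun x => (f x + g x) / 2)
      ≤ 2 * (ENNReal.ofReal c * e.level volume (fun x => ‖T (fun x => (f x + g x) / 2) x‖)) := by
        gcongr
    _ = ENNReal.ofReal c * (2 * e.level volume (fun x => ‖T (fun x => (f x + g x) / 2) x‖)) := by
        ring
    _ ≤ ENNReal.ofReal c * 1 := by gcongr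
    _ = _ := mul_one _

lemma eq_of_norm_half_add {u v : 𝕜} (h1 : ‖u‖ = ‖v‖) (h2 : ‖(2⁻¹ : 𝕜) * (u + v)‖ = ‖u‖) :
    u = v := by
  have h := parallelogram_law_with_norm 𝕜 u v
  rw [norm_mul, norm_inv, RCLike.norm_ofNat] at h2
  have h3 : ‖u + v‖ = 2 * ‖u‖ := by linarith
  rw [h3, ← h1] at h
  have h4 : ‖u - v‖ * ‖u - v‖ = 0 := by linarith
  exact sub_eq_zero.1 (norm_eq_zero.1 (mul_self_eq_zero.1 h4))

/-- Strict convexity of the mixed space. -/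
lemma eq_of_norm_add_eq_two (he : Represents e p q) [Fact (LuxTriangle 𝕜 p q)]
    {u v : MixedSpace 𝕜 p q} (hu : ‖u‖ ≤ 1) (hv : ‖v‖ ≤ 1) (huv : 2 ≤ ‖u + v‖) : u = v := by
  have hc := midpointConvex_of_luxTriangle (𝕜 := 𝕜) he Fact.out
  have hu1 := (luxNorm_le_one_iff he u).1 hu
  have hv1 := (luxNorm_le_one_iff he v).1 hv
  set w : MixedSpace 𝕜 p q := (2⁻¹ : 𝕜) • (u + v) with hw
  have hw1 : 1 ≤ mixedModular p q (fun ν x => w.seq ν x) := by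
    by_contra hlt
    have h1 : ‖w‖ < 1 := luxNorm_lt_one he w (not_le.1 hlt)
    rw [hw, norm_smul, norm_inv, RCLike.norm_ofNat] at h1
    linarith
  rw [mixedModular_eq he] at hu1 hv1 hw1
  have hmeas : ∀ (f : MixedSpace 𝕜 p q) ν, AEMeasurable (fun x => ‖f.seq ν x‖) volume := fun f ν =>
    (seq_aestronglyMeasurable f ν).norm.aemeasurable
  have hwx : ∀ ν, ∀ᵐ x, ‖w.seq ν x‖ ≤ (‖u.seq ν x‖ + ‖v.seq ν x‖) / 2 := by
    intro ν
    filter_upwards [seq_smul (2⁻¹ : 𝕜) (u + v) ν, seq_add u v ν] with x h1 h2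
    rw [hw, h1, h2, norm_mul, norm_inv, RCLike.norm_ofNat]
    linarith [norm_add_le (u.seq ν x) (v.seq ν x)]
  have hw2 : ∀ ν, e.level volume (fun x => ‖w.seq ν x‖) ≤
      e.level volume (fun x => (‖u.seq ν x‖ + ‖v.seq ν x‖) / 2) := fun ν =>
    ExponentPair.level_mono ((hwx ν).mono fun x hx => by
      rw [abs_norm, abs_of_nonneg (by positivity)]; exact hx)
  have hw3 : ∀ ν, 2 * e.level volume (fun x => (‖u.seq ν x‖ + ‖v.seq ν x‖) / 2) ≤
      e.level volume (fun x => ‖u.seq ν x‖) + e.level volume (fun x => ‖v.seq ν x‖) := fun ν =>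
    hc _ _ (hmeas u ν) (hmeas v ν)
  have hle : ∀ ν, 2 * e.level volume (fun x => ‖w.seq ν x‖) ≤
      e.level volume (fun x => ‖u.seq ν x‖) + e.level volume (fun x => ‖v.seq ν x‖) := fun ν =>
    (mul_le_mul_right (hw2 ν) 2).trans (hw3 ν)
  have hsum : ∑' ν, (e.level volume (fun x => ‖u.seq ν x‖) +
      e.level volume (fun x => ‖v.seq ν x‖)) ≤ 2 := by
    rw [ENNReal.tsum_add]
    exact (add_le_add hu1 hv1).trans one_add_one_eq_two.le
  -- The left sides sum to at least 2 and the right sides to at most 2, so no termwise inequality is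
  -- strict.
  have heq : ∀ ν, 2 * e.level volume (fun x => ‖w.seq ν x‖) =
      e.level volume (fun x => ‖u.seq ν x‖) + e.level volume (fun x => ‖v.seq ν x‖) := by
    intro ν
    by_contra hne
    have hlt := ENNReal.tsum_lt_tsum
      (ne_top_of_le_ne_top ENNReal.ofNat_ne_top ((ENNReal.tsum_le_tsum hle).trans hsum))
      hle (lt_of_le_of_ne (hle ν) hne)
    rw [ENNReal.tsum_mul_left] at hlt
    have h2 : (2 : ℝ≥0∞) * 1 ≤ 2 * ∑' ν, e.level volume (fun x => ‖w.seq ν x‖) := by gcongr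
    rw [mul_one] at h2
    exact absurd (h2.trans_lt hlt) (not_lt.2 hsum)
  have hfin : ∀ (f : MixedSpace 𝕜 p q) ν, e.level volume (fun x => ‖f.seq ν x‖) < ∞ := by
    intro f ν
    have := mixedModular_lt_top he f
    rw [mixedModular_eq he] at this
    exact (ENNReal.le_tsum ν).trans_lt this
  refine seq_ext fun ν => ?_
  have e1 : 2 * e.level volume (fun x => (‖u.seq ν x‖ + ‖v.seq ν x‖) / 2) =
      e.level volume (fun x => ‖u.seq ν x‖) + e.level volume (fun x => ‖v.seq ν x‖) :=
    le_antisymm (hw3 ν) ((heq ν).ge.trans (mul_le_mul_right (hw2 ν) 2))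
  have e2 := hc.ae_eq_of_level_eq (hmeas u ν) (hmeas v ν) (fun x => norm_nonneg _)
    (fun x => norm_nonneg _) (hfin u ν) (hfin v ν) e1
  have e3 : e.level volume (fun x => ‖w.seq ν x‖) =
      e.level volume (fun x => (‖u.seq ν x‖ + ‖v.seq ν x‖) / 2) := by
    have := (heq ν).trans e1.symm
    exact (ENNReal.mul_right_inj (by norm_num) (by norm_num)).1 this
  have e4 := ExponentPair.ae_eq_of_level_eq_of_le (hmeas w ν)
    (((hmeas u ν).add (hmeas v ν)).div_const 2) (fun x => norm_nonneg _) (hwx ν)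
    (by
      have := ENNReal.add_lt_top.2 ⟨hfin u ν, hfin v ν⟩
      rw [← e1] at this
      exact (le_mul_of_one_le_left zero_le (by norm_num)).trans_lt this) e3
  filter_upwards [e2, e4, seq_smul (2⁻¹ : 𝕜) (u + v) ν, seq_add u v ν] with x h1 h2 h3 h4
  -- Strict convexity of the level gave |u| = |v|, strict monotonicity gave |w| = (|u| + |v|)/2;
  -- what remains is equality in the triangle inequality for scalars.
  refine eq_of_norm_half_add h1 ?_
  rw [hw, h3, h4] at h2
  rw [h2]
  simp only [Pi.add_apply]
  linarith

end VarMixed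

/-! ### Gateaux smoothness of a dual space -/

section Dual

variable {𝕜 X : Type*} [RCLike 𝕜] [NormedAddCommGroup X] [NormedSpace 𝕜 X]

lemma exists_lt_re_of_lt_norm (z : StrongDual 𝕜 X) {c : ℝ} (hc : c < ‖z‖) :
    ∃ u : X, ‖u‖ ≤ 1 ∧ c < RCLike.re (z u) := by
  rcases lt_or_ge c 0 with h0 | h0
  · exact ⟨0, by simp, by simpa using h0⟩
  obtain ⟨v, hv1, hv⟩ := z.exists_lt_apply_of_lt_opNorm hc
  obtain ⟨a, ha, hav⟩ := RCLike.exists_norm_eq_mul_self (z v)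
  refine ⟨a • v, by rw [norm_smul, ha, one_mul]; exact hv1.le, ?_⟩
  rw [map_smul, smul_eq_mul, ← hav, RCLike.ofReal_re]
  exact hv

lemma re_apply_le_norm (z : StrongDual 𝕜 X) {u : X} (hu : ‖u‖ ≤ 1) : RCLike.re (z u) ≤ ‖z‖ :=
  (RCLike.re_le_norm _).trans ((z.le_opNorm u).trans
    (mul_le_of_le_one_right (norm_nonneg _) hu))

/-- If the unit ball of `X` is strictly convex and pairs of functionals attain joint bounds on it,
then the dual of `X` is Gateaux smooth. -/
lemma isGateauxSmooth_dual (hstrict : ∀ u v : X, ‖u‖ ≤ 1 → ‖v‖ ≤ 1 → 2 ≤ ‖u + v‖ → u = v)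
    (hatt : ∀ (x y : StrongDual 𝕜 X) (a b : ℝ),
      (∀ ε : ℝ, 0 < ε → ∃ u : X, ‖u‖ ≤ 1 ∧ a - ε ≤ RCLike.re (x u) ∧ b - ε ≤ RCLike.re (y u)) →
      ∃ u : X, ‖u‖ ≤ 1 ∧ a ≤ RCLike.re (x u) ∧ b ≤ RCLike.re (y u)) :
    IsGateauxSmooth 𝕜 (StrongDual 𝕜 X) := by
  intro x hx y
  -- With the zero functional as second partner, this says that x attains its norm.
  obtain ⟨u0, hu0, hxu0, -⟩ := hatt x 0 1 0 (fun ε hε => by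
    obtain ⟨u, hu, h⟩ := exists_lt_re_of_lt_norm x (show 1 - ε < ‖x‖ by linarith)
    exact ⟨u, hu, h.le, by simpa using hε.le⟩)
  have huniq : ∀ u : X, ‖u‖ ≤ 1 → 1 ≤ RCLike.re (x u) → u = u0 := by
    intro u hu h
    refine hstrict u u0 hu hu0 ?_
    have h1 : RCLike.re (x (u + u0)) ≤ ‖u + u0‖ :=
      (RCLike.re_le_norm _).trans ((x.le_opNorm _).trans (by rw [hx, one_mul]))
    rw [map_add, map_add] at h1
    linarith
  have hre : ∀ (z : StrongDual 𝕜 X) (t : ℝ) (u : X),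
      RCLike.re ((x + (t : 𝕜) • z) u) = RCLike.re (x u) + t * RCLike.re (z u) := by
    intro z t u
    simp
  have hlow : ∀ (z : StrongDual 𝕜 X) (t : ℝ),
      1 + t * RCLike.re (z u0) ≤ ‖x + (t : 𝕜) • z‖ := by
    intro z t
    have := re_apply_le_norm (x + (t : 𝕜) • z) hu0
    rw [hre] at this
    linarith
  have hup : ∀ (z : StrongDual 𝕜 X) (ε : ℝ), 0 < ε → ∃ δ : ℝ, 0 < δ ∧ ∀ t : ℝ, 0 < t → t < δ →
      ‖x + (t : 𝕜) • z‖ ≤ 1 + t * (RCLike.re (z u0) + ε) := by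
    intro z ε hε
    by_contra! hcon
    obtain ⟨u, hu, h1, h2⟩ := hatt x z 1 (RCLike.re (z u0) + ε) (fun η hη => by
      set b := RCLike.re (z u0) + ε with hb
      -- Small enough that t (|b| + ‖z‖) < η, so an almost maximizer u of x + tz has Re x(u) > 1 -
      -- η. Since Re x(u) ≤ 1, it also has Re z(u) ≥ b.
      obtain ⟨t, ht0, htδ, ht⟩ := hcon (η / (|b| + ‖z‖ + 1)) (by positivity)
      obtain ⟨u, hu, h⟩ := exists_lt_re_of_lt_norm _ ht
      rw [hre] at h
      have h3 := re_apply_le_norm x hu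
      have h4 := re_apply_le_norm z hu
      rw [hx] at h3
      rw [lt_div_iff₀ (by positivity)] at htδ
      have h5 : t * RCLike.re (z u) ≤ t * ‖z‖ := by gcongr
      have h6 : -(t * |b|) ≤ t * b := by
        rw [← mul_neg]
        have := neg_abs_le b
        gcongr
      refine ⟨u, hu, by linarith, ?_⟩
      have h7 : t * b ≤ t * RCLike.re (z u) := by linarith
      have := le_of_mul_le_mul_left h7 ht0
      linarith)
    rw [huniq u hu h1] at h2
    linarith
  refine ⟨RCLike.re (y u0), ?_⟩
  rw [Metric.tendsto_nhdsWithin_nhds]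
  intro ε hε
  obtain ⟨δ1, hδ1, h1⟩ := hup y (ε / 2) (by positivity)
  obtain ⟨δ2, hδ2, h2⟩ := hup (-y) (ε / 2) (by positivity)
  refine ⟨min δ1 δ2, lt_min hδ1 hδ2, fun {t} ht htd => ?_⟩
  rw [dist_zero_right, Real.norm_eq_abs] at htd
  rw [Real.dist_eq, hx]
  rcases lt_or_gt_of_ne (show t ≠ 0 from ht) with hneg | hpos
  · rw [abs_of_neg hneg] at htd
    have h3 := h2 (-t) (by linarith) (htd.trans_le (min_le_right _ _))
    have h4 := hlow y t
    have h5 : x + ((-t : ℝ) : 𝕜) • (-y) = x + (t : 𝕜) • y := by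
      ext u
      simp [RCLike.real_smul_eq_coe_mul]
    rw [h5, neg_apply, map_neg] at h3
    refine lt_of_le_of_lt ?_ (half_lt_self hε)
    rw [abs_le]
    constructor
    · rw [neg_le_sub_iff_le_add, ← sub_le_iff_le_add, le_div_iff_of_neg hneg]
      linarith
    · rw [sub_le_iff_le_add, div_le_iff_of_neg hneg]
      linarith
  · rw [abs_of_pos hpos] at htd
    have h3 := h1 t hpos (htd.trans_le (min_le_left _ _))
    have h4 := hlow y t
    refine lt_of_le_of_lt ?_ (half_lt_self hε)
    rw [abs_le]
    constructor
    · rw [neg_le_sub_iff_le_add, ← sub_le_iff_le_add, le_div_iff₀ hpos]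
      linarith
    · rw [sub_le_iff_le_add, div_le_iff₀ hpos]
      linarith

end Dual

/-! ### Almost everywhere convergence of almost minimizers -/

section AlmostMinimizers

variable {𝕜 : Type*} [RCLike 𝕜]

/-- Normalized vectors are close when the triangle inequality is almost an equality. -/
lemma norm_normalize_sub_sq_le {V : Type*} [NormedAddCommGroup V] [InnerProductSpace 𝕜 V] {a b : V}
    (ha : 1 ≤ ‖a‖) (hb : 1 ≤ ‖b‖) :
    ‖((‖a‖⁻¹ : ℝ) : 𝕜) • a - ((‖b‖⁻¹ : ℝ) : 𝕜) • b‖ ^ 2 ≤ 4 * (‖a‖ + ‖b‖ - ‖a + b‖) := by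
  have hA : 0 < ‖a‖ := by linarith
  have hB : 0 < ‖b‖ := by linarith
  have hN := norm_add_sq (𝕜 := 𝕜) a b
  have hle := norm_add_le a b
  have hN0 := norm_nonneg (a + b)
  rw [norm_sub_sq (𝕜 := 𝕜), inner_smul_left, inner_smul_right, norm_smul, norm_smul,
    RCLike.norm_ofReal, RCLike.norm_ofReal, abs_inv, abs_inv, abs_norm, abs_norm,
    inv_mul_cancel₀ hA.ne', inv_mul_cancel₀ hB.ne', RCLike.conj_ofReal, ← mul_assoc,
    ← RCLike.ofReal_mul, RCLike.re_ofReal_mul]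
  set I := RCLike.re (inner 𝕜 a b) with hI
  generalize ‖a‖ = A at *
  generalize ‖b‖ = B at *
  generalize ‖a + b‖ = N at *
  have h1 : 2 * (A * B - I) ≤ (A + B - N) * (4 * (A * B)) := by
    have h2 : 2 * (A * B - I) = (A + B - N) * (A + B + N) := by linear_combination hN
    rw [h2]
    have h3 : 0 ≤ A + B - N := by linarith
    -- A + B + N ≤ 2(A + B) ≤ 4AB, the last because A, B ≥ 1.
    refine mul_le_mul_of_nonneg_left ?_ h3
    nlinarith
  have h4 : 1 ^ 2 - 2 * (A⁻¹ * B⁻¹ * I) + 1 ^ 2 = (2 * (A * B - I)) / (A * B) := by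
    field_simp
    ring
  rw [h4, div_le_iff₀ (by positivity)]
  linarith

/-- The vector `(1, s)` of the Hilbert space `𝕜 × 𝕜`. -/
noncomputable def oneLift (s : 𝕜) : WithLp 2 (𝕜 × 𝕜) := WithLp.toLp 2 (1, s)

lemma norm_oneLift_sq (s : 𝕜) : ‖oneLift s‖ ^ 2 = 1 + ‖s‖ ^ 2 := by
  rw [WithLp.prod_norm_sq_eq_of_L2]
  simp [oneLift]

lemma one_le_norm_oneLift (s : 𝕜) : 1 ≤ ‖oneLift s‖ := by
  have := norm_oneLift_sq s
  nlinarith [norm_nonneg (oneLift s), sq_nonneg ‖s‖]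

lemma norm_oneLift_le (s : 𝕜) : ‖oneLift s‖ ≤ 1 + ‖s‖ := by
  have := norm_oneLift_sq s
  nlinarith [norm_nonneg (oneLift s), norm_nonneg s]

lemma continuous_oneLift : Continuous (oneLift (𝕜 := 𝕜)) :=
  (WithLp.prod_continuous_toLp 2 𝕜 𝕜).comp (continuous_const.prodMk continuous_id)

lemma oneLift_midpoint (s t : 𝕜) :
    oneLift s + oneLift t = (2 : 𝕜) • oneLift ((2⁻¹ : 𝕜) * (s + t)) := by
  apply (WithLp.equiv 2 (𝕜 × 𝕜)).injective
  ext
  · simp [oneLift, one_add_one_eq_two]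
  · simp [oneLift]

/-- The normalization of `(1, s)`. -/
noncomputable def unitLift (s : 𝕜) : WithLp 2 (𝕜 × 𝕜) := ((‖oneLift s‖⁻¹ : ℝ) : 𝕜) • oneLift s

lemma norm_unitLift (s : 𝕜) : ‖unitLift s‖ = 1 := by
  have := one_le_norm_oneLift s
  rw [unitLift, norm_smul, RCLike.norm_ofReal, abs_inv, abs_norm, inv_mul_cancel₀ (by linarith)]

lemma continuous_unitLift : Continuous (unitLift (𝕜 := 𝕜)) := by
  have h : Continuous fun s : 𝕜 => ((‖oneLift s‖⁻¹ : ℝ) : 𝕜) :=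
    RCLike.continuous_ofReal.comp (continuous_oneLift.norm.inv₀ fun s =>
      (zero_lt_one.trans_le (one_le_norm_oneLift s)).ne')
  exact h.smul continuous_oneLift

/-- Quantitative strict convexity of sqrt(1 + |s|²). Measuring distances after normalization makes
the bound uniform in s and t and keeps everything bounded, hence in L² of a finite measure. -/
lemma norm_unitLift_sub_sq_le (s t : 𝕜) : ‖unitLift s - unitLift t‖ ^ 2 ≤
    4 * (‖oneLift s‖ + ‖oneLift t‖ - 2 * ‖oneLift ((2⁻¹ : 𝕜) * (s + t))‖) := by
  refine (norm_normalize_sub_sq_le (one_le_norm_oneLift s) (one_le_norm_oneLift t)).trans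
    (le_of_eq ?_)
  rw [oneLift_midpoint, norm_smul, RCLike.norm_ofNat]

/-- If the normalizations of `(1, s k)` converge and `s` does not tend to infinity, then `s`
converges. -/
lemma exists_tendsto_of_unitLift {s : ℕ → 𝕜} {W : WithLp 2 (𝕜 × 𝕜)}
    (h : Tendsto (fun k => unitLift (s k)) atTop (𝓝 W))
    (hfin : liminf (fun k => ‖s k‖ₑ) atTop < ∞) : ∃ z, Tendsto s atTop (𝓝 z) := by
  have h1 : Tendsto (fun k => ((‖oneLift (s k)‖⁻¹ : ℝ) : 𝕜)) atTop (𝓝 W.fst) := by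
    have := ((WithLp.prod_continuous_ofLp 2 𝕜 𝕜).fst.tendsto W).comp h
    simpa [Function.comp_def, unitLift, oneLift] using this
  have h2 : Tendsto (fun k => ((‖oneLift (s k)‖⁻¹ : ℝ) : 𝕜) * s k) atTop (𝓝 W.snd) := by
    have := ((WithLp.prod_continuous_ofLp 2 𝕜 𝕜).snd.tendsto W).comp h
    simpa [Function.comp_def, unitLift, oneLift] using this
  obtain ⟨R, hR1, -⟩ := ENNReal.lt_iff_exists_nnreal_btwn.1 hfin
  have hfr : ∃ᶠ k in atTop, ‖s k‖ ≤ R :=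
    (frequently_lt_of_liminf_lt (by isBoundedDefault) hR1).mono fun k hk => by
      have : ‖s k‖₊ < R := by exact_mod_cast hk
      exact_mod_cast this.le
  -- The first coordinate 1/‖(1, s k)‖ is at least 1/(1 + R) for infinitely many k, so its limit is
  -- nonzero and s is recovered as a quotient of coordinates.
  have hne : W.fst ≠ 0 := by
    intro h0
    rw [h0] at h1
    have h3 := h1.norm
    rw [norm_zero] at h3
    have hpos : (0 : ℝ) < (1 + (R : ℝ))⁻¹ := by positivity
    obtain ⟨k, hk1, hk2⟩ := (hfr.and_eventually (h3.eventually (gt_mem_nhds hpos))).exists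
    have h4 := one_le_norm_oneLift (s k)
    have h5 := norm_oneLift_le (s k)
    rw [RCLike.norm_ofReal, abs_inv, abs_norm,
      inv_lt_inv₀ (by linarith) (by positivity)] at hk2
    linarith
  refine ⟨W.snd / W.fst, ?_⟩
  refine (h2.div h1 hne).congr fun k => ?_
  have h4 := one_le_norm_oneLift (s k)
  have h5 : ((‖oneLift (s k)‖⁻¹ : ℝ) : 𝕜) ≠ 0 := by
    rw [Ne, RCLike.ofReal_eq_zero, inv_eq_zero]
    linarith
  simp only [Pi.div_apply]
  exact mul_div_cancel_left₀ _ h5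

lemma dist_toLp_sq {Ω V : Type*} [MeasurableSpace Ω] {m : Measure Ω} [NormedAddCommGroup V]
    {f g : Ω → V} (hf : MemLp f 2 m) (hg : MemLp g 2 m) :
    dist (hf.toLp f) (hg.toLp g) ^ 2 = ∫ x, ‖f x - g x‖ ^ 2 ∂m := by
  rw [dist_eq_norm, ← MemLp.toLp_sub, Lp.norm_toLp,
    (hf.sub hg).eLpNorm_eq_integral_rpow_norm (by norm_num) (by norm_num),
    ENNReal.toReal_ofReal (by positivity)]
  simp only [ENNReal.toReal_ofNat, Real.rpow_ofNat, Pi.sub_apply]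
  rw [← Real.rpow_natCast, ← Real.rpow_mul (by positivity)]
  simp

/-- A decreasing sequence of midpoint convex sets of functions, bounded in `L¹` of a finite
measure, admits a choice of elements that converges almost everywhere. -/
lemma exists_seq_tendsto_ae {Ω ι : Type*} [MeasurableSpace Ω] {m : Measure Ω} [IsFiniteMeasure m]
    {C : ℕ → Set ι} (hC : Antitone C) (hne : ∀ k, (C k).Nonempty) {rep : ι → Ω → 𝕜}
    (hrepm : ∀ i, StronglyMeasurable (rep i)) {B : ℝ≥0∞} (hBtop : B < ∞)
    (hB : ∀ i ∈ C 0, ∫⁻ x, ‖rep i x‖ₑ ∂m ≤ B)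
    (hmid : ∀ k, ∀ i ∈ C k, ∀ j ∈ C k, ∃ l ∈ C k,
      ∀ᵐ x ∂m, rep l x = (2⁻¹ : 𝕜) * (rep i x + rep j x)) :
    ∃ (u : ℕ → ι) (f : Ω → 𝕜), (∀ k, u k ∈ C k) ∧ StronglyMeasurable f ∧
      ∀ᵐ x ∂m, Tendsto (fun k => rep (u k) x) atTop (𝓝 (f x)) := by
  have hrep : ∀ i, AEStronglyMeasurable (rep i) m := fun i => (hrepm i).aestronglyMeasurable
  have hC0 : ∀ k, C k ⊆ C 0 := fun k => hC (Nat.zero_le k)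
  have hint : ∀ i ∈ C 0, Integrable (fun x => ‖oneLift (rep i x)‖) m := by
    intro i hi
    have h1 : Integrable (rep i) m := ⟨hrep i, (hB i hi).trans_lt hBtop⟩
    refine ((integrable_const (1 : ℝ)).add h1.norm).mono'
      (continuous_oneLift.comp_aestronglyMeasurable (hrep i)).norm ?_
    refine Eventually.of_forall fun x => ?_
    rw [norm_norm]
    exact norm_oneLift_le _
  set Φ : ι → ℝ := fun i => ∫ x, ‖oneLift (rep i x)‖ ∂m with hΦ
  have hΦ0 : ∀ i, 0 ≤ Φ i := fun i => integral_nonneg fun x => norm_nonneg _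
  have hΦB : ∀ i ∈ C 0, Φ i ≤ m.real Set.univ + B.toReal := by
    intro i hi
    have h1 : Integrable (rep i) m := ⟨hrep i, (hB i hi).trans_lt hBtop⟩
    calc Φ i ≤ ∫ x, (1 + ‖rep i x‖) ∂m :=
          integral_mono (hint i hi) ((integrable_const _).add h1.norm) fun x => norm_oneLift_le _
      _ = m.real Set.univ + ∫ x, ‖rep i x‖ ∂m := by
          rw [integral_add (integrable_const _) h1.norm]
          simp
      _ ≤ _ := by
          rw [integral_norm_eq_lintegral_enorm (hrep i)]
          gcongr
          · exact hBtop.ne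
          · exact hB i hi
  set d : ℕ → ℝ := fun k => sInf (Φ '' C k) with hd
  have hbdd : ∀ k, BddBelow (Φ '' C k) := fun k =>
    ⟨0, by rintro _ ⟨i, -, rfl⟩; exact hΦ0 i⟩
  have hdmono : Monotone d := fun j k hjk =>
    csInf_le_csInf (hbdd j) ((hne k).image Φ) (Set.image_mono (hC hjk))
  have hdB : BddAbove (Set.range d) := by
    refine ⟨m.real Set.univ + B.toReal, ?_⟩
    rintro _ ⟨k, rfl⟩
    obtain ⟨i, hi⟩ := hne k
    exact (csInf_le (hbdd k) ⟨i, hi, rfl⟩).trans (hΦB i (hC0 k hi))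
  have hdlim := tendsto_atTop_ciSup hdmono hdB
  set D := ⨆ k, d k with hD
  have hchoose : ∀ k : ℕ, ∃ i ∈ C k, Φ i < d k + 1 / ((k : ℝ) + 1) := by
    intro k
    obtain ⟨_, ⟨i, hi, rfl⟩, h⟩ := exists_lt_of_csInf_lt ((hne k).image Φ)
      (show d k < d k + 1 / ((k : ℝ) + 1) by
        have : (0 : ℝ) < 1 / ((k : ℝ) + 1) := by positivity
        linarith)
    exact ⟨i, hi, h⟩
  choose u hu hΦu using hchoose
  have hmem : ∀ k, MemLp (fun x => unitLift (rep (u k) x)) 2 m := fun k =>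
    MemLp.of_bound (continuous_unitLift.comp_aestronglyMeasurable (hrep _)) 1
      (Eventually.of_forall fun x => (norm_unitLift _).le)
  set w : ℕ → Lp (WithLp 2 (𝕜 × 𝕜)) 2 m := fun k => (hmem k).toLp _ with hw
  -- The midpoint of u j and u k stays in C N, so its value of Φ is at least d N, whereas u j and u
  -- k have values at most D + 1/(N+1).
  have hdist : ∀ N j k, N ≤ j → N ≤ k →
      dist (w j) (w k) ^ 2 ≤ 8 * (D - d N + 1 / ((N : ℝ) + 1)) := by
    intro N j k hj hk
    obtain ⟨l, hl, hlx⟩ := hmid N (u j) (hC hj (hu j)) (u k) (hC hk (hu k))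
    have hij := hint _ (hC0 j (hu j))
    have hik := hint _ (hC0 k (hu k))
    have hil := hint l (hC0 N hl)
    rw [hw, dist_toLp_sq]
    calc ∫ x, ‖unitLift (rep (u j) x) - unitLift (rep (u k) x)‖ ^ 2 ∂m
        ≤ ∫ x, 4 * (‖oneLift (rep (u j) x)‖ + ‖oneLift (rep (u k) x)‖ -
            2 * ‖oneLift (rep l x)‖) ∂m := by
          refine integral_mono_of_nonneg (Eventually.of_forall fun x => by positivity)
            (((hij.add hik).sub (hil.const_mul 2)).const_mul 4) ?_
          filter_upwards [hlx] with x hx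
          rw [hx]
          exact norm_unitLift_sub_sq_le _ _
      _ = 4 * (Φ (u j) + Φ (u k) - 2 * Φ l) := by
          have hs : Integrable (fun x => ‖oneLift (rep (u j) x)‖ + ‖oneLift (rep (u k) x)‖) m :=
            hij.add hik
          rw [integral_const_mul, integral_sub hs (hil.const_mul 2),
            integral_add hij hik, integral_const_mul]
      _ ≤ 8 * (D - d N + 1 / ((N : ℝ) + 1)) := by
          have e1 : d N ≤ Φ l := csInf_le (hbdd N) ⟨l, hl, rfl⟩
          have e2 : ∀ i, N ≤ i → Φ (u i) ≤ D + 1 / ((N : ℝ) + 1) := by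
            intro i hi
            have e3 : 1 / ((i : ℝ) + 1) ≤ 1 / ((N : ℝ) + 1) := by gcongr
            have e4 : d i ≤ D := le_ciSup hdB i
            linarith [hΦu i]
          linarith [e2 j hj, e2 k hk]
  have hcauchy : CauchySeq w := by
    refine cauchySeq_of_le_tendsto_0 (fun N => √(8 * (D - d N + 1 / ((N : ℝ) + 1))))
      (fun j k N hj hk => Real.le_sqrt_of_sq_le (hdist N j k hj hk)) ?_
    have h1 : Tendsto (fun N : ℕ => 8 * (D - d N + 1 / ((N : ℝ) + 1))) atTop
        (𝓝 (8 * (D - D + 0))) :=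
      ((tendsto_const_nhds.sub hdlim).add tendsto_one_div_add_atTop_nhds_zero_nat).const_mul 8
    have h2 := h1.sqrt
    simpa using h2
  obtain ⟨W, hW⟩ := cauchySeq_tendsto_of_complete hcauchy
  obtain ⟨φ, hφ, hae⟩ := (tendstoInMeasure_of_tendsto_Lp hW).exists_seq_tendsto_ae
  have hwae : ∀ᵐ x ∂m, ∀ k, w k x = unitLift (rep (u k) x) :=
    ae_all_iff.2 fun k => (hmem k).coeFn_toLp
  -- Fatou and the L¹ bound exclude escape to infinity almost everywhere, as
  -- `exists_tendsto_of_unitLift` requires.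
  have hliminf : ∫⁻ x, liminf (fun k => ‖rep (u (φ k)) x‖ₑ) atTop ∂m ≤ B := by
    refine (lintegral_liminf_le' fun k => (hrep _).enorm).trans ?_
    refine liminf_le_of_frequently_le' (Frequently.of_forall fun k => ?_)
    exact hB _ (hC0 _ (hu _))
  have hfin := ae_lt_top (Measurable.liminf fun k => (hrepm (u (φ k))).enorm)
    (hliminf.trans_lt hBtop).ne
  obtain ⟨f, hf, hlim⟩ := exists_stronglyMeasurable_limit_of_tendsto_ae
    (f := fun k => rep (u (φ k))) (μ := m) (fun k => hrep _) (by
      filter_upwards [hae, hwae, hfin] with x h1 h2 h3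
      simp only [h2] at h1
      exact exists_tendsto_of_unitLift h1 h3)
  exact ⟨fun k => u (φ k), f, fun k => hC (hφ.id_le k) (hu _), hf, hlim⟩

end AlmostMinimizers

/-! ### Small averages of sequences tending to zero almost everywhere -/

namespace VarMixed

variable {n : ℕ} {𝕜 : Type*} [RCLike 𝕜] {p q : VarExponent n}
  {e : ExponentPair (EuclideanSpace ℝ (Fin n))}

lemma seq_sum {ι : Type*} (s : Finset ι) (f : ι → MixedSpace 𝕜 p q) (ν : ℕ) :
    ∀ᵐ x, (∑ k ∈ s, f k).seq ν x = ∑ k ∈ s, (f k).seq ν x := by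
  classical
  induction s using Finset.induction_on with
  | empty => simpa using seq_zero (p := p) (q := q) ν
  | insert a s ha ih =>
    rw [Finset.sum_insert ha]
    filter_upwards [ih, seq_add (f a) (∑ k ∈ s, f k) ν] with x h1 h2
    rw [h2, h1, Finset.sum_insert ha]

lemma luxNorm_mono {f g : MixedSpace 𝕜 p q} (h : ∀ ν, ∀ᵐ x, ‖f.seq ν x‖ ≤ ‖g.seq ν x‖) :
    luxNorm f ≤ luxNorm g := by
  refine csInf_le_csInf (luxSet_bddBelow f) (luxSet_nonempty g) ?_
  rintro μ ⟨hμ0, hμ⟩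
  refine ⟨hμ0, (mixedModular_mono p q fun ν => ?_).trans hμ⟩
  filter_upwards [h ν] with x hx
  rw [norm_smul, norm_smul]
  gcongr

lemma exists_mixed_of_le (he : Represents e p q) (G : MixedSpace 𝕜 p q)
    {F : ℕ → EuclideanSpace ℝ (Fin n) → ℝ} (hF : ∀ ν, Measurable (F ν))
    (hle : ∀ ν, ∀ᵐ x, |F ν x| ≤ ‖G.seq ν x‖) :
    ∃ f : MixedSpace 𝕜 p q, ∀ ν, ∀ᵐ x, f.seq ν x = (F ν x : 𝕜) := by
  have hm : ∀ ν, AEStronglyMeasurable (fun x => (F ν x : 𝕜)) := fun ν =>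
    (RCLike.measurable_ofReal.comp (hF ν)).aestronglyMeasurable
  have hfin : mixedModular p q (fun ν x => (F ν x : 𝕜)) < ∞ := by
    refine lt_of_le_of_lt (mixedModular_mono p q fun ν => ?_) (mixedModular_lt_top he G)
    filter_upwards [hle ν] with x hx
    rwa [RCLike.norm_ofReal]
  exact ⟨mkMixed _ hm hfin, mkMixed_seq _ hm hfin⟩

lemma measurable_norm_seq (f : MixedSpace 𝕜 p q) (ν : ℕ) : Measurable fun x => ‖f.seq ν x‖ :=
  (f.seq ν).stronglyMeasurable.norm.measurable

lemma tendsto_tsum_zero_of_dominated {F : ℕ → ℕ → ℝ≥0∞} {g : ℕ → ℝ≥0∞} (hg : ∑' ν, g ν ≠ ∞)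
    (hle : ∀ k ν, F k ν ≤ g ν) (h : ∀ ν, Tendsto (fun k => F k ν) atTop (𝓝 0)) :
    Tendsto (fun k => ∑' ν, F k ν) atTop (𝓝 0) := by
  have := tendsto_lintegral_of_dominated_convergence (μ := Measure.count) (F := F)
    (f := fun _ => 0) g (fun k => measurable_of_countable _)
    (fun k => Eventually.of_forall (hle k)) (by rwa [lintegral_count])
    (Eventually.of_forall h)
  simpa [lintegral_count] using this

/-- Order continuity of the Luxemburg functional. -/
lemma tendsto_luxNorm_zero (he : Represents e p q) {h : ℕ → MixedSpace 𝕜 p q}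
    {G : MixedSpace 𝕜 p q} (hle : ∀ k ν, ∀ᵐ x, ‖(h k).seq ν x‖ ≤ ‖G.seq ν x‖)
    (hlim : ∀ ν, ∀ᵐ x, Tendsto (fun k => ‖(h k).seq ν x‖) atTop (𝓝 0)) :
    Tendsto (fun k => luxNorm (h k)) atTop (𝓝 0) := by
  rw [Metric.tendsto_atTop']
  intro ε hε
  have hε2 : 0 < ε / 2 := by positivity
  have hG := mixedModular_lt_top he G
  rw [mixedModular_eq he] at hG
  have hGfin : ∑' ν, e.level volume (fun x => (ε / 2)⁻¹ * ‖G.seq ν x‖) ≠ ∞ := by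
    have h1 := mixedModular_lt_top he ((((ε / 2)⁻¹ : ℝ) : 𝕜) • G)
    rw [mixedModular_eq he] at h1
    refine ne_top_of_le_ne_top h1.ne (ENNReal.tsum_le_tsum fun ν => ExponentPair.level_mono ?_)
    filter_upwards [seq_smul (((ε / 2)⁻¹ : ℝ) : 𝕜) G ν] with x hx
    rw [hx, norm_mul, RCLike.norm_ofReal, abs_mul, abs_mul, abs_abs]
  have ht := tendsto_tsum_zero_of_dominated
    (F := fun k ν => e.level volume (fun x => (ε / 2)⁻¹ * ‖(h k).seq ν x‖)) hGfin
    (fun k ν => ExponentPair.level_mono (by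
      filter_upwards [hle k ν] with x hx
      rw [abs_mul, abs_mul, abs_norm, abs_norm]
      gcongr))
    (fun ν => by
      refine ExponentPair.tendsto_level_zero
        (fun k => ((measurable_norm_seq (h k) ν).const_mul _).aemeasurable)
        (lt_of_le_of_lt (ENNReal.le_tsum ν) hGfin.lt_top) (fun k => ?_) ?_
      · filter_upwards [hle k ν] with x hx
        rw [abs_mul, abs_mul, abs_norm, abs_norm]
        gcongr
      · filter_upwards [hlim ν] with x hx
        simpa using hx.const_mul (ε / 2)⁻¹)
  obtain ⟨K, hK⟩ := eventually_atTop.1 (ht.eventually_le_const zero_lt_one)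
  refine ⟨K, fun k hk => ?_⟩
  rw [Real.dist_eq, sub_zero, abs_of_nonneg (luxNorm_nonneg _)]
  refine lt_of_le_of_lt (luxNorm_le_of_modular hε2 ?_) (half_lt_self hε)
  rw [mixedModular_eq he]
  refine le_trans (le_of_eq (tsum_congr fun ν => ?_)) (hK k hk.le)
  congr with x
  rw [norm_smul, Real.norm_of_nonneg (by positivity)]

/-- An upper estimate for the pointwise maximum of finitely many elements of the unit ball. -/
lemma luxNorm_max_le (he : Represents e p q) {s : Finset ℕ} (hs : s.Nonempty)
    {d : ℕ → MixedSpace 𝕜 p q} (hd : ∀ k, luxNorm (d k) ≤ 1) {D : MixedSpace 𝕜 p q}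
    (hD : ∀ ν, ∀ᵐ x, ∃ k ∈ s, ‖D.seq ν x‖ ≤ ‖(d k).seq ν x‖) :
    luxNorm D ≤ 2 * (s.card : ℝ) ^ (min e.p0 e.q0)⁻¹ := by
  have hcard : (0 : ℝ) < s.card := by exact_mod_cast hs.card_pos
  refine luxNorm_le_of_modular (by positivity) ?_
  rw [mixedModular_eq he]
  have hfin : ∀ k ν, e.level volume (fun x => ‖(d k).seq ν x‖) ≠ ∞ := by
    intro k ν
    have := mixedModular_lt_top he (d k)
    rw [mixedModular_eq he] at this
    exact ((ENNReal.le_tsum ν).trans_lt this).ne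
  -- The gain 1/card in each component cancels against the card many modulars, each at most 1, after
  -- summation over ν.
  have hν : ∀ ν, e.level volume
      (fun x => ‖(2 * (s.card : ℝ) ^ (min e.p0 e.q0)⁻¹)⁻¹ • D.seq ν x‖) ≤
      (∑ k ∈ s, e.level volume (fun x => ‖(d k).seq ν x‖)) / s.card := by
    intro ν
    have key := ExponentPair.level_max_le (e := e) (μ := volume) hs
      (d := fun k x => ‖(d k).seq ν x‖) (g := fun x => ‖D.seq ν x‖)
      (a := fun k => (e.level volume (fun x => ‖(d k).seq ν x‖)).toReal)
      (r := min e.p0 e.q0) (le_min e.one_lt_p0.le e.one_lt_q0.le) (min_le_left _ _)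
      (min_le_right _ _) (fun k => (measurable_norm_seq (d k) ν).aemeasurable)
      (fun k => ENNReal.toReal_nonneg) (fun k _ => (ENNReal.ofReal_toReal (hfin k ν)).ge)
      (by simpa only [abs_norm] using hD ν)
    rw [ENNReal.ofReal_div_of_pos hcard,
      ENNReal.ofReal_sum_of_nonneg fun k _ => ENNReal.toReal_nonneg,
      Finset.sum_congr rfl fun k _ => ENNReal.ofReal_toReal (hfin k ν),
      ENNReal.ofReal_natCast] at key
    refine le_trans (le_of_eq ?_) key
    congr with x
    rw [norm_smul, Real.norm_of_nonneg (by positivity)]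
  refine (ENNReal.tsum_le_tsum hν).trans ?_
  simp only [div_eq_mul_inv]
  rw [ENNReal.tsum_mul_right, Summable.tsum_finsetSum fun _ _ => ENNReal.summable]
  have hsum : ∑ k ∈ s, ∑' ν, e.level volume (fun x => ‖(d k).seq ν x‖) ≤ s.card := by
    refine (Finset.sum_le_sum (g := fun _ => 1) fun k _ => ?_).trans (by simp)
    have := (luxNorm_le_one_iff he (d k)).1 (hd k)
    rwa [mixedModular_eq he] at this
  calc _ ≤ (s.card : ℝ≥0∞) * (s.card : ℝ≥0∞)⁻¹ := by gcongr
    _ = 1 := ENNReal.mul_inv_cancel (by exact_mod_cast hs.card_pos.ne') (ENNReal.natCast_ne_top _)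

/-- In a bounded sequence that tends to zero almost everywhere, sums of suitable finite subfamilies
are almost as small in norm as the pointwise maxima. -/
lemma exists_finset_sum_le (he : Represents e p q) [Fact (LuxTriangle 𝕜 p q)]
    {d : ℕ → MixedSpace 𝕜 p q}
    (hlim : ∀ ν, ∀ᵐ x, Tendsto (fun k => (d k).seq ν x) atTop (𝓝 0)) {δ : ℝ} (hδ : 0 < δ) (j M : ℕ) :
    ∃ (s : Finset ℕ) (R : MixedSpace 𝕜 p q), s.card = M + 1 ∧ (∀ k ∈ s, j ≤ k) ∧ ‖R‖ ≤ M * δ ∧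
      ∀ ν, ∀ᵐ x, 0 ≤ RCLike.re (R.seq ν x) ∧ ∃ i ∈ s,
        ∑ k ∈ s, ‖(d k).seq ν x‖ ≤ ‖(d i).seq ν x‖ + RCLike.re (R.seq ν x) := by
  induction M with
  | zero =>
    refine ⟨{j}, 0, by simp, by simp, by simp, fun ν => ?_⟩
    filter_upwards [seq_zero (𝕜 := 𝕜) (p := p) (q := q) ν] with x hx
    simp [hx]
  | succ M ih =>
    obtain ⟨s, R, hcard, hj, hR, hs⟩ := ih
    have habs : ∀ k, ∃ f : MixedSpace 𝕜 p q, ∀ ν, ∀ᵐ x, f.seq ν x = (‖(d k).seq ν x‖ : 𝕜) := fun k =>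
      exists_mixed_of_le he (d k) (measurable_norm_seq (d k))
        (fun ν => Eventually.of_forall fun x => by rw [abs_norm])
    choose A hA using habs
    -- The sum of the moduli chosen so far. Since min(G, |d k|) is dominated by G and tends to 0
    -- almost everywhere, order continuity makes its norm at most δ for all late k.
    set G : MixedSpace 𝕜 p q := ∑ k ∈ s, A k with hG
    have hGx : ∀ ν, ∀ᵐ x, ‖G.seq ν x‖ = ∑ k ∈ s, ‖(d k).seq ν x‖ := by
      intro ν
      filter_upwards [seq_sum s A ν, ae_all_iff.2 fun k => hA k ν] with x h1 h2
      rw [hG, h1, Finset.sum_congr rfl fun k _ => h2 k, ← RCLike.ofReal_sum, RCLike.norm_ofReal,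
        abs_of_nonneg (Finset.sum_nonneg fun k _ => norm_nonneg _)]
    have hmin : ∀ k, ∃ f : MixedSpace 𝕜 p q, ∀ ν, ∀ᵐ x, f.seq ν x =
        ((min ‖G.seq ν x‖ ‖(d k).seq ν x‖ : ℝ) : 𝕜) := fun k =>
      exists_mixed_of_le he G (fun ν => (measurable_norm_seq G ν).min (measurable_norm_seq (d k) ν))
        (fun ν => Eventually.of_forall fun x => by
          rw [abs_of_nonneg (le_min (norm_nonneg _) (norm_nonneg _))]
          exact min_le_left _ _)
    choose h hh using hmin
    have hhn : ∀ k ν, ∀ᵐ x, ‖(h k).seq ν x‖ = min ‖G.seq ν x‖ ‖(d k).seq ν x‖ := by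
      intro k ν
      filter_upwards [hh k ν] with x hx
      rw [hx, RCLike.norm_ofReal, abs_of_nonneg (le_min (norm_nonneg _) (norm_nonneg _))]
    have ht := tendsto_luxNorm_zero he (h := h) (G := G)
      (fun k ν => (hhn k ν).mono fun x hx => by rw [hx]; exact min_le_left _ _)
      (fun ν => by
        filter_upwards [hlim ν, ae_all_iff.2 fun k => hhn k ν] with x h1 h2
        refine squeeze_zero (fun k => norm_nonneg _) (fun k => ?_) (by simpa using h1.norm)
        rw [h2 k]
        exact min_le_right _ _)
    obtain ⟨k, hkδ, hkj, hks⟩ := ((ht.eventually_le_const hδ).and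
      ((eventually_ge_atTop j).and (eventually_gt_atTop (s.sup id)))).exists
    have hk : k ∉ s := fun hmem => absurd (Finset.le_sup (f := id) hmem) (not_le.2 hks)
    refine ⟨insert k s, R + h k, by rw [Finset.card_insert_of_notMem hk, hcard], ?_, ?_, ?_⟩
    · intro i hi
      rcases Finset.mem_insert.1 hi with rfl | hi
      · exact hkj
      · exact hj i hi
    · have h1 := norm_add_le R (h k)
      have h2 : ‖h k‖ ≤ δ := hkδ
      push_cast
      linarith
    · intro ν
      filter_upwards [hs ν, hh k ν, seq_add R (h k) ν, hGx ν] with x ⟨h0, i, hi, h1⟩ h2 h3 h4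
      have hmin0 : 0 ≤ min ‖G.seq ν x‖ ‖(d k).seq ν x‖ := le_min (norm_nonneg _) (norm_nonneg _)
      rw [h3, map_add, h2, RCLike.ofReal_re]
      refine ⟨add_nonneg h0 hmin0, ?_⟩
      rw [Finset.sum_insert hk]
      -- The larger of the two moduli is kept as the distinguished term; the smaller is at most
      -- min(G, |d k|) and is absorbed by the remainder.
      rcases le_total ‖(d k).seq ν x‖ ‖(d i).seq ν x‖ with hki | hki
      · refine ⟨i, Finset.mem_insert_of_mem hi, ?_⟩
        have h5 : ‖(d i).seq ν x‖ ≤ ‖G.seq ν x‖ := by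
          rw [h4]
          exact Finset.single_le_sum (f := fun k => ‖(d k).seq ν x‖) (fun k _ => norm_nonneg _) hi
        rw [min_eq_right (hki.trans h5)]
        linarith
      · refine ⟨k, Finset.mem_insert_self _ _, ?_⟩
        have h5 : ‖(d i).seq ν x‖ ≤ ‖G.seq ν x‖ := by
          rw [h4]
          exact Finset.single_le_sum (f := fun k => ‖(d k).seq ν x‖) (fun k _ => norm_nonneg _) hi
        have h6 := le_min h5 hki
        linarith

/-- A sequence in the unit ball that tends to zero almost everywhere has arbitrarily small
averages. -/
lemma exists_average_small (he : Represents e p q) [Fact (LuxTriangle 𝕜 p q)]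
    {d : ℕ → MixedSpace 𝕜 p q} (hd : ∀ k, ‖d k‖ ≤ 1)
    (hlim : ∀ ν, ∀ᵐ x, Tendsto (fun k => (d k).seq ν x) atTop (𝓝 0)) {η : ℝ} (hη : 0 < η) (j : ℕ) :
    ∃ s : Finset ℕ, s.Nonempty ∧ (∀ k ∈ s, j ≤ k) ∧ ‖∑ k ∈ s, d k‖ ≤ s.card * η := by
  set r := min e.p0 e.q0 with hr
  have hr1 : 1 < r := lt_min e.one_lt_p0 e.one_lt_q0
  have ht : Tendsto (fun M : ℕ => 2 * ((M : ℝ) + 1) ^ (r⁻¹ - 1)) atTop (𝓝 0) := by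
    have h1 : Tendsto (fun M : ℕ => (M : ℝ) + 1) atTop atTop :=
      tendsto_atTop_add_const_right _ _ tendsto_natCast_atTop_atTop
    have h2 := (tendsto_rpow_neg_atTop (y := 1 - r⁻¹) (by
      rw [sub_pos]; exact inv_lt_one_of_one_lt₀ hr1)).comp h1
    have h3 := h2.const_mul 2
    simpa [Function.comp_def] using h3
  -- Since r > 1, the maximum of M + 1 terms divided by M + 1 is eventually below η/2; the other η/2
  -- is reserved for the remainder R.
  obtain ⟨M, hM⟩ := (ht.eventually_le_const (show (0 : ℝ) < η / 2 by positivity)).exists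
  obtain ⟨s, R, hcard, hj, hR, hs⟩ := exists_finset_sum_le he hlim
    (show (0 : ℝ) < η / 2 by positivity) j M
  have hne : s.Nonempty := Finset.card_pos.1 (by omega)
  refine ⟨s, hne, hj, ?_⟩
  have habs : ∀ k, ∃ f : MixedSpace 𝕜 p q, ∀ ν, ∀ᵐ x, f.seq ν x = (‖(d k).seq ν x‖ : 𝕜) := fun k =>
    exists_mixed_of_le he (d k) (measurable_norm_seq (d k))
      (fun ν => Eventually.of_forall fun x => by rw [abs_norm])
  choose A hA using habs
  obtain ⟨D, hD⟩ := exists_mixed_of_le he (∑ k ∈ s, A k)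
    (F := fun ν x => s.sup' hne fun k => ‖(d k).seq ν x‖)
    (fun ν => by
      convert Finset.measurable_sup' hne (fun k _ => measurable_norm_seq (d k) ν) using 1
      funext x
      rw [Finset.sup'_apply]) (fun ν => by
      filter_upwards [seq_sum s A ν, ae_all_iff.2 fun k => hA k ν] with x h1 h2
      obtain ⟨i, hi, hmax⟩ := Finset.exists_mem_eq_sup' hne fun k => ‖(d k).seq ν x‖
      rw [h1, Finset.sum_congr rfl fun k _ => h2 k, ← RCLike.ofReal_sum, RCLike.norm_ofReal,
        abs_of_nonneg (Finset.sum_nonneg fun k _ => norm_nonneg _), hmax, abs_norm]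
      exact Finset.single_le_sum (f := fun k => ‖(d k).seq ν x‖) (fun k _ => norm_nonneg _) hi)
  have hDn : ‖D‖ ≤ 2 * (s.card : ℝ) ^ r⁻¹ := luxNorm_max_le he hne hd fun ν => by
    filter_upwards [hD ν] with x hx
    obtain ⟨i, hi, hmax⟩ := Finset.exists_mem_eq_sup' hne fun k => ‖(d k).seq ν x‖
    refine ⟨i, hi, ?_⟩
    rw [hx, RCLike.norm_ofReal, hmax, abs_norm]
  have hle : ‖∑ k ∈ s, d k‖ ≤ ‖D + R‖ := luxNorm_mono fun ν => by
    filter_upwards [seq_sum s d ν, seq_add D R ν, hD ν, hs ν] with x h1 h2 h3 ⟨h4, i, hi, h5⟩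
    rw [h1, h2]
    refine (norm_sum_le _ _).trans (h5.trans (le_trans ?_ (RCLike.re_le_norm _)))
    rw [map_add, h3, RCLike.ofReal_re]
    have := Finset.le_sup' (fun k => ‖(d k).seq ν x‖) hi
    linarith
  have hM0 : (0 : ℝ) < (M : ℝ) + 1 := by positivity
  have hc : (s.card : ℝ) = (M : ℝ) + 1 := by rw [hcard]; push_cast; ring
  rw [hc] at hDn ⊢
  have h6 : 2 * ((M : ℝ) + 1) ^ r⁻¹ ≤ ((M : ℝ) + 1) * (η / 2) := by
    have h7 : ((M : ℝ) + 1) ^ r⁻¹ = ((M : ℝ) + 1) * ((M : ℝ) + 1) ^ (r⁻¹ - 1) := by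
      rw [Real.rpow_sub_one hM0.ne']
      field_simp
    rw [h7]
    calc _ = ((M : ℝ) + 1) * (2 * ((M : ℝ) + 1) ^ (r⁻¹ - 1)) := by ring
      _ ≤ _ := by gcongr
  have h8 := norm_add_le D R
  have h9 : (M : ℝ) * (η / 2) ≤ ((M : ℝ) + 1) * (η / 2) := by gcongr; linarith
  linarith

end VarMixed

/-! ### Attainment of joint bounds on the unit ball -/

/-- A positive integrable density capped at 1: positivity preserves the null sets, and the cap keeps
m below μ, so integral bounds carry over. -/
lemma exists_finite_measure_le {α : Type*} [MeasurableSpace α] (μ : Measure α) [SigmaFinite μ] :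
    ∃ m : Measure α, IsFiniteMeasure m ∧ m ≤ μ ∧ ae m = ae μ := by
  obtain ⟨g, hg0, hgm, hg⟩ := exists_pos_lintegral_lt_of_sigmaFinite μ (one_ne_zero (α := ℝ≥0∞))
  set w : α → ℝ≥0∞ := fun x => min (g x : ℝ≥0∞) 1 with hw
  have hwm : Measurable w := hgm.coe_nnreal_ennreal.min measurable_const
  have hw0 : ∀ x, w x ≠ 0 := fun x =>
    (lt_min (ENNReal.coe_pos.2 (hg0 x)) one_pos).ne'
  refine ⟨μ.withDensity w, isFiniteMeasure_withDensity ?_, ?_, ?_⟩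
  · exact ((lintegral_mono fun x => min_le_left _ _).trans_lt (hg.trans ENNReal.one_lt_top)).ne
  · calc μ.withDensity w ≤ μ.withDensity 1 :=
        withDensity_mono (Eventually.of_forall fun x => min_le_right _ _)
      _ = μ := withDensity_one
  · exact le_antisymm (withDensity_absolutelyContinuous μ w).ae_le
      (withDensity_absolutelyContinuous' hwm.aemeasurable (Eventually.of_forall hw0)).ae_le

namespace VarMixed

variable {n : ℕ} {𝕜 : Type*} [RCLike 𝕜] {p q : VarExponent n}
  {e : ExponentPair (EuclideanSpace ℝ (Fin n))}

lemma stronglyMeasurable_uncurry_seq (u : MixedSpace 𝕜 p q) :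
    StronglyMeasurable fun z : ℕ × EuclideanSpace ℝ (Fin n) => u.seq z.1 z.2 :=
  (measurable_from_prod_countable_right fun ν =>
    (u.seq ν).stronglyMeasurable.measurable).stronglyMeasurable

/-- From t ≤ 1 + t^P and the level integral at l = 1. This supplies the L¹ bound for
`exists_seq_tendsto_ae`. -/
lemma lintegral_enorm_seq_le (he : Represents e p q) {u : MixedSpace 𝕜 p q} (hu : luxNorm u ≤ 1)
    {m : Measure (EuclideanSpace ℝ (Fin n))} (hm : m ≤ volume) (ν : ℕ) :
    ∫⁻ x, ‖u.seq ν x‖ₑ ∂m ≤ m Set.univ + 1 := by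
  have h1 : e.level volume (fun x => ‖u.seq ν x‖) ≤ ENNReal.ofReal 1 := by
    have h := (luxNorm_le_one_iff he u).1 hu
    rw [mixedModular_eq he] at h
    rw [ENNReal.ofReal_one]
    exact (ENNReal.le_tsum ν).trans h
  rw [ExponentPair.level_le_ofReal_iff one_pos] at h1
  have h2 : ∀ x, ‖u.seq ν x‖ₑ ≤ 1 + ENNReal.ofReal (|‖u.seq ν x‖| ^ e.P x * 1 ^ (-e.S x)) := by
    intro x
    have hP := e.one_lt_P x
    rw [← ofReal_norm, abs_norm, Real.one_rpow, mul_one, ← ENNReal.ofReal_one,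
      ← ENNReal.ofReal_add zero_le_one (by positivity)]
    refine ENNReal.ofReal_le_ofReal ?_
    rcases le_total ‖u.seq ν x‖ 1 with h | h
    · have : 0 ≤ ‖u.seq ν x‖ ^ e.P x := by positivity
      linarith
    · have := Real.rpow_le_rpow_of_exponent_le h hP.le
      rw [Real.rpow_one] at this
      linarith
  calc ∫⁻ x, ‖u.seq ν x‖ₑ ∂m
      ≤ ∫⁻ x, (1 + ENNReal.ofReal (|‖u.seq ν x‖| ^ e.P x * 1 ^ (-e.S x))) ∂m := lintegral_mono h2
    _ = m Set.univ + ∫⁻ x, ENNReal.ofReal (|‖u.seq ν x‖| ^ e.P x * 1 ^ (-e.S x)) ∂m := by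
      rw [lintegral_add_left measurable_const, lintegral_one]
    _ ≤ m Set.univ + 1 := by
      gcongr
      exact (lintegral_mono' hm le_rfl).trans h1

/-- The unit ball is closed under convergence almost everywhere. -/
lemma exists_limit_mem_ball (he : Represents e p q) {u : ℕ → MixedSpace 𝕜 p q}
    (hu : ∀ k, luxNorm (u k) ≤ 1) {f : ℕ → EuclideanSpace ℝ (Fin n) → 𝕜}
    (hf : ∀ ν, AEStronglyMeasurable (f ν))
    (hlim : ∀ ν, ∀ᵐ x, Tendsto (fun k => (u k).seq ν x) atTop (𝓝 (f ν x))) :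
    ∃ v : MixedSpace 𝕜 p q, luxNorm v ≤ 1 ∧ ∀ ν, ∀ᵐ x, v.seq ν x = f ν x := by
  have h1 : mixedModular p q f ≤ 1 := by
    -- Fatou is used twice: for each level in x, and for the sum over ν written as an integral.
    rw [mixedModular_eq he, ← lintegral_count]
    calc ∫⁻ ν, e.level volume (fun x => ‖f ν x‖) ∂Measure.count
        ≤ ∫⁻ ν, liminf (fun k => e.level volume fun x => ‖(u k).seq ν x‖) atTop
            ∂Measure.count := by
          refine lintegral_mono fun ν => ExponentPair.level_le_liminf
            (fun k => (measurable_norm_seq (u k) ν).aemeasurable) ?_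
          filter_upwards [hlim ν] with x hx using hx.norm
      _ ≤ liminf (fun k => ∫⁻ ν, e.level volume (fun x => ‖(u k).seq ν x‖) ∂Measure.count)
            atTop := lintegral_liminf_le fun k => measurable_of_countable _
      _ ≤ 1 := by
          refine liminf_le_of_frequently_le' (Frequently.of_forall fun k => ?_)
          rw [lintegral_count, ← mixedModular_eq he]
          exact (luxNorm_le_one_iff he (u k)).1 (hu k)
  refine ⟨mkMixed f hf (h1.trans_lt ENNReal.one_lt_top), (luxNorm_le_one_iff he _).2 ?_,
    mkMixed_seq _ _ _⟩
  exact (mixedModular_congr (mkMixed_seq _ _ _)).le.trans h1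

/-- A functional is at least `a` at a limit almost everywhere of a bounded sequence along which its
values are asymptotically at least `a`. -/
lemma le_re_apply_of_tendsto_ae (he : Represents e p q) [Fact (LuxTriangle 𝕜 p q)]
    {u : ℕ → MixedSpace 𝕜 p q} (hu : ∀ k, ‖u k‖ ≤ 1) {v : MixedSpace 𝕜 p q} (hv : ‖v‖ ≤ 1)
    (hlim : ∀ ν, ∀ᵐ x, Tendsto (fun k => (u k).seq ν x) atTop (𝓝 (v.seq ν x)))
    (z : StrongDual 𝕜 (MixedSpace 𝕜 p q)) {a : ℝ}
    (ha : ∀ ε : ℝ, 0 < ε → ∀ᶠ k in atTop, a - ε ≤ RCLike.re (z (u k))) :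
    a ≤ RCLike.re (z v) := by
  refine le_of_forall_pos_le_add fun ε hε => ?_
  obtain ⟨j, hj⟩ := eventually_atTop.1 (ha (ε / 2) (by positivity))
  set d : ℕ → MixedSpace 𝕜 p q := fun k => (2⁻¹ : 𝕜) • (u k - v) with hd
  have hd1 : ∀ k, ‖d k‖ ≤ 1 := by
    intro k
    rw [hd, norm_smul, norm_inv, RCLike.norm_ofNat]
    linarith [norm_sub_le (u k) v, hu k]
  have hd0 : ∀ ν, ∀ᵐ x, Tendsto (fun k => (d k).seq ν x) atTop (𝓝 0) := by
    intro ν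
    filter_upwards [hlim ν, ae_all_iff.2 fun k => seq_smul (2⁻¹ : 𝕜) (u k - v) ν,
      ae_all_iff.2 fun k => seq_sub (u k) v ν] with x h1 h2 h3
    have h4 := (h1.sub_const (v.seq ν x)).const_mul (2⁻¹ : 𝕜)
    rw [sub_self, mul_zero] at h4
    refine h4.congr fun k => ?_
    rw [hd, h2 k, h3 k]
  -- As d k is half of u k - v, the average enters with a factor 2, and 2‖z‖η ≤ ε/2.
  set η : ℝ := ε / (4 * (‖z‖ + 1)) with hη
  have hz : 0 < ‖z‖ + 1 := by positivity
  obtain ⟨s, hs, hsj, hsn⟩ := exists_average_small he hd1 hd0 (show 0 < η by positivity) j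
  have hcard : (0 : ℝ) < s.card := by exact_mod_cast hs.card_pos
  have h1 : (s.card : ℝ) * (a - ε / 2 - RCLike.re (z v)) ≤
      2 * RCLike.re (z (∑ k ∈ s, d k)) := by
    have h2 : 2 * RCLike.re (z (∑ k ∈ s, d k)) =
        ∑ k ∈ s, (RCLike.re (z (u k)) - RCLike.re (z v)) := by
      rw [map_sum, map_sum, Finset.mul_sum]
      refine Finset.sum_congr rfl fun k _ => ?_
      have h3 : (2⁻¹ : 𝕜) = ((2⁻¹ : ℝ) : 𝕜) := by push_cast; rfl
      rw [hd, map_smul, h3, smul_eq_mul, RCLike.re_ofReal_mul, map_sub, map_sub]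
      ring
    rw [h2, ← nsmul_eq_mul]
    refine Finset.card_nsmul_le_sum _ _ _ fun k hk => ?_
    linarith [hj k (hsj k hk)]
  have h4 : RCLike.re (z (∑ k ∈ s, d k)) ≤ ‖z‖ * (s.card * η) :=
    (RCLike.re_le_norm _).trans ((z.le_opNorm _).trans (by gcongr))
  have h5 : ‖z‖ * η ≤ ε / 4 := by
    rw [hη, mul_div_assoc', div_le_div_iff₀ (by positivity) (by norm_num)]
    nlinarith [norm_nonneg z]
  have h6 : (s.card : ℝ) * (a - ε / 2 - RCLike.re (z v)) ≤ s.card * (ε / 2) := by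
    calc _ ≤ 2 * (‖z‖ * (s.card * η)) := h1.trans (by linarith)
      _ = s.card * (2 * (‖z‖ * η)) := by ring
      _ ≤ s.card * (ε / 2) := by gcongr; linarith
  have h7 := le_of_mul_le_mul_left h6 hcard
  linarith

/-- Joint approximate bounds of two functionals on the unit ball are attained. -/
lemma exists_attains (he : Represents e p q) [Fact (LuxTriangle 𝕜 p q)]
    (x y : StrongDual 𝕜 (MixedSpace 𝕜 p q)) (a b : ℝ)
    (h : ∀ ε : ℝ, 0 < ε → ∃ u : MixedSpace 𝕜 p q,
      ‖u‖ ≤ 1 ∧ a - ε ≤ RCLike.re (x u) ∧ b - ε ≤ RCLike.re (y u)) :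
    ∃ u : MixedSpace 𝕜 p q, ‖u‖ ≤ 1 ∧ a ≤ RCLike.re (x u) ∧ b ≤ RCLike.re (y u) := by
  obtain ⟨m0, hm0, hle, hae⟩ :=
    exists_finite_measure_le (volume : Measure (EuclideanSpace ℝ (Fin n)))
  -- A finite measure on the indices whose only null set is empty: convergence almost everywhere for
  -- the product is convergence almost everywhere in every component.
  set c : Measure ℕ := (Measure.count : Measure ℕ).toFinite
  have hc : ∀ P : ℕ → Prop, (∀ᵐ ν ∂c, P ν) ↔ ∀ ν, P ν := fun P => by
    rw [ae_toFinite, Measure.ae_count_iff]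
  have hr : ∀ k : ℕ, (0 : ℝ) < 1 / ((k : ℝ) + 1) := fun k => by positivity
  set C : ℕ → Set (MixedSpace 𝕜 p q) := fun k => {u | ‖u‖ ≤ 1 ∧
    a - 1 / ((k : ℝ) + 1) ≤ RCLike.re (x u) ∧ b - 1 / ((k : ℝ) + 1) ≤ RCLike.re (y u)} with hC
  have hanti : Antitone C := by
    rintro i j hij u ⟨h1, h2, h3⟩
    have h4 : 1 / ((j : ℝ) + 1) ≤ 1 / ((i : ℝ) + 1) := by gcongr
    exact ⟨h1, by linarith, by linarith⟩
  obtain ⟨u, f, huC, hf, hlim⟩ := exists_seq_tendsto_ae (m := c.prod m0) hanti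
    (fun k => h _ (hr k)) (rep := fun u z => u.seq z.1 z.2) stronglyMeasurable_uncurry_seq
    (B := (m0 Set.univ + 1) * c Set.univ)
    (ENNReal.mul_lt_top (ENNReal.add_lt_top.2 ⟨measure_lt_top _ _, ENNReal.one_lt_top⟩)
      (measure_lt_top _ _))
    (by
      rintro u ⟨hu, -⟩
      rw [lintegral_prod _ (stronglyMeasurable_uncurry_seq u).enorm.aemeasurable]
      refine (lintegral_mono fun ν => lintegral_enorm_seq_le he hu hle ν).trans ?_
      rw [lintegral_const])
    (by
      rintro k u ⟨hu1, hu2, hu3⟩ v ⟨hv1, hv2, hv3⟩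
      have h2 : (2⁻¹ : 𝕜) = ((2⁻¹ : ℝ) : 𝕜) := by push_cast; rfl
      have hre : ∀ z : StrongDual 𝕜 (MixedSpace 𝕜 p q),
          RCLike.re (z ((2⁻¹ : 𝕜) • (u + v))) = 2⁻¹ * (RCLike.re (z u) + RCLike.re (z v)) := by
        intro z
        rw [map_smul, h2, smul_eq_mul, RCLike.re_ofReal_mul, map_add, map_add]
      refine ⟨(2⁻¹ : 𝕜) • (u + v), ⟨?_, ?_, ?_⟩, ?_⟩
      · rw [norm_smul, norm_inv, RCLike.norm_ofNat]
        linarith [norm_add_le u v]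
      · rw [hre]; linarith
      · rw [hre]; linarith
      · rw [Measure.ae_prod_iff_ae_ae, hc]
        · intro ν
          rw [hae]
          filter_upwards [seq_smul (2⁻¹ : 𝕜) (u + v) ν, seq_add u v ν] with t h3 h4
          rw [h3, h4]
        · exact measurableSet_eq_fun (stronglyMeasurable_uncurry_seq _).measurable
            (((stronglyMeasurable_uncurry_seq u).add
              (stronglyMeasurable_uncurry_seq v)).measurable.const_mul _))
  have hlim' : ∀ ν, ∀ᵐ t, Tendsto (fun k => (u k).seq ν t) atTop (𝓝 (f (ν, t))) := by
    have h1 := (hc _).1 (Measure.ae_ae_of_ae_prod hlim)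
    rwa [hae] at h1
  obtain ⟨v, hv, hvf⟩ := exists_limit_mem_ball he (fun k => (huC k).1)
    (f := fun ν t => f (ν, t))
    (fun ν => (hf.comp_measurable measurable_prodMk_left).aestronglyMeasurable) hlim'
  have hlimv : ∀ ν, ∀ᵐ t, Tendsto (fun k => (u k).seq ν t) atTop (𝓝 (v.seq ν t)) := by
    intro ν
    filter_upwards [hlim' ν, hvf ν] with t h1 h2
    rwa [h2]
  have hsmall : ∀ ε : ℝ, 0 < ε → ∀ᶠ k : ℕ in atTop, 1 / ((k : ℝ) + 1) ≤ ε := fun ε hε =>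
    tendsto_one_div_add_atTop_nhds_zero_nat.eventually_le_const hε
  refine ⟨v, hv, ?_, ?_⟩
  · refine le_re_apply_of_tendsto_ae he (fun k => (huC k).1) hv hlimv x fun ε hε => ?_
    filter_upwards [hsmall ε hε] with k hk
    linarith [(huC k).2.1]
  · refine le_re_apply_of_tendsto_ae he (fun k => (huC k).1) hv hlimv y fun ε hε => ?_
    filter_upwards [hsmall ε hε] with k hk
    linarith [(huC k).2.2]

end VarMixed

theorem mainTheorem3 {𝕜 : Type*} [RCLike 𝕜] {n : ℕ} (p q : VarExponent n)
    (hp : 1 < p.minus) (hp' : p.plus < ∞) (hq : 1 < q.minus) (hq' : q.plus < ∞)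
    [Fact (VarMixed.LuxTriangle 𝕜 p q)] :
    IsGateauxSmooth 𝕜 (StrongDual 𝕜 (VarMixed.MixedSpace 𝕜 p q)) := by
  obtain ⟨e, he⟩ := VarMixed.exists_represents p q hp hp' hq hq'
  exact isGateauxSmooth_dual (fun _ _ => VarMixed.eq_of_norm_add_eq_two he)
    (VarMixed.exists_attains he)
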